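/- Let $g,d,h,Q_1,Q_2,p_1,p_2,x_0\in\mathbb R$, let $\rho_1,\rho_2:\mathbb R\to\mathbb R$ be $C^1$ and $\beta_1,\beta_2:\mathbb R\to\mathbb R$ continuous. For $i=1,2$ let $F_i$ be such that for every $y\in[-d,h)$ the function $F_i(y,\cdot):\mathbb R\to\mathbb R$ is $C^2$ with nowhere vanishing second derivative and $$(\partial_2F_i(y,\cdot))^{-1}(p)=f_i(y,p):=g\,y\,\rho_i'(p)-\beta_i(-p),\qquad p\in\mathbb R .$$ This determines $F_i$ up to an additive function of $y$, which is fixed by requiring, for $y\in[-d,h)$, $$F_2(y,f_2(y,p_2))=g(\rho_2(0)-\rho_2(p_2))(y+d),\qquad F_1(y,f_1(y,0))=F_2(y,f_2(y,0))+g(\rho_1(p_1)-\rho_1(0))(y+d).$$ Let $\eta,\widetilde\eta:\mathbb R\to\mathbb R$ be $2\pi$-periodic and $C^2$ with $-d<\widetilde\eta<\eta<h$, put $$\Omega_1=\{-\pi<x<\pi,\,-d<y<\widetilde\eta(x)\},\qquad \Omega_2=\{-\pi<x<\pi,\ \widetilde\eta(x)<y<\eta(x)\},$$ and let $\Psi_i$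 be $2\pi$-periodic in $x$ and $C^2$ up to the boundary of the $i$-th layer (extended to a periodic $C^2$ function on $\mathbb R^2$). Consider $$H(\Psi_1,\Psi_2,\eta,\widetilde\eta)=\iint_{\Omega_1}\Big[\tfrac{|\nabla\Psi_1|^2}{2}+g\rho_1(p_1)(y+d)-(Q_1+Q_2)-F_1(y,\Delta\Psi_1)\Big]dy\,dx+\iint_{\Omega_2}\Big[\tfrac{|\nabla\Psi_2|^2}{2}+g\rho_2(0)(y+d)-Q_2-F_2(y,\Delta\Psi_2)\Big]dy\,dx .$$ Call $(\Psi_1,\Psi_2,\eta,\widetilde\eta)$ a critical point of $H$ if $\frac{d}{d\epsilon}H(\Psi_1+\epsilon\Psi_{1p},\Psi_2+\epsilon\Psi_{2p},\eta+\epsilon\eta_p,\widetilde\eta+\epsilon\widetilde\eta_p)\big|_{\epsilon=0}$ exists and is $0$ for all $2\pi$-periodic $C^2$ perturbations in the class $$\mathbb P=\Big\{(\Psi_{1p},\Psi_{2p},\eta_p,\widetilde\eta_p):\ \int_{y=-d}\partial_y\Psi_{1p}\,dx=0,\quad \int_{y=\eta(x)}\frac{\partial\Psi_{2p}}{\partial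 n}\,dl=0\Big\}$$ (integrals over one period, $n$ the upward unit normal, $dl$ arc length). Then the following are equivalent. (a) $(\Psi_1,\Psi_2,\eta,\widetilde\eta)$ is a critical point of $H$, and $p_1,p_2$ are its fluxes at $x_0$: $p_1=\int_{-d}^{\widetilde\eta(x_0)}\partial_y\Psi_1(x_0,y)\,dy$, $p_2=-\int_{\widetilde\eta(x_0)}^{\eta(x_0)}\partial_y\Psi_2(x_0,y)\,dy$. (b) There are constants $k_1,k_2\in\mathbb R$ such that $(\Psi_1-k_1,\Psi_2-k_2,\eta,\widetilde\eta)$, written again $(\Psi_1,\Psi_2,\eta,\widetilde\eta)$, solves $$\begin{cases}\Delta\Psi_i=gy\rho_i'(-\Psi_i)-\beta_i(\Psi_i)&\text{in }\Omega_i,\ i=1,2,\\ \tfrac12|\nabla\Psi_2|^2+g\rho_2(-\Psi_2)(y+d)=Q_2&\text{on }y=\eta(x),\\ \tfrac12(|\nabla\Psi_1|^2-|\nabla\Psi_2|^2)+g(\rho_1(-\Psi_1)-\rho_2(-\Psi_2))(y+d)=Q_1&\text{on }y=\widetilde\eta(x),\\ \Psi_1=\Psi_2=0&\text{on }y=\widetilde\eta(x),\\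 \Psi_1=-p_1&\text{on }y=-d,\\ \Psi_2=-p_2&\text{on }y=\eta(x).\end{cases}$$ In particular, for every $(\Psi_1,\Psi_2,\eta,\widetilde\eta)$ there are constants $p_1,p_2$, namely its fluxes, for which being a critical point of $H$ is equivalent to solving this system up to additive constants in $\Psi_1$, $\Psi_2$. -/

import Mathlib

namespace TwoLayer

open Real Set

noncomputable section

/-- Partial derivative in the horizontal variable. -/
def dx (Ψ : ℝ × ℝ → ℝ) (z : ℝ × ℝ) : ℝ := deriv (fun s => Ψ (s, z.2)) z.1

/-- Partial derivative in the vertical variable. -/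
def dy (Ψ : ℝ × ℝ → ℝ) (z : ℝ × ℝ) : ℝ := deriv (fun t => Ψ (z.1, t)) z.2

/-- The squared length of the gradient. -/
def gradSq (Ψ : ℝ × ℝ → ℝ) (z : ℝ × ℝ) : ℝ := dx Ψ z ^ 2 + dy Ψ z ^ 2

/-- The Laplacian in the plane. -/
def lap (Ψ : ℝ × ℝ → ℝ) (z : ℝ × ℝ) : ℝ :=
  iteratedDeriv 2 (fun s => Ψ (s, z.2)) z.1 + iteratedDeriv 2 (fun t => Ψ (z.1, t)) z.2

/-- Stream functions of the lower and of the upper layer, the profile of the internal interface and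
the profile of the free surface (or perturbations of these four functions). A function that is
`C²` up to the boundary of a layer is represented by a `C²` extension to the plane. -/
structure Flow where
  Ψ₁ : ℝ × ℝ → ℝ
  Ψ₂ : ℝ × ℝ → ℝ
  ηi : ℝ → ℝ
  ηs : ℝ → ℝ

/-- All four functions are `C²` and `2π`-periodic in the horizontal variable. -/
structure Flow.IsClassical (S : Flow) : Prop where
  smooth_lower : ContDiff ℝ 2 S.Ψ₁
  smooth_upper : ContDiff ℝ 2 S.Ψ₂
  smooth_interface : ContDiff ℝ 2 S.ηi
  smooth_surface : ContDiff ℝ 2 S.ηs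
  periodic_lower : ∀ x y, S.Ψ₁ (x + 2 * π, y) = S.Ψ₁ (x, y)
  periodic_upper : ∀ x y, S.Ψ₂ (x + 2 * π, y) = S.Ψ₂ (x, y)
  periodic_interface : ∀ x, S.ηi (x + 2 * π) = S.ηi x
  periodic_surface : ∀ x, S.ηs (x + 2 * π) = S.ηs x

/-- The bottom `y = -d`, the interface and the surface are ordered and lie below height `h`. -/
def Flow.IsLayered (S : Flow) (d h : ℝ) : Prop :=
  ∀ x, -d < S.ηi x ∧ S.ηi x < S.ηs x ∧ S.ηs x < h

/-- The lower layer (one period). -/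
def Flow.lower (S : Flow) (d : ℝ) : Set (ℝ × ℝ) :=
  {z | z.1 ∈ Ioo (-π) π ∧ -d < z.2 ∧ z.2 < S.ηi z.1}

/-- The upper layer (one period). -/
def Flow.upper (S : Flow) : Set (ℝ × ℝ) :=
  {z | z.1 ∈ Ioo (-π) π ∧ S.ηi z.1 < z.2 ∧ z.2 < S.ηs z.1}

/-- The perturbed tuple `S + ε P`. -/
def Flow.perturb (S P : Flow) (ε : ℝ) : Flow where
  Ψ₁ := fun z => S.Ψ₁ z + ε * P.Ψ₁ z
  Ψ₂ := fun z => S.Ψ₂ z + ε * P.Ψ₂ z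
  ηi := fun x => S.ηi x + ε * P.ηi x
  ηs := fun x => S.ηs x + ε * P.ηs x

/-- Subtracting constants from the two stream functions. -/
def Flow.shift (S : Flow) (k₁ k₂ : ℝ) : Flow where
  Ψ₁ := fun z => S.Ψ₁ z - k₁
  Ψ₂ := fun z => S.Ψ₂ z - k₂
  ηi := S.ηi
  ηs := S.ηs

/-- The derivative of `Ψ` along the upward unit normal of the graph of `η`, over the point `x`. -/
def normalDeriv (Ψ : ℝ × ℝ → ℝ) (η : ℝ → ℝ) (x : ℝ) : ℝ :=
  (dy Ψ (x, η x) - deriv η x * dx Ψ (x, η x)) / √(1 + deriv η x ^ 2)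

/-- The admissible perturbations of `S`: those of class `C²` and periodic whose vertical derivative
has mean zero on the bottom and whose normal derivative has mean zero, with respect to arc length,
on the free surface of `S`. -/
structure Flow.IsPerturbation (S : Flow) (d : ℝ) (P : Flow) : Prop where
  classical : P.IsClassical
  bottom : ∫ x in (-π)..π, dy P.Ψ₁ (x, -d) = 0
  surface : ∫ x in (-π)..π, normalDeriv P.Ψ₂ S.ηs x * √(1 + deriv S.ηs x ^ 2) = 0

/-- The `C²` functions of one variable whose second derivative vanishes nowhere. -/
def classG : Set (ℝ → ℝ) := {G | ContDiff ℝ 2 G ∧ ∀ q, iteratedDeriv 2 G q ≠ 0}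

/-- The vorticity `g y ρ'(p) - β(-p)`. -/
def vort (g : ℝ) (ρ β : ℝ → ℝ) (y p : ℝ) : ℝ := g * y * deriv ρ p - β (-p)

/-- For every height `y` in `[-d, h)` the function `F y` is in the class above and the inverse
function of its derivative is `p ↦ g y ρ'(p) - β(-p)`, `p ∈ ℝ`. -/
def IsPotential (g d h : ℝ) (ρ β : ℝ → ℝ) (F : ℝ → ℝ → ℝ) : Prop :=
  ∀ y ∈ Ico (-d) h, F y ∈ classG ∧
    Function.LeftInverse (deriv (F y)) (vort g ρ β y) ∧
    Function.RightInverse (deriv (F y)) (vort g ρ β y)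

/-- The additive function of `y` up to which each of `F₁`, `F₂` is determined is fixed by their
values at the vorticities of the free surface and of the interface. -/
def IsNormalized (g d h p₁ p₂ : ℝ) (ρ₁ ρ₂ β₁ β₂ : ℝ → ℝ) (F₁ F₂ : ℝ → ℝ → ℝ) : Prop :=
  ∀ y ∈ Ico (-d) h,
    F₂ y (vort g ρ₂ β₂ y p₂) = g * (ρ₂ 0 - ρ₂ p₂) * (y + d) ∧
    F₁ y (vort g ρ₁ β₁ y 0) = F₂ y (vort g ρ₂ β₂ y 0) + g * (ρ₁ p₁ - ρ₁ 0) * (y + d)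

/-- The energy functional. -/
def energy (g d Q₁ Q₂ p₁ : ℝ) (ρ₁ ρ₂ : ℝ → ℝ) (F₁ F₂ : ℝ → ℝ → ℝ) (S : Flow) : ℝ :=
  (∫ x in (-π)..π, ∫ y in (-d)..(S.ηi x),
    (gradSq S.Ψ₁ (x, y) / 2 + g * ρ₁ p₁ * (y + d) - (Q₁ + Q₂) - F₁ y (lap S.Ψ₁ (x, y)))) +
  ∫ x in (-π)..π, ∫ y in (S.ηi x)..(S.ηs x),
    (gradSq S.Ψ₂ (x, y) / 2 + g * ρ₂ 0 * (y + d) - Q₂ - F₂ y (lap S.Ψ₂ (x, y)))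

/-- `S` is a critical point of `H`: along every admissible perturbation the first variation of `H`
exists and vanishes. -/
def IsCritical (d : ℝ) (H : Flow → ℝ) (S : Flow) : Prop :=
  ∀ P : Flow, S.IsPerturbation d P → HasDerivAt (fun ε : ℝ => H (S.perturb P ε)) 0 0

/-- The system for steady stratified waves in two layers. -/
structure Solves (g d Q₁ Q₂ p₁ p₂ : ℝ) (ρ₁ ρ₂ β₁ β₂ : ℝ → ℝ) (S : Flow) : Prop where
  eq_lower : ∀ z ∈ S.lower d, lap S.Ψ₁ z = g * z.2 * deriv ρ₁ (-S.Ψ₁ z) - β₁ (S.Ψ₁ z)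
  eq_upper : ∀ z ∈ S.upper, lap S.Ψ₂ z = g * z.2 * deriv ρ₂ (-S.Ψ₂ z) - β₂ (S.Ψ₂ z)
  bernoulli_surface : ∀ x, gradSq S.Ψ₂ (x, S.ηs x) / 2
    + g * ρ₂ (-S.Ψ₂ (x, S.ηs x)) * (S.ηs x + d) = Q₂
  bernoulli_interface : ∀ x,
    (gradSq S.Ψ₁ (x, S.ηi x) - gradSq S.Ψ₂ (x, S.ηi x)) / 2
      + g * (ρ₁ (-S.Ψ₁ (x, S.ηi x)) - ρ₂ (-S.Ψ₂ (x, S.ηi x))) * (S.ηi x + d) = Q₁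
  interface_lower : ∀ x, S.Ψ₁ (x, S.ηi x) = 0
  interface_upper : ∀ x, S.Ψ₂ (x, S.ηi x) = 0
  bottom : ∀ x, S.Ψ₁ (x, -d) = -p₁
  surface : ∀ x, S.Ψ₂ (x, S.ηs x) = -p₂

/-- The fluxes through the vertical section over `x₀` are `p₁` in the lower layer and `-p₂` in the
upper layer. -/
def Flow.HasFluxes (S : Flow) (d p₁ p₂ x₀ : ℝ) : Prop :=
  (∫ y in (-d)..(S.ηi x₀), dy S.Ψ₁ (x₀, y)) = p₁ ∧
  -(∫ y in (S.ηi x₀)..(S.ηs x₀), dy S.Ψ₂ (x₀, y)) = p₂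

end

end TwoLayer

/-!
Critical points of the two-layer energy are exactly the steady stratified waves.

*First variation.* The inverse `γ = ∂_q F` of the vorticity function is jointly continuous in the
height and the vorticity, although nothing is assumed about the dependence of `F` on the height
(`continuous_uncurry_inverse`), and with the normalisation so is `F`. Hence the energy can be
differentiated (`hasDerivAt_energy`); with `u = γ(y, ΔΨ)` the variation of a layer in the stream
function is `∬ ∇Ψ·∇φ - u Δφ`, and the variations of the profiles give the boundary values of the
energy density. If `u = k - Ψ` and `Ψ` is constant on the boundary components, Green's identity
turns this integral into fluxes of `φ` that vanish for admissible perturbations. This is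
sufficiency (`EulerLagrange.firstVariation_eq_zero`).

*Necessity.* The core is a rigidity statement (`layer_rigidity`): if `∬_Ω ∇ψ·∇φ - u Δφ = 0` for all
periodic `φ`, with no boundary condition on `φ`, then `u + ψ` is constant and `u` vanishes on the
boundary. Here `u` is only continuous, so integration by parts is not available. Instead let `v` and
`g` be the extensions by zero of `u` and `∇ψ`. The hypothesis says that `Δv = -div g` on the whole
cylinder. Comparing Fourier coefficients, `∇v` is square integrable and `M = g + ∇v` is divergence
free. As `M` vanishes off the layer, where `g` and `v` do, and `g` is a gradient in the layer,
`⟨M, g⟩ = ⟨M, ∇ψ⟩ = 0`; and `⟨M, ∇v⟩ = 0`. So `M = 0` (`repr_eq_neg_weak_derivative`): the extension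
`v` has the weak gradient `-g`. The vertical component of this identity, with suitable test
functions, shows that `u + ψ = ψ(x, b(x)) = ψ(x, a(x))` on each vertical from `a(x)` to `b(x)`;
thus `u` is `C²` after all, and testing with `φ = ψ(x, b(x))` shows that this function is constant.

The condition of zero flux through the bottom or the surface adds a Lagrange multiplier, which
changes the value of `ψ` on that boundary component by a constant (`layer_rigidity_of_flux`). That
constant is the flux `p₁` or `p₂`, and the normalisation of `F₁`, `F₂` turns the boundary values of
the energy density into the two Bernoulli conditions (`eulerLagrange_iff_solves`).
-/

namespace TwoLayer

open Real Set MeasureTheory Filter Topology intervalIntegral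

/-! ### Partial derivatives in the plane -/

theorem hasDerivAt_dx {Ψ : ℝ × ℝ → ℝ} (h : ContDiff ℝ 1 Ψ) (x y : ℝ) :
    HasDerivAt (fun s => Ψ (s, y)) (dx Ψ (x, y)) x := by
  have : DifferentiableAt ℝ (fun s => Ψ (s, y)) x :=
    ((h.differentiable one_ne_zero) (x, y)).comp x
      (differentiableAt_id.prodMk (differentiableAt_const y))
  exact this.hasDerivAt

theorem hasDerivAt_dy {Ψ : ℝ × ℝ → ℝ} (h : ContDiff ℝ 1 Ψ) (x y : ℝ) :
    HasDerivAt (fun t => Ψ (x, t)) (dy Ψ (x, y)) y := by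
  have : DifferentiableAt ℝ (fun t => Ψ (x, t)) y :=
    ((h.differentiable one_ne_zero) (x, y)).comp y
      ((differentiableAt_const x).prodMk differentiableAt_id)
  exact this.hasDerivAt

theorem dx_eq_fderiv {Ψ : ℝ × ℝ → ℝ} (h : ContDiff ℝ 1 Ψ) :
    dx Ψ = fun z => fderiv ℝ Ψ z (1, 0) := by
  funext ⟨x, y⟩
  have h1 := ((h.differentiable one_ne_zero) (x, y)).hasFDerivAt
  have h2 : HasDerivAt (fun s : ℝ => (s, y)) ((1 : ℝ), (0 : ℝ)) x :=
    (hasDerivAt_id x).prodMk (hasDerivAt_const x y)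
  exact (h1.comp_hasDerivAt (f := fun s : ℝ => (s, y)) x h2).deriv

theorem dy_eq_fderiv {Ψ : ℝ × ℝ → ℝ} (h : ContDiff ℝ 1 Ψ) :
    dy Ψ = fun z => fderiv ℝ Ψ z (0, 1) := by
  funext ⟨x, y⟩
  have h1 := ((h.differentiable one_ne_zero) (x, y)).hasFDerivAt
  have h2 : HasDerivAt (fun t : ℝ => (x, t)) ((0 : ℝ), (1 : ℝ)) y :=
    (hasDerivAt_const y x).prodMk (hasDerivAt_id y)
  exact (h1.comp_hasDerivAt (f := fun t : ℝ => (x, t)) y h2).deriv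

theorem contDiff_dx {Ψ : ℝ × ℝ → ℝ} (h : ContDiff ℝ 2 Ψ) : ContDiff ℝ 1 (dx Ψ) := by
  rw [dx_eq_fderiv (h.of_le one_le_two)]
  exact (h.fderiv_right (m := 1) (by norm_num)).clm_apply contDiff_const

theorem contDiff_dy {Ψ : ℝ × ℝ → ℝ} (h : ContDiff ℝ 2 Ψ) : ContDiff ℝ 1 (dy Ψ) := by
  rw [dy_eq_fderiv (h.of_le one_le_two)]
  exact (h.fderiv_right (m := 1) (by norm_num)).clm_apply contDiff_const

theorem continuous_dx {Ψ : ℝ × ℝ → ℝ} (h : ContDiff ℝ 1 Ψ) : Continuous (dx Ψ) := by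
  rw [dx_eq_fderiv h]
  exact (h.continuous_fderiv one_ne_zero).clm_apply continuous_const

theorem continuous_dy {Ψ : ℝ × ℝ → ℝ} (h : ContDiff ℝ 1 Ψ) : Continuous (dy Ψ) := by
  rw [dy_eq_fderiv h]
  exact (h.continuous_fderiv one_ne_zero).clm_apply continuous_const

theorem lap_eq (Ψ : ℝ × ℝ → ℝ) (z : ℝ × ℝ) : lap Ψ z = dx (dx Ψ) z + dy (dy Ψ) z := by
  simp only [lap, dx, dy, iteratedDeriv_succ, iteratedDeriv_zero]

theorem continuous_lap {Ψ : ℝ × ℝ → ℝ} (h : ContDiff ℝ 2 Ψ) : Continuous (lap Ψ) := by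
  rw [funext (lap_eq Ψ)]
  exact (continuous_dx (contDiff_dx h)).add (continuous_dy (contDiff_dy h))

theorem continuous_gradSq {Ψ : ℝ × ℝ → ℝ} (h : ContDiff ℝ 1 Ψ) : Continuous (gradSq Ψ) :=
  ((continuous_dx h).pow 2).add ((continuous_dy h).pow 2)

section Periodic

variable {Ψ : ℝ × ℝ → ℝ} {T : ℝ}

theorem dx_periodic (h : ∀ x y, Ψ (x + T, y) = Ψ (x, y)) (x y : ℝ) :
    dx Ψ (x + T, y) = dx Ψ (x, y) := by
  have := deriv_comp_add_const (fun s => Ψ (s, y)) T x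
  simp only [h] at this
  exact this.symm

theorem dy_periodic (h : ∀ x y, Ψ (x + T, y) = Ψ (x, y)) (x y : ℝ) :
    dy Ψ (x + T, y) = dy Ψ (x, y) := by
  simp only [dy, h]

theorem lap_periodic (h : ∀ x y, Ψ (x + T, y) = Ψ (x, y)) (x y : ℝ) :
    lap Ψ (x + T, y) = lap Ψ (x, y) := by
  rw [lap_eq, lap_eq, dx_periodic (dx_periodic h), dy_periodic (dy_periodic h)]

theorem deriv_periodic {f : ℝ → ℝ} (h : ∀ x, f (x + T) = f x) (x : ℝ) :
    deriv f (x + T) = deriv f x := by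
  have := deriv_comp_add_const f T x
  simp only [h] at this
  exact this.symm

end Periodic

/-! ### Differentiation under the integral sign -/

theorem hasDerivAt_integral_of_continuous {L L' : ℝ → ℝ → ℝ}
    (hL : Continuous (Function.uncurry L)) (hL' : Continuous (Function.uncurry L'))
    (hd : ∀ s y, HasDerivAt (fun s => L s y) (L' s y) s) (a b s₀ : ℝ) :
    HasDerivAt (fun s => ∫ y in a..b, L s y) (∫ y in a..b, L' s₀ y) s₀ := by
  obtain ⟨C, hC⟩ := ((isCompact_closedBall s₀ 1).prod
    (isCompact_uIcc (a := a) (b := b))).exists_bound_of_continuousOn hL'.continuousOn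
  refine (intervalIntegral.hasDerivAt_integral_of_dominated_loc_of_deriv_le
    (F := L) (F' := L') (bound := fun _ => C) (Metric.ball_mem_nhds s₀ one_pos) ?_ ?_ ?_ ?_ ?_ ?_).2
  · exact Eventually.of_forall fun s =>
      (hL.comp (Continuous.prodMk_right s)).aestronglyMeasurable
  · exact (hL.comp (Continuous.prodMk_right s₀)).intervalIntegrable _ _
  · exact (hL'.comp (Continuous.prodMk_right s₀)).aestronglyMeasurable
  · refine Eventually.of_forall fun y hy s hs => hC (s, y) ⟨Metric.ball_subset_closedBall hs, ?_⟩
    exact uIoc_subset_uIcc hy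
  · exact intervalIntegrable_const
  · exact Eventually.of_forall fun y _ s _ => hd s y

/-- Leibniz' rule for an integral whose end points move with the parameter. -/
theorem hasDerivAt_integral_moving {L L' : ℝ → ℝ → ℝ}
    (hL : Continuous (Function.uncurry L)) (hL' : Continuous (Function.uncurry L'))
    (hd : ∀ s y, HasDerivAt (fun s => L s y) (L' s y) s)
    {A B : ℝ → ℝ} {A' B' s₀ : ℝ} (hA : HasDerivAt A A' s₀) (hB : HasDerivAt B B' s₀) :
    HasDerivAt (fun s => ∫ y in (A s)..(B s), L s y)
      ((∫ y in (A s₀)..(B s₀), L' s₀ y) + (B' * L s₀ (B s₀) - A' * L s₀ (A s₀))) s₀ := by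
  -- `G s Y = ∫₀^Y L s` has continuous partial derivatives, so it is differentiable jointly.
  have key : ∀ {Y : ℝ → ℝ} {Y' : ℝ}, HasDerivAt Y Y' s₀ →
      HasDerivAt (fun s => ∫ y in (0 : ℝ)..(Y s), L s y)
        ((∫ y in (0 : ℝ)..(Y s₀), L' s₀ y) + Y' * L s₀ (Y s₀)) s₀ := by
    intro Y Y' hY
    have hst := hasStrictFDerivAt_uncurry_coprod (𝕜 := ℝ) (u := (s₀, Y s₀))
      (f := fun s Y => ∫ y in (0 : ℝ)..Y, L s y)
      (f₁ := fun s Y => ContinuousLinearMap.toSpanSingleton ℝ (∫ y in (0 : ℝ)..Y, L' s y))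
      (f₂ := fun s Y => ContinuousLinearMap.toSpanSingleton ℝ (L s Y))
      (Eventually.of_forall fun v =>
        (hasDerivAt_integral_of_continuous hL hL' hd 0 v.2 v.1).hasFDerivAt)
      (Eventually.of_forall fun v =>
        (intervalIntegral.integral_hasDerivAt_right
          ((hL.comp (Continuous.prodMk_right v.1)).intervalIntegrable _ _)
          ((hL.comp (Continuous.prodMk_right v.1)).stronglyMeasurableAtFilter _ _)
          ((hL.comp (Continuous.prodMk_right v.1)).continuousAt)).hasFDerivAt)
      (by
        refine Continuous.continuousAt ?_
        exact (ContinuousLinearMap.toSpanSingletonCLE (𝕜 := ℝ) (E := ℝ)).continuous.comp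
          (continuous_parametric_primitive_of_continuous hL'))
      (by
        refine Continuous.continuousAt ?_
        exact (ContinuousLinearMap.toSpanSingletonCLE (𝕜 := ℝ) (E := ℝ)).continuous.comp hL)
    have := hst.hasFDerivAt.comp_hasDerivAt (f := fun s => (s, Y s)) s₀
      ((hasDerivAt_id s₀).prodMk hY)
    refine this.congr_deriv ?_
    simp [Function.HasUncurry.uncurry]
  have h := (key hB).sub (key hA)
  have e : ∀ s a b, (∫ y in a..b, L s y) = (∫ y in (0 : ℝ)..b, L s y) - ∫ y in (0 : ℝ)..a, L s y :=
    fun s a b => (intervalIntegral.integral_interval_sub_left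
      ((hL.comp (Continuous.prodMk_right s)).intervalIntegrable _ _)
      ((hL.comp (Continuous.prodMk_right s)).intervalIntegrable _ _)).symm
  have e' : ∀ s a b, (∫ y in a..b, L' s y)
      = (∫ y in (0 : ℝ)..b, L' s y) - ∫ y in (0 : ℝ)..a, L' s y :=
    fun s a b => (intervalIntegral.integral_interval_sub_left
      ((hL'.comp (Continuous.prodMk_right s)).intervalIntegrable _ _)
      ((hL'.comp (Continuous.prodMk_right s)).intervalIntegrable _ _)).symm
  rw [e']
  refine (h.congr_deriv (by ring)).congr_of_eventuallyEq (Eventually.of_forall fun s => ?_)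
  simp [e s (A s)]

/-- The derivative of the integral of a parameter-dependent density over a layer whose boundaries
move linearly in the parameter. -/
theorem hasDerivAt_integral_layer {L L' : ℝ → ℝ × ℝ → ℝ}
    (hL : Continuous (Function.uncurry L)) (hL' : Continuous (Function.uncurry L'))
    (hd : ∀ s z, HasDerivAt (fun s => L s z) (L' s z) s)
    {A A' B B' : ℝ → ℝ} (hA : Continuous A) (hA' : Continuous A') (hB : Continuous B)
    (hB' : Continuous B') (p q : ℝ) :
    HasDerivAt (fun s => ∫ x in p..q, ∫ y in (A x + s * A' x)..(B x + s * B' x), L s (x, y))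
      (∫ x in p..q, ((∫ y in (A x)..(B x), L' 0 (x, y))
        + (B' x * L 0 (x, B x) - A' x * L 0 (x, A x)))) 0 := by
  have hcont : ∀ {M : ℝ → ℝ × ℝ → ℝ}, Continuous (Function.uncurry M) →
      Continuous fun w : ℝ × ℝ => ∫ y in (A w.2 + w.1 * A' w.2)..(B w.2 + w.1 * B' w.2),
        M w.1 (w.2, y) := by
    intro M hM
    have h1 : Continuous (Function.uncurry fun (w : ℝ × ℝ) (y : ℝ) => M w.1 (w.2, y)) :=
      hM.comp (by fun_prop : Continuous fun v : (ℝ × ℝ) × ℝ => (v.1.1, (v.1.2, v.2)))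
    have e : ∀ w : ℝ × ℝ, (∫ y in (A w.2 + w.1 * A' w.2)..(B w.2 + w.1 * B' w.2),
        M w.1 (w.2, y)) = (∫ y in (0 : ℝ)..(B w.2 + w.1 * B' w.2), M w.1 (w.2, y))
          - ∫ y in (0 : ℝ)..(A w.2 + w.1 * A' w.2), M w.1 (w.2, y) :=
      fun w => (intervalIntegral.integral_interval_sub_left
        ((h1.comp (Continuous.prodMk_right w)).intervalIntegrable _ _)
        ((h1.comp (Continuous.prodMk_right w)).intervalIntegrable _ _)).symm
    simp only [e]
    exact (continuous_parametric_intervalIntegral_of_continuous h1 (by fun_prop)).sub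
      (continuous_parametric_intervalIntegral_of_continuous h1 (by fun_prop))
  have hb : ∀ {C : ℝ → ℝ} {C' : ℝ → ℝ}, Continuous C → Continuous C' →
      Continuous fun w : ℝ × ℝ => C' w.2 * L w.1 (w.2, C w.2 + w.1 * C' w.2) := by
    intro C C' hC hC'
    exact (hC'.comp continuous_snd).mul (hL.comp (by fun_prop :
      Continuous fun w : ℝ × ℝ => (w.1, (w.2, C w.2 + w.1 * C' w.2))))
  have := hasDerivAt_integral_of_continuous
    (L := fun s x => ∫ y in (A x + s * A' x)..(B x + s * B' x), L s (x, y))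
    (L' := fun s x => (∫ y in (A x + s * A' x)..(B x + s * B' x), L' s (x, y))
        + (B' x * L s (x, B x + s * B' x) - A' x * L s (x, A x + s * A' x)))
    (hcont hL) ((hcont hL').add ((hb hB hB').sub (hb hA hA'))) (fun s x => by
      refine hasDerivAt_integral_moving (L := fun s y => L s (x, y)) (L' := fun s y => L' s (x, y))
        (hL.comp (by fun_prop : Continuous fun v : ℝ × ℝ => (v.1, (x, v.2))))
        (hL'.comp (by fun_prop : Continuous fun v : ℝ × ℝ => (v.1, (x, v.2))))
        (fun s y => hd s (x, y)) ?_ ?_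
      · simpa using ((hasDerivAt_id s).mul_const (A' x)).const_add (A x)
      · simpa using ((hasDerivAt_id s).mul_const (B' x)).const_add (B x)) p q 0
  simpa using this

/-! ### Green's identity in a layer -/

/-- The flux density of `∇φ` through the graph of `c`, with respect to `x`:
`(∂_y φ - c' ∂_x φ)(x, c(x)) dx = ∂_n φ dl`. -/
noncomputable def flux (φ : ℝ × ℝ → ℝ) (c : ℝ → ℝ) (x : ℝ) : ℝ :=
  dy φ (x, c x) - deriv c x * dx φ (x, c x)

theorem continuous_flux {φ : ℝ × ℝ → ℝ} {c : ℝ → ℝ} (hφ : ContDiff ℝ 1 φ) (hc : ContDiff ℝ 1 c) :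
    Continuous (flux φ c) := by
  have h1 := continuous_dx hφ
  have h2 := continuous_dy hφ
  have h3 := hc.continuous_deriv le_rfl
  have h4 := hc.continuous
  unfold flux
  fun_prop

theorem continuous_layer_integral {f : ℝ × ℝ → ℝ} (hf : Continuous f) {a b : ℝ → ℝ}
    (ha : Continuous a) (hb : Continuous b) :
    Continuous fun x => ∫ y in (a x)..(b x), f (x, y) := by
  have h1 : Continuous (Function.uncurry fun (x : ℝ) (y : ℝ) => f (x, y)) := hf
  have e : ∀ x : ℝ, (∫ y in (a x)..(b x), f (x, y)) = (∫ y in (0 : ℝ)..(b x), f (x, y))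
        - ∫ y in (0 : ℝ)..(a x), f (x, y) :=
    fun w => (intervalIntegral.integral_interval_sub_left
      ((h1.comp (Continuous.prodMk_right w)).intervalIntegrable _ _)
      ((h1.comp (Continuous.prodMk_right w)).intervalIntegrable _ _)).symm
  simp only [e]
  exact (continuous_parametric_intervalIntegral_of_continuous h1 hb).sub
    (continuous_parametric_intervalIntegral_of_continuous h1 ha)

/-- Linearity of the integral over a layer, for continuous integrands. -/
theorem layer_integral_add {f g : ℝ × ℝ → ℝ} (hf : Continuous f) (hg : Continuous g) {a b : ℝ → ℝ}
    (ha : Continuous a) (hb : Continuous b) (p q : ℝ) :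
    (∫ x in p..q, ∫ y in (a x)..(b x), (f (x, y) + g (x, y)))
      = (∫ x in p..q, ∫ y in (a x)..(b x), f (x, y))
        + ∫ x in p..q, ∫ y in (a x)..(b x), g (x, y) := by
  rw [← intervalIntegral.integral_add
    ((continuous_layer_integral hf ha hb).intervalIntegrable _ _)
    ((continuous_layer_integral hg ha hb).intervalIntegrable _ _)]
  refine intervalIntegral.integral_congr fun x _ => ?_
  exact intervalIntegral.integral_add
    ((hf.comp (Continuous.prodMk_right x)).intervalIntegrable _ _)
    ((hg.comp (Continuous.prodMk_right x)).intervalIntegrable _ _)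

theorem layer_integral_const_mul (f : ℝ × ℝ → ℝ) (a b : ℝ → ℝ) (p q r : ℝ) :
    (∫ x in p..q, ∫ y in (a x)..(b x), r * f (x, y))
      = r * ∫ x in p..q, ∫ y in (a x)..(b x), f (x, y) := by
  simp only [intervalIntegral.integral_const_mul]

theorem layer_integral_sub {f g : ℝ × ℝ → ℝ} (hf : Continuous f) (hg : Continuous g) {a b : ℝ → ℝ}
    (ha : Continuous a) (hb : Continuous b) (p q : ℝ) :
    (∫ x in p..q, ∫ y in (a x)..(b x), (f (x, y) - g (x, y)))
      = (∫ x in p..q, ∫ y in (a x)..(b x), f (x, y))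
        - ∫ x in p..q, ∫ y in (a x)..(b x), g (x, y) := by
  have h := layer_integral_add hf (hg.const_mul (-1)) ha hb p q
  rw [layer_integral_const_mul g] at h
  linarith [show (∫ x in p..q, ∫ y in (a x)..(b x), (f (x, y) - g (x, y)))
    = ∫ x in p..q, ∫ y in (a x)..(b x), (f (x, y) + -1 * g (x, y)) by
      congr! 4; ring]

/-- The divergence theorem in a periodic layer between two graphs. -/
theorem layer_divergence {V W : ℝ × ℝ → ℝ} (hV : ContDiff ℝ 1 V) (hW : ContDiff ℝ 1 W)
    (hVp : ∀ x y, V (x + 2 * π, y) = V (x, y))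
    {a b : ℝ → ℝ} (ha : ContDiff ℝ 1 a) (hb : ContDiff ℝ 1 b)
    (hap : ∀ x, a (x + 2 * π) = a x) (hbp : ∀ x, b (x + 2 * π) = b x) :
    (∫ x in (-π)..π, ∫ y in (a x)..(b x), (dx V (x, y) + dy W (x, y)))
      = (∫ x in (-π)..π, (W (x, b x) - deriv b x * V (x, b x)))
        - ∫ x in (-π)..π, (W (x, a x) - deriv a x * V (x, a x)) := by
  have hac := ha.continuous
  have hbc := hb.continuous
  have had := ha.continuous_deriv le_rfl
  have hbd := hb.continuous_deriv le_rfl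
  have hVc := hV.continuous
  have hWc := hW.continuous
  rw [layer_integral_add (continuous_dx hV) (continuous_dy hW) hac hbc]
  have h2 : ∀ x, (∫ y in (a x)..(b x), dy W (x, y)) = W (x, b x) - W (x, a x) := fun x =>
    intervalIntegral.integral_eq_sub_of_hasDerivAt (fun y _ => hasDerivAt_dy hW x y)
      (((continuous_dy hW).comp (Continuous.prodMk_right x)).intervalIntegrable _ _)
  have h1 : (∫ x in (-π)..π, ((∫ y in (a x)..(b x), dx V (x, y))
      + (deriv b x * V (x, b x) - deriv a x * V (x, a x)))) = 0 := by
    have hder : ∀ x, HasDerivAt (fun x => ∫ y in (a x)..(b x), V (x, y))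
        ((∫ y in (a x)..(b x), dx V (x, y))
          + (deriv b x * V (x, b x) - deriv a x * V (x, a x))) x := fun x =>
      hasDerivAt_integral_moving (L := fun s y => V (s, y)) (L' := fun s y => dx V (s, y)) hVc
        (continuous_dx hV) (fun s y => hasDerivAt_dx hV s y)
        ((ha.differentiable one_ne_zero) x).hasDerivAt
        ((hb.differentiable one_ne_zero) x).hasDerivAt
    rw [intervalIntegral.integral_eq_sub_of_hasDerivAt (fun x _ => hder x)]
    · have e : (π : ℝ) = -π + 2 * π := by ring
      rw [e, hap, hbp]
      simp only [hVp]
      rw [← e, sub_self]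
    · have := continuous_layer_integral (continuous_dx hV) hac hbc
      exact Continuous.intervalIntegrable (by fun_prop) _ _
  have hi := (continuous_layer_integral (continuous_dx hV) hac hbc).intervalIntegrable
    (μ := volume) (-π) π
  rw [intervalIntegral.integral_add hi
    (Continuous.intervalIntegrable (by fun_prop) _ _)] at h1
  rw [intervalIntegral.integral_sub (Continuous.intervalIntegrable (by fun_prop) _ _)
    (Continuous.intervalIntegrable (by fun_prop) _ _)] at h1
  simp only [h2]
  rw [intervalIntegral.integral_sub (Continuous.intervalIntegrable (by fun_prop) _ _)
    (Continuous.intervalIntegrable (by fun_prop) _ _),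
    intervalIntegral.integral_sub (Continuous.intervalIntegrable (by fun_prop) _ _)
    (Continuous.intervalIntegrable (by fun_prop) _ _),
    intervalIntegral.integral_sub (Continuous.intervalIntegrable (by fun_prop) _ _)
    (Continuous.intervalIntegrable (by fun_prop) _ _)]
  linarith

theorem dx_mul {f g : ℝ × ℝ → ℝ} (hf : ContDiff ℝ 1 f) (hg : ContDiff ℝ 1 g) (z : ℝ × ℝ) :
    dx (fun z => f z * g z) z = dx f z * g z + f z * dx g z :=
  ((hasDerivAt_dx hf z.1 z.2).mul (hasDerivAt_dx hg z.1 z.2)).deriv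

theorem dy_mul {f g : ℝ × ℝ → ℝ} (hf : ContDiff ℝ 1 f) (hg : ContDiff ℝ 1 g) (z : ℝ × ℝ) :
    dy (fun z => f z * g z) z = dy f z * g z + f z * dy g z :=
  ((hasDerivAt_dy hf z.1 z.2).mul (hasDerivAt_dy hg z.1 z.2)).deriv

/-- Green's first identity in a periodic layer. -/
theorem layer_green {θ φ : ℝ × ℝ → ℝ} (hθ : ContDiff ℝ 1 θ) (hφ : ContDiff ℝ 2 φ)
    (hθp : ∀ x y, θ (x + 2 * π, y) = θ (x, y)) (hφp : ∀ x y, φ (x + 2 * π, y) = φ (x, y))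
    {a b : ℝ → ℝ} (ha : ContDiff ℝ 1 a) (hb : ContDiff ℝ 1 b)
    (hap : ∀ x, a (x + 2 * π) = a x) (hbp : ∀ x, b (x + 2 * π) = b x) :
    (∫ x in (-π)..π, ∫ y in (a x)..(b x),
        (dx θ (x, y) * dx φ (x, y) + dy θ (x, y) * dy φ (x, y) + θ (x, y) * lap φ (x, y)))
      = (∫ x in (-π)..π, θ (x, b x) * flux φ b x) - ∫ x in (-π)..π, θ (x, a x) * flux φ a x := by
  have h := layer_divergence (V := fun z => θ z * dx φ z) (W := fun z => θ z * dy φ z)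
    (hθ.mul (contDiff_dx hφ)) (hθ.mul (contDiff_dy hφ))
    (fun x y => by simp only [hθp, dx_periodic hφp]) ha hb hap hbp
  simp only [dx_mul hθ (contDiff_dx hφ), dy_mul hθ (contDiff_dy hφ)] at h
  refine Eq.trans ?_ (h.trans ?_)
  · refine intervalIntegral.integral_congr fun x _ => intervalIntegral.integral_congr fun y _ => ?_
    simp only [lap_eq]
    ring
  · congr 1 <;> refine intervalIntegral.integral_congr fun x _ => ?_ <;> simp only [flux] <;> ring

/-! ### Two vanishing principles -/

theorem eq_zero_of_integral_sq_eq_zero {f : ℝ → ℝ} (hf : Continuous f) {a b : ℝ} (hab : a < b)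
    (h : ∫ x in a..b, f x ^ 2 = 0) : ∀ x ∈ Icc a b, f x = 0 := by
  intro x hx
  by_contra hne
  have := intervalIntegral.integral_pos hab (f := fun x => f x ^ 2) (hf.pow 2).continuousOn
    (fun y _ => sq_nonneg _) ⟨x, hx, by positivity⟩
  linarith

theorem periodic_exists_mem_Icc (x : ℝ) : ∃ n : ℤ, x + n * (2 * π) ∈ Icc (-π) π := by
  obtain ⟨y, hy, -⟩ := existsUnique_add_zsmul_mem_Ioc (Real.two_pi_pos) x (-π)
  refine ⟨y, ?_⟩
  simp only [zsmul_eq_mul] at hy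
  exact ⟨hy.1.le, by linarith [hy.2]⟩

theorem periodic_add_int {f : ℝ → ℝ} (hf : ∀ x, f (x + 2 * π) = f x) (x : ℝ) (n : ℤ) :
    f (x + n * (2 * π)) = f x := by
  have : Function.Periodic f (2 * π) := hf
  simpa using this.int_mul n x

theorem periodic_forall {f : ℝ → ℝ} (hf : ∀ x, f (x + 2 * π) = f x)
    {p : ℝ → Prop} (h : ∀ x ∈ Icc (-π) π, p (f x)) (x : ℝ) : p (f x) := by
  obtain ⟨n, hn⟩ := periodic_exists_mem_Icc x
  rw [← periodic_add_int hf x n]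
  exact h _ hn

/-- A primitive of a continuous periodic function of mean zero is periodic. -/
theorem primitive_periodic {f : ℝ → ℝ} (hf : Continuous f) (hp : ∀ x, f (x + 2 * π) = f x)
    (h0 : ∫ x in (-π)..π, f x = 0) (x : ℝ) :
    (∫ t in (-π)..(x + 2 * π), f t) = ∫ t in (-π)..x, f t := by
  rw [← intervalIntegral.integral_add_adjacent_intervals (hf.intervalIntegrable (-π) x)
    (hf.intervalIntegrable x (x + 2 * π)),
    (show Function.Periodic f (2 * π) from hp).intervalIntegral_add_eq x (-π)]
  rw [show -π + 2 * π = π by ring, h0, add_zero]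

/-- The fundamental lemma of the calculus of variations for periodic `C²` test functions. The test
function is a periodic second primitive of `q`. -/
theorem eq_zero_of_integral_mul_periodic {q : ℝ → ℝ} (hq : Continuous q)
    (hp : ∀ x, q (x + 2 * π) = q x)
    (h : ∀ φ : ℝ → ℝ, ContDiff ℝ 2 φ → (∀ x, φ (x + 2 * π) = φ x) →
      ∫ x in (-π)..π, φ x * q x = 0) (x : ℝ) : q x = 0 := by
  have h0 : ∫ x in (-π)..π, q x = 0 := by
    simpa using h (fun _ => 1) contDiff_const (fun _ => rfl)
  set R : ℝ → ℝ := fun x => ∫ t in (-π)..x, q t with hR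
  have hRd : ∀ x, HasDerivAt R (q x) x := fun x => hq.integral_hasStrictDerivAt (-π) x |>.hasDerivAt
  have hRc : Continuous R := continuous_iff_continuousAt.2 fun x => (hRd x).continuousAt
  set m : ℝ := (∫ x in (-π)..π, R x) / (2 * π) with hm
  set K : ℝ → ℝ := fun x => R x - m with hK
  have hKd : ∀ x, HasDerivAt K (q x) x := fun x => (hRd x).sub_const m
  have hKc : Continuous K := hRc.sub continuous_const
  have hKp : ∀ x, K (x + 2 * π) = K x := fun x => by
    simp only [hK, hR, primitive_periodic hq hp h0]
  have hK0 : ∫ x in (-π)..π, K x = 0 := by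
    simp only [hK]
    rw [intervalIntegral.integral_sub (hRc.intervalIntegrable _ _) intervalIntegrable_const,
      intervalIntegral.integral_const, hm]
    have := Real.pi_pos
    simp only [smul_eq_mul]
    field_simp
    ring
  set φ : ℝ → ℝ := fun x => ∫ t in (-π)..x, K t with hφ
  have hφd : ∀ x, HasDerivAt φ (K x) x := fun x =>
    hKc.integral_hasStrictDerivAt (-π) x |>.hasDerivAt
  have hφp : ∀ x, φ (x + 2 * π) = φ x := fun x => primitive_periodic hKc hKp hK0 x
  have hKC : ContDiff ℝ 1 K := by
    rw [contDiff_one_iff_deriv]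
    exact ⟨fun x => (hKd x).differentiableAt, by rwa [funext fun x => (hKd x).deriv]⟩
  have hφC : ContDiff ℝ 2 φ := by
    rw [show (2 : WithTop ℕ∞) = 1 + 1 by norm_num, contDiff_succ_iff_deriv]
    exact ⟨fun x => (hφd x).differentiableAt, by simp, by rwa [funext fun x => (hφd x).deriv]⟩
  have h1 := intervalIntegral.integral_mul_deriv_eq_deriv_mul (a := -π) (b := π)
    (fun x _ => hφd x) (fun x _ => hKd x) (hKc.intervalIntegrable _ _) (hq.intervalIntegrable _ _)
  rw [h φ hφC hφp] at h1
  have h2 : φ π = φ (-π) := by rw [← hφp (-π)]; congr 1; ring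
  have h3 : K π = K (-π) := by rw [← hKp (-π)]; congr 1; ring
  have h4 : ∫ x in (-π)..π, K x ^ 2 = 0 := by
    simp only [pow_two]
    rw [h2, h3] at h1
    linarith
  have h5 := eq_zero_of_integral_sq_eq_zero hKc (by linarith [Real.pi_pos]) h4
  have h6 : ∀ x, K x = 0 := periodic_forall hKp (p := fun r => r = 0) h5
  have := (hKd x).unique ((hasDerivAt_const x (0 : ℝ)).congr_of_eventuallyEq
    (Eventually.of_forall h6))
  exact this

/-! ### The Hilbert space argument -/

section Hilbert

variable {ι H : Type*} [NormedAddCommGroup H] [InnerProductSpace ℂ H] (B : HilbertBasis ι ℂ H)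

theorem hasSum_repr (x y : H) :
    HasSum (fun k => (starRingEnd ℂ) (B.repr x k) * B.repr y k) (inner ℂ x y) := by
  simpa only [HilbertBasis.repr_apply_apply, inner_conj_symm] using B.hasSum_inner_mul_inner x y

/-- Multiplication of the coefficients by `iω` is skew-adjoint. -/
theorem inner_multiplier_skew {ω : ι → ℝ} {X Y v D : H}
    (hY : ∀ k, B.repr Y k = Complex.I * ω k * B.repr X k)
    (hD : ∀ k, B.repr D k = Complex.I * ω k * B.repr v k) : inner ℂ X D = - inner ℂ Y v := by
  refine (hasSum_repr B X D).unique ((hasSum_repr B Y v).neg.congr_fun fun k => ?_)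
  rw [hY, hD]
  simp only [map_mul, Complex.conj_I, Complex.conj_ofReal]
  ring

/-- Gradients are orthogonal to divergence free fields. -/
theorem inner_gradient_divergenceFree {ω₁ ω₂ : ι → ℝ} {q A₁ A₂ M₁ M₂ : H}
    (h₁ : ∀ k, B.repr A₁ k = Complex.I * ω₁ k * B.repr q k)
    (h₂ : ∀ k, B.repr A₂ k = Complex.I * ω₂ k * B.repr q k)
    (hM : ∀ k, ω₁ k * B.repr M₁ k + ω₂ k * B.repr M₂ k = 0) :
    inner ℂ A₁ M₁ + inner ℂ A₂ M₂ = 0 := by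
  refine ((hasSum_repr B A₁ M₁).add (hasSum_repr B A₂ M₂)).unique
    (hasSum_zero.congr_fun fun k => ?_)
  rw [h₁, h₂]
  simp only [map_mul, Complex.conj_I, Complex.conj_ofReal]
  linear_combination (-Complex.I * (starRingEnd ℂ) (B.repr q k)) * hM k

/-- A multiplier bound: if `|ω|² v̂ = i ω·ĝ` with `g` square integrable, then `iω v̂` is square
summable, so that it is the coefficient family of a vector. -/
theorem exists_weak_derivative {ω₁ ω₂ : ι → ℝ} {v g₁ g₂ : H}
    (hv : ∀ k, ((ω₁ k : ℂ) ^ 2 + (ω₂ k : ℂ) ^ 2) * B.repr v k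
      = Complex.I * (ω₁ k * B.repr g₁ k + ω₂ k * B.repr g₂ k))
    (ω : ι → ℝ) (hω : ∀ k, ω k ^ 2 ≤ ω₁ k ^ 2 + ω₂ k ^ 2) :
    ∃ D : H, ∀ k, B.repr D k = Complex.I * ω k * B.repr v k := by
  have hle : ∀ k, ‖Complex.I * ω k * B.repr v k‖ ≤ ‖B.repr g₁ k‖ + ‖B.repr g₂ k‖ := by
    intro k
    have h1 : (ω₁ k ^ 2 + ω₂ k ^ 2) * ‖B.repr v k‖
        ≤ |ω₁ k| * ‖B.repr g₁ k‖ + |ω₂ k| * ‖B.repr g₂ k‖ := by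
      have h := congrArg norm (hv k)
      rw [norm_mul, norm_mul, Complex.norm_I, one_mul] at h
      have e : ‖((ω₁ k : ℂ) ^ 2 + (ω₂ k : ℂ) ^ 2)‖ = ω₁ k ^ 2 + ω₂ k ^ 2 := by
        rw [← Complex.ofReal_pow, ← Complex.ofReal_pow, ← Complex.ofReal_add, Complex.norm_real,
          Real.norm_of_nonneg (by positivity)]
      rw [e] at h
      rw [h]
      refine (norm_add_le _ _).trans (le_of_eq ?_)
      simp
    rw [norm_mul, norm_mul, Complex.norm_I, one_mul, Complex.norm_real, Real.norm_eq_abs]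
    rcases eq_or_ne (ω₁ k ^ 2 + ω₂ k ^ 2) 0 with h0 | h0
    · have : ω k = 0 := by
        have := hω k
        rw [h0] at this
        exact pow_eq_zero_iff two_ne_zero |>.1 (le_antisymm this (sq_nonneg _))
      rw [this]
      simp only [abs_zero, zero_mul]
      positivity
    · have hpos : 0 < ω₁ k ^ 2 + ω₂ k ^ 2 := lt_of_le_of_ne (by positivity) h0.symm
      set ρ := √(ω₁ k ^ 2 + ω₂ k ^ 2) with hρ
      have hρ2 : ρ ^ 2 = ω₁ k ^ 2 + ω₂ k ^ 2 := Real.sq_sqrt hpos.le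
      have hρ0 : 0 < ρ := Real.sqrt_pos.2 hpos
      have a0 : |ω k| ≤ ρ := Real.abs_le_sqrt (hω k)
      have a1 : |ω₁ k| ≤ ρ := Real.abs_le_sqrt (by nlinarith [sq_nonneg (ω₂ k)])
      have a2 : |ω₂ k| ≤ ρ := Real.abs_le_sqrt (by nlinarith [sq_nonneg (ω₁ k)])
      rw [← hρ2] at h1
      have n1 := norm_nonneg (B.repr g₁ k)
      have n2 := norm_nonneg (B.repr g₂ k)
      have n0 := norm_nonneg (B.repr v k)
      have h2 : ρ * ‖B.repr v k‖ ≤ ‖B.repr g₁ k‖ + ‖B.repr g₂ k‖ := by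
        refine le_of_mul_le_mul_left ?_ hρ0
        nlinarith
      nlinarith
  have hmem : Memℓp (fun k => Complex.I * ω k * B.repr v k) 2 := by
    refine memℓp_gen ?_
    have s : ∀ g : H, Summable fun k => ‖B.repr g k‖ ^ 2 := fun g => by
      have := (lp.memℓp (B.repr g)).summable (by norm_num)
      simpa using this
    refine Summable.of_nonneg_of_le (fun k => by positivity) (fun k => ?_)
      (((s g₁).mul_left 2).add ((s g₂).mul_left 2))
    have e : (2 : ENNReal).toReal = ((2 : ℕ) : ℝ) := by simp
    rw [e, Real.rpow_natCast]
    nlinarith [hle k, norm_nonneg (Complex.I * ω k * B.repr v k), norm_nonneg (B.repr g₁ k),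
      norm_nonneg (B.repr g₂ k), sq_nonneg (‖B.repr g₁ k‖ - ‖B.repr g₂ k‖)]
  refine ⟨B.repr.symm ⟨_, hmem⟩, fun k => ?_⟩
  rw [LinearIsometryEquiv.apply_symm_apply]

/-- The abstract form of the uniqueness argument. The field `g` is the restriction of the gradient
`p` to a set, `v` satisfies `Δv = -div g`, and the fields `X n`, with derivatives `Y n`, live off
that set and tend to `p - g`. Then `M = g + ∇v` is divergence free and vanishes off the set, so
`⟨M, g⟩ = ⟨M, p⟩ = 0`, whence `‖M‖² = ⟨M, g⟩ + ⟨M, ∇v⟩ = 0`. -/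
theorem repr_eq_neg_weak_derivative {ω₁ ω₂ : ι → ℝ} {v g₁ g₂ p p₁ p₂ : H}
    (hv : ∀ k, ((ω₁ k : ℂ) ^ 2 + (ω₂ k : ℂ) ^ 2) * B.repr v k
      = Complex.I * (ω₁ k * B.repr g₁ k + ω₂ k * B.repr g₂ k))
    (hp₁ : ∀ k, B.repr p₁ k = Complex.I * ω₁ k * B.repr p k)
    (hp₂ : ∀ k, B.repr p₂ k = Complex.I * ω₂ k * B.repr p k)
    {X₁ Y₁ X₂ Y₂ : ℕ → H}
    (hXY₁ : ∀ n k, B.repr (Y₁ n) k = Complex.I * ω₁ k * B.repr (X₁ n) k)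
    (hXY₂ : ∀ n k, B.repr (Y₂ n) k = Complex.I * ω₂ k * B.repr (X₂ n) k)
    (hpair₁ : ∀ n, inner ℂ (X₁ n) g₁ = inner ℂ (Y₁ n) v)
    (hpair₂ : ∀ n, inner ℂ (X₂ n) g₂ = inner ℂ (Y₂ n) v)
    (hlim₁ : Tendsto X₁ atTop (𝓝 (p₁ - g₁))) (hlim₂ : Tendsto X₂ atTop (𝓝 (p₂ - g₂))) (k : ι) :
    B.repr g₂ k = -(Complex.I * ω₂ k * B.repr v k) := by
  obtain ⟨D₁, hD₁⟩ := exists_weak_derivative B hv ω₁ fun k => by nlinarith [sq_nonneg (ω₂ k)]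
  obtain ⟨D₂, hD₂⟩ := exists_weak_derivative B hv ω₂ fun k => by nlinarith [sq_nonneg (ω₁ k)]
  have hM : ∀ k, ω₁ k * B.repr (g₁ + D₁) k + ω₂ k * B.repr (g₂ + D₂) k = 0 := by
    intro k
    simp only [map_add, lp.coeFn_add, Pi.add_apply, hD₁, hD₂]
    linear_combination Complex.I * hv k + (ω₁ k * B.repr g₁ k + ω₂ k * B.repr g₂ k) * Complex.I_sq
  have orth : ∀ {ω : ι → ℝ} {g D q : H} {X Y : ℕ → H},
      (∀ k, B.repr D k = Complex.I * ω k * B.repr v k) →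
      (∀ n k, B.repr (Y n) k = Complex.I * ω k * B.repr (X n) k) →
      (∀ n, inner ℂ (X n) g = inner ℂ (Y n) v) → Tendsto X atTop (𝓝 (q - g)) →
      inner ℂ (q - g) (g + D) = 0 := by
    intro ω g D q X Y hD hXY hpair hlim
    refine tendsto_nhds_unique (hlim.inner (tendsto_const_nhds (x := g + D))) ?_
    refine tendsto_const_nhds.congr fun n => ?_
    rw [inner_add_right, inner_multiplier_skew B (hXY n) hD, hpair, add_neg_cancel]
  have o₁ := orth hD₁ hXY₁ hpair₁ hlim₁
  have o₂ := orth hD₂ hXY₂ hpair₂ hlim₂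
  have o₃ := inner_gradient_divergenceFree B hp₁ hp₂ hM
  have o₄ := inner_gradient_divergenceFree B hD₁ hD₂ hM
  rw [inner_sub_left] at o₁ o₂
  have h0 : inner ℂ (g₁ + D₁) (g₁ + D₁) + inner ℂ (g₂ + D₂) (g₂ + D₂) = 0 := by
    rw [inner_add_left g₁, inner_add_left g₂]
    linear_combination o₃ + o₄ - o₁ - o₂
  rw [inner_self_eq_norm_sq_to_K, inner_self_eq_norm_sq_to_K] at h0
  rw [← RCLike.ofReal_pow, ← RCLike.ofReal_pow, ← RCLike.ofReal_add, RCLike.ofReal_eq_zero] at h0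
  have h2 : g₂ + D₂ = 0 := by
    rw [← norm_eq_zero]
    nlinarith [sq_nonneg ‖g₁ + D₁‖, sq_nonneg ‖g₂ + D₂‖]
  rw [← hD₂, eq_neg_of_add_eq_zero_left h2]
  simp

end Hilbert

/-! ### Fourier series on a rectangle -/

/-- The product of the normalised Haar measures on the two-dimensional torus. -/
noncomputable def torusMeasure : Measure (UnitAddTorus (Fin 2)) :=
  Measure.pi fun _ => AddCircle.haarAddCircle

/-- The Fourier basis of `L²` of the two-dimensional torus. -/
noncomputable def torusBasis : HilbertBasis (Fin 2 → ℤ) ℂ (Lp ℂ 2 torusMeasure) :=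
  UnitAddTorus.mFourierBasis

instance : IsProbabilityMeasure torusMeasure := by
  unfold torusMeasure
  infer_instance

/-- The parametrisation of the rectangle `(-π, π] × (α, α + Λ]` by the torus. -/
noncomputable def wrap (α Λ : ℝ) (τ : UnitAddTorus (Fin 2)) : ℝ × ℝ :=
  (-π + 2 * π * (AddCircle.equivIoc 1 0 (τ 0)).1, α + Λ * (AddCircle.equivIoc 1 0 (τ 1)).1)

theorem measurable_wrap (α Λ : ℝ) : Measurable (wrap α Λ) := by
  have h : Measurable fun t : UnitAddCircle => (AddCircle.equivIoc 1 0 t).1 :=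
    measurable_subtype_coe.comp (AddCircle.measurableEquivIoc 1 0).measurable
  unfold wrap
  have h0 : Measurable fun τ : UnitAddTorus (Fin 2) => (AddCircle.equivIoc 1 0 (τ 0)).1 :=
    h.comp (measurable_pi_apply 0)
  have h1 : Measurable fun τ : UnitAddTorus (Fin 2) => (AddCircle.equivIoc 1 0 (τ 1)).1 :=
    h.comp (measurable_pi_apply 1)
  exact ((h0.const_mul (2 * π)).const_add (-π)).prodMk ((h1.const_mul Λ).const_add α)

theorem wrap_mem {α Λ : ℝ} (hΛ : 0 < Λ) (τ : UnitAddTorus (Fin 2)) :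
    wrap α Λ τ ∈ Icc (-π) π ×ˢ Icc α (α + Λ) := by
  have h0 := (AddCircle.equivIoc 1 0 (τ 0)).2
  have h1 := (AddCircle.equivIoc 1 0 (τ 1)).2
  simp only [zero_add, mem_Ioc] at h0 h1
  have := Real.pi_pos
  simp only [wrap, mem_prod, mem_Icc]
  refine ⟨⟨?_, ?_⟩, ?_, ?_⟩ <;> nlinarith

/-- Measurable functions that are bounded on the rectangle `[-π, π] × [α, α + Λ]`. -/
def RectBounded (α Λ : ℝ) (f : ℝ × ℝ → ℝ) : Prop :=
  Measurable f ∧ ∃ C, ∀ z ∈ Icc (-π) π ×ˢ Icc α (α + Λ), |f z| ≤ C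

theorem RectBounded.of_continuous {α Λ : ℝ} {f : ℝ × ℝ → ℝ} (hf : Continuous f) :
    RectBounded α Λ f :=
  ⟨hf.measurable, (isCompact_Icc.prod isCompact_Icc).exists_bound_of_continuousOn hf.continuousOn⟩

theorem RectBounded.mul {α Λ : ℝ} {f g : ℝ × ℝ → ℝ} (hf : RectBounded α Λ f)
    (hg : RectBounded α Λ g) : RectBounded α Λ fun z => f z * g z := by
  obtain ⟨hf, C, hC⟩ := hf
  obtain ⟨hg, D, hD⟩ := hg
  refine ⟨hf.mul hg, C * D, fun z hz => ?_⟩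
  rw [abs_mul]
  exact mul_le_mul (hC z hz) (hD z hz) (abs_nonneg _) ((abs_nonneg _).trans (hC z hz))

theorem RectBounded.sub {α Λ : ℝ} {f g : ℝ × ℝ → ℝ} (hf : RectBounded α Λ f)
    (hg : RectBounded α Λ g) : RectBounded α Λ fun z => f z - g z := by
  obtain ⟨hf, C, hC⟩ := hf
  obtain ⟨hg, D, hD⟩ := hg
  exact ⟨hf.sub hg, C + D, fun z hz =>
    (abs_sub _ _).trans (add_le_add (hC z hz) (hD z hz))⟩

theorem RectBounded.memLp {α Λ : ℝ} (hΛ : 0 < Λ) {f : ℝ × ℝ → ℝ} (hf : RectBounded α Λ f) :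
    MemLp (fun τ => (f (wrap α Λ τ) : ℂ)) 2 torusMeasure := by
  obtain ⟨C, hC⟩ := hf.2
  refine MemLp.of_bound (C := C) ?_ (Eventually.of_forall fun τ => ?_)
  · exact (Complex.measurable_ofReal.comp (hf.1.comp (measurable_wrap α Λ))).aestronglyMeasurable
  · rw [Complex.norm_real]
    exact hC _ (wrap_mem hΛ τ)

theorem RectBounded.integrable {α Λ : ℝ} (hΛ : 0 < Λ) {f : ℝ × ℝ → ℝ} (hf : RectBounded α Λ f) :
    Integrable (fun τ => f (wrap α Λ τ)) torusMeasure := by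
  obtain ⟨C, hC⟩ := hf.2
  refine Integrable.of_bound (C := C) ?_ (Eventually.of_forall fun τ => ?_)
  · exact (hf.1.comp (measurable_wrap α Λ)).aestronglyMeasurable
  · exact hC _ (wrap_mem hΛ τ)

/-- The integral over the rectangle `(-π, π) × (α, α + Λ)`. -/
noncomputable def rectIntegral (α Λ : ℝ) (f : ℝ × ℝ → ℝ) : ℝ :=
  ∫ x in (-π)..π, ∫ y in α..(α + Λ), f (x, y)

theorem integral_wrap {α Λ : ℝ} (hΛ : 0 < Λ) {f : ℝ × ℝ → ℝ} (hf : RectBounded α Λ f) :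
    ∫ τ, f (wrap α Λ τ) ∂torusMeasure = (2 * π * Λ)⁻¹ * rectIntegral α Λ f := by
  have h1 : ∫ τ, f (wrap α Λ τ) ∂torusMeasure
      = ∫ x in {x : Fin 2 → ℝ | ∀ i, x i ∈ Ioc (0 : ℝ) (0 + 1)},
          f (wrap α Λ fun i => (x i : UnitAddCircle)) :=
    UnitAddTorus.integral_preimage (fun τ => f (wrap α Λ τ)) 0
  have hms : MeasurableSet {x : Fin 2 → ℝ | ∀ i, x i ∈ Ioc (0 : ℝ) (0 + 1)} :=
    MeasurableSet.univ_pi' fun _ => measurableSet_Ioc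
  have h2 : (∫ x in {x : Fin 2 → ℝ | ∀ i, x i ∈ Ioc (0 : ℝ) (0 + 1)},
          f (wrap α Λ fun i => (x i : UnitAddCircle)))
      = ∫ x in {x : Fin 2 → ℝ | ∀ i, x i ∈ Ioc (0 : ℝ) (0 + 1)},
          f (-π + 2 * π * x 0, α + Λ * x 1) := by
    refine setIntegral_congr_fun hms fun x hx => ?_
    have e : ∀ i, ((AddCircle.equivIoc 1 0 (x i : UnitAddCircle)).1 : ℝ) = x i := fun i =>
      AddCircle.equivIoc_coe_of_mem (hx i)
    simp only [wrap, e]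
  have h3 : (∫ x in {x : Fin 2 → ℝ | ∀ i, x i ∈ Ioc (0 : ℝ) (0 + 1)},
          f (-π + 2 * π * x 0, α + Λ * x 1))
      = ∫ w in Ioc (0 : ℝ) 1 ×ˢ Ioc (0 : ℝ) 1, f (-π + 2 * π * w.1, α + Λ * w.2) := by
    rw [← (volume_preserving_finTwoArrow ℝ).setIntegral_preimage_emb
      (MeasurableEquiv.measurableEmbedding _)]
    refine setIntegral_congr_set (Eq.eventuallyEq ?_)
    ext x
    change (∀ i, x i ∈ Ioc (0 : ℝ) (0 + 1)) ↔ (x 0 ∈ Ioc (0 : ℝ) 1 ∧ x 1 ∈ Ioc (0 : ℝ) 1)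
    rw [Fin.forall_fin_two, zero_add]
  have hint : IntegrableOn (fun w : ℝ × ℝ => f (-π + 2 * π * w.1, α + Λ * w.2))
      (Ioc (0 : ℝ) 1 ×ˢ Ioc (0 : ℝ) 1) := by
    obtain ⟨C, hC⟩ := hf.2
    refine Measure.integrableOn_of_bounded (M := C) ?_ ?_ ?_
    · rw [Measure.volume_eq_prod, Measure.prod_prod]
      simp
    · exact (hf.1.comp (by fun_prop)).aestronglyMeasurable
    · refine (ae_restrict_mem (measurableSet_Ioc.prod measurableSet_Ioc)).mono fun w hw => ?_
      have := Real.pi_pos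
      simp only [mem_prod, mem_Ioc] at hw
      refine hC _ ⟨⟨?_, ?_⟩, ?_, ?_⟩ <;> simp only <;> nlinarith
  rw [h1, h2, h3, Measure.volume_eq_prod, setIntegral_prod _ hint]
  rw [← intervalIntegral.integral_of_le zero_le_one]
  simp only [← intervalIntegral.integral_of_le (zero_le_one (α := ℝ))]
  have h4 : ∀ x, (∫ y in (0 : ℝ)..1, f (x, α + Λ * y))
      = Λ⁻¹ * ∫ y in α..(α + Λ), f (x, y) := fun x => by
    rw [intervalIntegral.integral_comp_add_mul (fun y => f (x, y)) hΛ.ne']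
    simp
  simp only [h4]
  rw [intervalIntegral.integral_const_mul,
    intervalIntegral.integral_comp_add_mul (fun x => ∫ y in α..(α + Λ), f (x, y))
      (by positivity : (2 * π) ≠ 0)]
  simp only [smul_eq_mul, mul_zero, mul_one, add_zero, rectIntegral]
  rw [show -π + 2 * π = π by ring]
  field_simp

/-- A bounded function on the rectangle as a square integrable function on the torus. -/
noncomputable def rectLift {α Λ : ℝ} (hΛ : 0 < Λ) {f : ℝ × ℝ → ℝ} (hf : RectBounded α Λ f) :
    Lp ℂ 2 torusMeasure :=
  (hf.memLp hΛ).toLp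

theorem rectLift_sub {α Λ : ℝ} (hΛ : 0 < Λ) {f g : ℝ × ℝ → ℝ} (hf : RectBounded α Λ f)
    (hg : RectBounded α Λ g) : rectLift hΛ hf - rectLift hΛ hg = rectLift hΛ (hf.sub hg) := by
  unfold rectLift
  rw [← MemLp.toLp_sub]
  congr 1
  funext τ
  simp

theorem inner_rectLift {α Λ : ℝ} (hΛ : 0 < Λ) {f g : ℝ × ℝ → ℝ} (hf : RectBounded α Λ f)
    (hg : RectBounded α Λ g) :
    inner ℂ (rectLift hΛ hf) (rectLift hΛ hg)
      = (((2 * π * Λ)⁻¹ * rectIntegral α Λ (fun z => f z * g z) : ℝ) : ℂ) := by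
  rw [L2.inner_def, ← integral_wrap hΛ (hf.mul hg), ← integral_complex_ofReal]
  refine integral_congr_ae ?_
  filter_upwards [(hf.memLp hΛ).coeFn_toLp, (hg.memLp hΛ).coeFn_toLp] with τ h1 h2
  simp only [rectLift, h1, h2, RCLike.inner_apply, Complex.conj_ofReal, Complex.ofReal_mul]
  ring

/-- The argument of the trigonometric monomial with index `k` on the rectangle. -/
noncomputable def phase (α Λ : ℝ) (k : Fin 2 → ℤ) (z : ℝ × ℝ) : ℝ :=
  k 0 * (z.1 + π) + 2 * π / Λ * k 1 * (z.2 - α)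

theorem contDiff_phase (α Λ : ℝ) (k : Fin 2 → ℤ) {n : WithTop ℕ∞} :
    ContDiff ℝ n (phase α Λ k) := by
  unfold phase
  fun_prop

theorem contDiff_cos_phase (α Λ : ℝ) (k : Fin 2 → ℤ) {n : WithTop ℕ∞} :
    ContDiff ℝ n fun z => cos (phase α Λ k z) :=
  Real.contDiff_cos.comp (contDiff_phase α Λ k)

theorem contDiff_sin_phase (α Λ : ℝ) (k : Fin 2 → ℤ) {n : WithTop ℕ∞} :
    ContDiff ℝ n fun z => sin (phase α Λ k z) :=
  Real.contDiff_sin.comp (contDiff_phase α Λ k)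

theorem phase_add_two_pi (α Λ : ℝ) (k : Fin 2 → ℤ) (x y : ℝ) :
    phase α Λ k (x + 2 * π, y) = phase α Λ k (x, y) + (k 0 : ℤ) * (2 * π) := by
  unfold phase
  ring

theorem mFourier_eq_exp_phase {α Λ : ℝ} (hΛ : 0 < Λ) (k : Fin 2 → ℤ) (τ : UnitAddTorus (Fin 2)) :
    UnitAddTorus.mFourier k τ = Complex.exp (phase α Λ k (wrap α Λ τ) * Complex.I) := by
  have e : ∀ i, τ i = ((AddCircle.equivIoc 1 0 (τ i)).1 : UnitAddCircle) := fun i =>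
    AddCircle.coe_equivIoc.symm
  simp only [UnitAddTorus.mFourier, ContinuousMap.coe_mk, Fin.prod_univ_two]
  rw [e 0, e 1, fourier_coe_apply, fourier_coe_apply, ← Complex.exp_add]
  congr 1
  simp only [phase, wrap]
  have : (Λ : ℂ) ≠ 0 := by exact_mod_cast hΛ.ne'
  push_cast
  field_simp
  ring

theorem repr_rectLift {α Λ : ℝ} (hΛ : 0 < Λ) {f : ℝ × ℝ → ℝ} (hf : RectBounded α Λ f)
    (k : Fin 2 → ℤ) :
    torusBasis.repr (rectLift hΛ hf) k = ((2 * π * Λ)⁻¹ : ℝ) *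
      ((rectIntegral α Λ (fun z => f z * cos (phase α Λ k z)) : ℂ)
        - Complex.I * rectIntegral α Λ (fun z => f z * sin (phase α Λ k z))) := by
  have hc : RectBounded α Λ fun z => f z * cos (phase α Λ k z) :=
    hf.mul (.of_continuous (contDiff_cos_phase α Λ k (n := 0)).continuous)
  have hs : RectBounded α Λ fun z => f z * sin (phase α Λ k z) :=
    hf.mul (.of_continuous (contDiff_sin_phase α Λ k (n := 0)).continuous)
  have h1 : torusBasis.repr (rectLift hΛ hf) k
      = ∫ τ, UnitAddTorus.mFourier (-k) τ • rectLift hΛ hf τ ∂torusMeasure :=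
    UnitAddTorus.mFourierBasis_repr _ _
  have h2 : (∫ τ, UnitAddTorus.mFourier (-k) τ • rectLift hΛ hf τ ∂torusMeasure)
      = ∫ τ, (((f (wrap α Λ τ) * cos (phase α Λ k (wrap α Λ τ)) : ℝ) : ℂ)
          - Complex.I * ((f (wrap α Λ τ) * sin (phase α Λ k (wrap α Λ τ)) : ℝ) : ℂ))
          ∂torusMeasure := by
    refine integral_congr_ae ?_
    filter_upwards [(hf.memLp hΛ).coeFn_toLp] with τ h
    simp only [rectLift, h, smul_eq_mul]
    rw [UnitAddTorus.mFourier_neg, mFourier_eq_exp_phase (α := α) hΛ, ← Complex.exp_conj, map_mul,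
      Complex.conj_ofReal, Complex.conj_I, mul_neg, ← neg_mul, ← Complex.ofReal_neg,
      Complex.exp_mul_I, ← Complex.ofReal_cos, ← Complex.ofReal_sin, Real.cos_neg, Real.sin_neg]
    push_cast
    ring
  rw [h1, h2, integral_sub (hc.integrable hΛ).ofReal ((hs.integrable hΛ).ofReal.const_mul _),
    MeasureTheory.integral_const_mul, integral_complex_ofReal, integral_complex_ofReal,
    integral_wrap hΛ hc, integral_wrap hΛ hs]
  push_cast
  ring

/-- Convergence of lifts from bounded pointwise convergence. -/
theorem tendsto_rectLift {α Λ : ℝ} (hΛ : 0 < Λ) {f : ℕ → ℝ × ℝ → ℝ} {g : ℝ × ℝ → ℝ}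
    (hf : ∀ n, RectBounded α Λ (f n)) (hg : RectBounded α Λ g) (C : ℝ)
    (hC : ∀ n, ∀ z ∈ Icc (-π) π ×ˢ Icc α (α + Λ), |f n z| ≤ C)
    (hlim : ∀ z, Tendsto (fun n => f n z) atTop (𝓝 (g z))) :
    Tendsto (fun n => rectLift hΛ (hf n)) atTop (𝓝 (rectLift hΛ hg)) := by
  obtain ⟨D, hD⟩ := hg.2
  rw [tendsto_iff_norm_sub_tendsto_zero]
  have h1 : ∀ n, ‖rectLift hΛ (hf n) - rectLift hΛ hg‖
      = √(∫ τ, (f n (wrap α Λ τ) - g (wrap α Λ τ)) * (f n (wrap α Λ τ) - g (wrap α Λ τ))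
          ∂torusMeasure) := by
    intro n
    have h := inner_rectLift hΛ ((hf n).sub hg) ((hf n).sub hg)
    rw [inner_self_eq_norm_sq_to_K, ← integral_wrap hΛ (((hf n).sub hg).mul ((hf n).sub hg))] at h
    have h' : ‖rectLift hΛ ((hf n).sub hg)‖ ^ 2
        = ∫ τ, (f n (wrap α Λ τ) - g (wrap α Λ τ)) * (f n (wrap α Λ τ) - g (wrap α Λ τ))
          ∂torusMeasure := Complex.ofReal_injective (by rw [Complex.ofReal_pow]; exact h)
    rw [rectLift_sub, ← h', Real.sqrt_sq (norm_nonneg _)]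
  simp only [h1]
  rw [show (0 : ℝ) = √(∫ _, 0 ∂torusMeasure) by simp]
  refine (Real.continuous_sqrt.tendsto _).comp ?_
  refine tendsto_integral_of_dominated_convergence (fun _ => (C + D) * (C + D)) (fun n => ?_)
    (integrable_const _) (fun n => Eventually.of_forall fun τ => ?_)
    (Eventually.of_forall fun τ => ?_)
  · exact ((((hf n).sub hg).mul ((hf n).sub hg)).integrable hΛ).aestronglyMeasurable
  · have hb : |f n (wrap α Λ τ) - g (wrap α Λ τ)| ≤ C + D :=
      (abs_sub _ _).trans (add_le_add (hC n _ (wrap_mem hΛ τ)) (hD _ (wrap_mem hΛ τ)))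
    rw [Real.norm_eq_abs, abs_mul]
    exact mul_le_mul hb hb (abs_nonneg _) ((abs_nonneg _).trans hb)
  · have := (hlim (wrap α Λ τ)).sub_const (g (wrap α Λ τ))
    rw [sub_self] at this
    simpa using this.mul this

/-- `Y` is the derivative of `X` on the rectangle with periodic boundary conditions, in the weak
sense that it multiplies the Fourier coefficients by `iω`. -/
def HasWeakDeriv (α Λ : ℝ) (ω : (Fin 2 → ℤ) → ℝ) (X Y : ℝ × ℝ → ℝ) : Prop :=
  ∀ k, rectIntegral α Λ (fun z => Y z * cos (phase α Λ k z))
      = ω k * rectIntegral α Λ (fun z => X z * sin (phase α Λ k z)) ∧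
    rectIntegral α Λ (fun z => Y z * sin (phase α Λ k z))
      = -(ω k * rectIntegral α Λ (fun z => X z * cos (phase α Λ k z)))

/-- Frequencies of the trigonometric monomials in the horizontal direction. -/
def freqX (k : Fin 2 → ℤ) : ℝ := k 0

/-- Frequencies of the trigonometric monomials in the vertical direction. -/
noncomputable def freqY (Λ : ℝ) (k : Fin 2 → ℤ) : ℝ := 2 * π / Λ * k 1

theorem HasWeakDeriv.repr_eq {α Λ : ℝ} (hΛ : 0 < Λ) {ω : (Fin 2 → ℤ) → ℝ} {X Y : ℝ × ℝ → ℝ}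
    (h : HasWeakDeriv α Λ ω X Y) (hX : RectBounded α Λ X) (hY : RectBounded α Λ Y)
    (k : Fin 2 → ℤ) :
    torusBasis.repr (rectLift hΛ hY) k
      = Complex.I * ω k * torusBasis.repr (rectLift hΛ hX) k := by
  rw [repr_rectLift, repr_rectLift, (h k).1, (h k).2]
  push_cast
  linear_combination ((2 * π * Λ)⁻¹ : ℂ) * ω k
    * rectIntegral α Λ (fun z => X z * sin (phase α Λ k z)) * Complex.I_sq

/-- Integration by parts in the vertical direction. -/
theorem hasWeakDeriv_y {α Λ : ℝ} {X Y : ℝ × ℝ → ℝ} (hX : Continuous X)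
    (hY : Continuous Y) (hd : ∀ x y, HasDerivAt (fun t => X (x, t)) (Y (x, y)) y)
    (h0 : ∀ x, X (x, α) = 0) (h1 : ∀ x, X (x, α + Λ) = 0) : HasWeakDeriv α Λ (freqY Λ) X Y := by
  have key : ∀ (k : Fin 2 → ℤ) {c s : ℝ → ℝ}, (∀ t, HasDerivAt c (s t) t) → Continuous s →
      rectIntegral α Λ (fun z => Y z * c (phase α Λ k z))
        = -(freqY Λ k * rectIntegral α Λ (fun z => X z * s (phase α Λ k z))) := by
    intro k c s hc hs
    rw [rectIntegral, rectIntegral, ← intervalIntegral.integral_const_mul,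
      ← intervalIntegral.integral_neg]
    refine intervalIntegral.integral_congr fun x _ => ?_
    have hp : ∀ y, HasDerivAt (fun t => phase α Λ k (x, t)) (freqY Λ k) y := fun y => by
      have := ((((hasDerivAt_id y).sub_const α).const_mul (2 * π / Λ * k 1)).const_add
        (k 0 * (x + π)))
      simpa [phase, freqY] using this
    have hcd : ∀ y, HasDerivAt (fun t => c (phase α Λ k (x, t)))
        (s (phase α Λ k (x, y)) * freqY Λ k) y := fun y => (hc _).comp y (hp y)
    have hpc : Continuous fun y => phase α Λ k (x, y) :=
      (contDiff_phase α Λ k (n := 0)).continuous.comp (Continuous.prodMk_right x)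
    have := intervalIntegral.integral_deriv_mul_eq_sub (a := α) (b := α + Λ)
      (fun y _ => hd x y) (fun y _ => hcd y)
      ((hY.comp (Continuous.prodMk_right x)).intervalIntegrable _ _)
      (((hs.comp hpc).mul continuous_const).intervalIntegrable _ _)
    rw [h0, h1] at this
    have i1 : IntervalIntegrable (fun y => Y (x, y) * c (phase α Λ k (x, y))) volume α (α + Λ) :=
      ((hY.comp (Continuous.prodMk_right x)).mul
        (continuous_iff_continuousAt.2 fun y => (hcd y).continuousAt)).intervalIntegrable _ _
    have i2 : IntervalIntegrable (fun y => X (x, y) * (s (phase α Λ k (x, y)) * freqY Λ k))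
        volume α (α + Λ) :=
      ((hX.comp (Continuous.prodMk_right x)).mul
        ((hs.comp hpc).mul continuous_const)).intervalIntegrable _ _
    rw [intervalIntegral.integral_add i1 i2] at this
    rw [← intervalIntegral.integral_const_mul]
    have e : (∫ y in α..(α + Λ), X (x, y) * (s (phase α Λ k (x, y)) * freqY Λ k))
        = ∫ y in α..(α + Λ), freqY Λ k * (X (x, y) * s (phase α Λ k (x, y))) := by
      congr! 2; ring
    linarith
  intro k
  refine ⟨?_, key k Real.hasDerivAt_sin Real.continuous_cos⟩
  rw [key k Real.hasDerivAt_cos Real.continuous_sin.neg]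
  simp only [mul_neg, rectIntegral, intervalIntegral.integral_neg, neg_neg]

theorem integral_swap_of_continuous {f : ℝ × ℝ → ℝ} (hf : Continuous f) (a b c d : ℝ) :
    (∫ x in a..b, ∫ y in c..d, f (x, y)) = ∫ y in c..d, ∫ x in a..b, f (x, y) := by
  refine intervalIntegral_intervalIntegral_swap (F := fun x y => f (x, y)) ?_
  exact (hf.continuousOn.integrableOn_compact (isCompact_uIcc.prod isCompact_uIcc)).mono_set
    (prod_mono uIoc_subset_uIcc uIoc_subset_uIcc)

/-- Integration by parts in the horizontal direction. -/
theorem hasWeakDeriv_x {α Λ : ℝ} {X Y : ℝ × ℝ → ℝ} (hX : Continuous X)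
    (hY : Continuous Y) (hd : ∀ x y, HasDerivAt (fun s => X (s, y)) (Y (x, y)) x)
    (hper : ∀ x y, X (x + 2 * π, y) = X (x, y)) : HasWeakDeriv α Λ freqX X Y := by
  have key : ∀ (k : Fin 2 → ℤ) {c s : ℝ → ℝ}, (∀ t, HasDerivAt c (s t) t) → Continuous s →
      (∀ t (n : ℤ), c (t + n * (2 * π)) = c t) →
      rectIntegral α Λ (fun z => Y z * c (phase α Λ k z))
        = -(freqX k * rectIntegral α Λ (fun z => X z * s (phase α Λ k z))) := by
    intro k c s hc hs hcp
    have hcc : Continuous c := continuous_iff_continuousAt.2 fun y => (hc y).continuousAt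
    have hpc := (contDiff_phase α Λ k (n := 0)).continuous
    rw [rectIntegral, rectIntegral,
      integral_swap_of_continuous (f := fun z => X z * s (phase α Λ k z)) (hX.mul (hs.comp hpc)),
      integral_swap_of_continuous (f := fun z => Y z * c (phase α Λ k z)) (hY.mul (hcc.comp hpc)),
      ← intervalIntegral.integral_const_mul, ← intervalIntegral.integral_neg]
    refine intervalIntegral.integral_congr fun y _ => ?_
    have hp : ∀ x, HasDerivAt (fun t => phase α Λ k (t, y)) (freqX k) x := fun x => by
      have := ((((hasDerivAt_id x).add_const π).const_mul (k 0 : ℝ)).add_const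
        (2 * π / Λ * k 1 * (y - α)))
      simpa [phase, freqX] using this
    have hcd : ∀ x, HasDerivAt (fun t => c (phase α Λ k (t, y)))
        (s (phase α Λ k (x, y)) * freqX k) x := fun x => (hc _).comp x (hp x)
    have hpx : Continuous fun x => phase α Λ k (x, y) := hpc.comp (Continuous.prodMk_left y)
    have hXx : Continuous fun x => X (x, y) := hX.comp (Continuous.prodMk_left y)
    have hYx : Continuous fun x => Y (x, y) := hY.comp (Continuous.prodMk_left y)
    have := intervalIntegral.integral_deriv_mul_eq_sub (a := -π) (b := π)
      (fun x _ => hd x y) (fun x _ => hcd x) (hYx.intervalIntegrable _ _)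
      (((hs.comp hpx).mul continuous_const).intervalIntegrable _ _)
    have e0 : (π : ℝ) = -π + 2 * π := by ring
    have e1 : X (π, y) = X (-π, y) := by
      conv_lhs => rw [e0]
      rw [hper]
    have e2 : c (phase α Λ k (π, y)) = c (phase α Λ k (-π, y)) := by
      conv_lhs => rw [e0, phase_add_two_pi, hcp]
    have i1 : IntervalIntegrable (fun x => Y (x, y) * c (phase α Λ k (x, y))) volume (-π) π :=
      (hYx.mul (hcc.comp hpx)).intervalIntegrable _ _
    have i2 : IntervalIntegrable (fun x => X (x, y) * (s (phase α Λ k (x, y)) * freqX k))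
        volume (-π) π := (hXx.mul ((hs.comp hpx).mul continuous_const)).intervalIntegrable _ _
    rw [e1, e2, sub_self, intervalIntegral.integral_add i1 i2] at this
    rw [← intervalIntegral.integral_const_mul]
    have e : (∫ x in (-π)..π, X (x, y) * (s (phase α Λ k (x, y)) * freqX k))
        = ∫ x in (-π)..π, freqX k * (X (x, y) * s (phase α Λ k (x, y))) := by
      congr! 2; ring
    linarith
  intro k
  refine ⟨?_, key k Real.hasDerivAt_sin Real.continuous_cos Real.sin_add_int_mul_two_pi⟩
  rw [key k Real.hasDerivAt_cos Real.continuous_sin.neg Real.cos_add_int_mul_two_pi]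
  simp only [mul_neg, rectIntegral, intervalIntegral.integral_neg, neg_neg]

/-- If `v` and `g` satisfy `Δv = -div g` weakly on the rectangle with periodic boundary conditions,
and `g` can be approximated as in `repr_eq_neg_weak_derivative`, then `∂_y v = -g₂` weakly. -/
theorem rectIntegral_weak_deriv_y {α Λ : ℝ} (hΛ : 0 < Λ) {v g₁ g₂ p p₁ p₂ : ℝ × ℝ → ℝ}
    (hv : RectBounded α Λ v) (hg₁ : RectBounded α Λ g₁) (hg₂ : RectBounded α Λ g₂)
    (hp : RectBounded α Λ p) (hp₁ : RectBounded α Λ p₁) (hp₂ : RectBounded α Λ p₂)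
    (hweak : ∀ k,
      (freqX k ^ 2 + freqY Λ k ^ 2) * rectIntegral α Λ (fun z => v z * cos (phase α Λ k z))
        = freqX k * rectIntegral α Λ (fun z => g₁ z * sin (phase α Λ k z))
          + freqY Λ k * rectIntegral α Λ (fun z => g₂ z * sin (phase α Λ k z)) ∧
      (freqX k ^ 2 + freqY Λ k ^ 2) * rectIntegral α Λ (fun z => v z * sin (phase α Λ k z))
        = -(freqX k * rectIntegral α Λ (fun z => g₁ z * cos (phase α Λ k z))
          + freqY Λ k * rectIntegral α Λ (fun z => g₂ z * cos (phase α Λ k z))))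
    (hpp₁ : HasWeakDeriv α Λ freqX p p₁) (hpp₂ : HasWeakDeriv α Λ (freqY Λ) p p₂)
    {X₁ Y₁ X₂ Y₂ : ℕ → ℝ × ℝ → ℝ}
    (bX₁ : ∀ n, RectBounded α Λ (X₁ n)) (bY₁ : ∀ n, RectBounded α Λ (Y₁ n))
    (bX₂ : ∀ n, RectBounded α Λ (X₂ n)) (bY₂ : ∀ n, RectBounded α Λ (Y₂ n))
    (hXY₁ : ∀ n, HasWeakDeriv α Λ freqX (X₁ n) (Y₁ n))
    (hXY₂ : ∀ n, HasWeakDeriv α Λ (freqY Λ) (X₂ n) (Y₂ n))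
    (hpair₁ : ∀ n, rectIntegral α Λ (fun z => X₁ n z * g₁ z)
      = rectIntegral α Λ (fun z => Y₁ n z * v z))
    (hpair₂ : ∀ n, rectIntegral α Λ (fun z => X₂ n z * g₂ z)
      = rectIntegral α Λ (fun z => Y₂ n z * v z))
    (C : ℝ) (hC₁ : ∀ n, ∀ z ∈ Icc (-π) π ×ˢ Icc α (α + Λ), |X₁ n z| ≤ C)
    (hC₂ : ∀ n, ∀ z ∈ Icc (-π) π ×ˢ Icc α (α + Λ), |X₂ n z| ≤ C)
    (hlim₁ : ∀ z, Tendsto (fun n => X₁ n z) atTop (𝓝 (p₁ z - g₁ z)))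
    (hlim₂ : ∀ z, Tendsto (fun n => X₂ n z) atTop (𝓝 (p₂ z - g₂ z)))
    {X Y : ℝ × ℝ → ℝ} (hX : RectBounded α Λ X) (hY : RectBounded α Λ Y)
    (hXY : HasWeakDeriv α Λ (freqY Λ) X Y) :
    rectIntegral α Λ (fun z => X z * g₂ z) = rectIntegral α Λ (fun z => Y z * v z) := by
  have hr := repr_eq_neg_weak_derivative torusBasis (ω₁ := freqX) (ω₂ := freqY Λ)
    (v := rectLift hΛ hv) (g₁ := rectLift hΛ hg₁) (g₂ := rectLift hΛ hg₂) (p := rectLift hΛ hp)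
    (p₁ := rectLift hΛ hp₁) (p₂ := rectLift hΛ hp₂)
    (X₁ := fun n => rectLift hΛ (bX₁ n)) (Y₁ := fun n => rectLift hΛ (bY₁ n))
    (X₂ := fun n => rectLift hΛ (bX₂ n)) (Y₂ := fun n => rectLift hΛ (bY₂ n))
    (fun k => by
      obtain ⟨h1, h2⟩ := hweak k
      rw [repr_rectLift, repr_rectLift, repr_rectLift]
      have h1' := congrArg (fun r : ℝ => (r : ℂ)) h1
      have h2' := congrArg (fun r : ℝ => (r : ℂ)) h2
      push_cast at h1' h2' ⊢
      linear_combination ((2 * π * Λ)⁻¹ : ℂ) * h1' - Complex.I * ((2 * π * Λ)⁻¹ : ℂ) * h2'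
        + ((2 * π * Λ)⁻¹ : ℂ)
          * (freqX k * rectIntegral α Λ (fun z => g₁ z * sin (phase α Λ k z))
          + freqY Λ k * rectIntegral α Λ (fun z => g₂ z * sin (phase α Λ k z))) * Complex.I_sq)
    (hpp₁.repr_eq hΛ hp hp₁) (hpp₂.repr_eq hΛ hp hp₂)
    (fun n => (hXY₁ n).repr_eq hΛ (bX₁ n) (bY₁ n)) (fun n => (hXY₂ n).repr_eq hΛ (bX₂ n) (bY₂ n))
    (fun n => by rw [inner_rectLift, inner_rectLift, hpair₁])
    (fun n => by rw [inner_rectLift, inner_rectLift, hpair₂])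
    (by rw [rectLift_sub]; exact tendsto_rectLift hΛ bX₁ (hp₁.sub hg₁) C hC₁ hlim₁)
    (by rw [rectLift_sub]; exact tendsto_rectLift hΛ bX₂ (hp₂.sub hg₂) C hC₂ hlim₂)
  have h := inner_multiplier_skew torusBasis (ω := freqY Λ) (X := rectLift hΛ hX)
    (Y := rectLift hΛ hY) (v := rectLift hΛ hv) (D := -rectLift hΛ hg₂)
    (hXY.repr_eq hΛ hX hY) (fun k => by rw [map_neg, lp.coeFn_neg, Pi.neg_apply, hr k, neg_neg])
  rw [inner_neg_right, neg_inj, inner_rectLift, inner_rectLift] at h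
  have h' := Complex.ofReal_injective h
  have hne : (2 * π * Λ)⁻¹ ≠ 0 := by
    have := Real.pi_pos
    positivity
  exact mul_left_cancel₀ hne h'

/-! ### Cutoff functions of a layer -/

/-- A `C²` cutoff that is `1` near the closed layer between the graphs of `a` and `b` and vanishes
at vertical distance `2 / (n + 1)` from it. -/
noncomputable def layerCutoff (a b : ℝ → ℝ) (n : ℕ) (z : ℝ × ℝ) : ℝ :=
  smoothTransition (2 + (n + 1) * (z.2 - a z.1)) * smoothTransition (2 + (n + 1) * (b z.1 - z.2))

/-- The closed layer between two graphs, over the whole line. -/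
def closedLayer (a b : ℝ → ℝ) : Set (ℝ × ℝ) := {z | a z.1 ≤ z.2 ∧ z.2 ≤ b z.1}

theorem isClosed_closedLayer {a b : ℝ → ℝ} (ha : Continuous a) (hb : Continuous b) :
    IsClosed (closedLayer a b) :=
  (isClosed_le (ha.comp continuous_fst) continuous_snd).inter
    (isClosed_le continuous_snd (hb.comp continuous_fst))

section Cutoff

variable {a b : ℝ → ℝ}

theorem contDiff_layerCutoff (ha : ContDiff ℝ 2 a) (hb : ContDiff ℝ 2 b) (n : ℕ) :
    ContDiff ℝ 2 (layerCutoff a b n) := by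
  have h1 : ContDiff ℝ 2 fun z : ℝ × ℝ => 2 + ((n : ℝ) + 1) * (z.2 - a z.1) :=
    contDiff_const.add (contDiff_const.mul (contDiff_snd.sub (ha.comp contDiff_fst)))
  have h2 : ContDiff ℝ 2 fun z : ℝ × ℝ => 2 + ((n : ℝ) + 1) * (b z.1 - z.2) :=
    contDiff_const.add (contDiff_const.mul ((hb.comp contDiff_fst).sub contDiff_snd))
  exact (smoothTransition.contDiff.comp h1).mul (smoothTransition.contDiff.comp h2)

theorem layerCutoff_nonneg (n : ℕ) (z : ℝ × ℝ) : 0 ≤ layerCutoff a b n z :=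
  mul_nonneg (smoothTransition.nonneg _) (smoothTransition.nonneg _)

theorem layerCutoff_le_one (n : ℕ) (z : ℝ × ℝ) : layerCutoff a b n z ≤ 1 :=
  mul_le_one₀ (smoothTransition.le_one _) (smoothTransition.nonneg _) (smoothTransition.le_one _)

theorem layerCutoff_eventuallyEq_one (ha : Continuous a) (hb : Continuous b) (n : ℕ) {z : ℝ × ℝ}
    (hz : z ∈ closedLayer a b) : ∀ᶠ w in 𝓝 z, layerCutoff a b n w = 1 := by
  have h1 : ∀ᶠ w : ℝ × ℝ in 𝓝 z, 1 < 2 + ((n : ℝ) + 1) * (w.2 - a w.1) := by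
    refine ContinuousAt.eventually_lt continuousAt_const (by fun_prop) ?_
    have := mul_nonneg (by positivity : (0 : ℝ) ≤ n + 1) (sub_nonneg.2 hz.1)
    linarith
  have h2 : ∀ᶠ w : ℝ × ℝ in 𝓝 z, 1 < 2 + ((n : ℝ) + 1) * (b w.1 - w.2) := by
    refine ContinuousAt.eventually_lt continuousAt_const (by fun_prop) ?_
    have := mul_nonneg (by positivity : (0 : ℝ) ≤ n + 1) (sub_nonneg.2 hz.2)
    linarith
  filter_upwards [h1, h2] with w h1 h2
  rw [layerCutoff, smoothTransition.one_of_one_le h1.le, smoothTransition.one_of_one_le h2.le,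
    one_mul]

theorem layerCutoff_eq_one (n : ℕ) {z : ℝ × ℝ} (hz : z ∈ closedLayer a b) :
    layerCutoff a b n z = 1 := by
  have h1 := mul_nonneg (by positivity : (0 : ℝ) ≤ n + 1) (sub_nonneg.2 hz.1)
  have h2 := mul_nonneg (by positivity : (0 : ℝ) ≤ n + 1) (sub_nonneg.2 hz.2)
  rw [layerCutoff, smoothTransition.one_of_one_le (by linarith),
    smoothTransition.one_of_one_le (by linarith), one_mul]

theorem layerCutoff_eq_zero (n : ℕ) {z : ℝ × ℝ}
    (hz : 2 + ((n : ℝ) + 1) * (z.2 - a z.1) ≤ 0 ∨ 2 + ((n : ℝ) + 1) * (b z.1 - z.2) ≤ 0) :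
    layerCutoff a b n z = 0 := by
  rcases hz with h | h <;> simp [layerCutoff, smoothTransition.zero_of_nonpos h]

theorem layerCutoff_eventually_eq_zero {z : ℝ × ℝ} (hz : z ∉ closedLayer a b) :
    ∀ᶠ n : ℕ in atTop, layerCutoff a b n z = 0 := by
  have key : ∀ t : ℝ, t < 0 → ∀ᶠ n : ℕ in atTop, 2 + ((n : ℝ) + 1) * t ≤ 0 := by
    intro t ht
    filter_upwards [eventually_ge_atTop (Nat.ceil (2 / (-t)))] with n hn
    have h1 : 2 / (-t) ≤ n := (Nat.le_ceil _).trans (by exact_mod_cast hn)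
    rw [div_le_iff₀ (by linarith)] at h1
    nlinarith
  by_cases h : a z.1 ≤ z.2
  · have h' : b z.1 - z.2 < 0 := by
      by_contra h'
      exact hz ⟨h, by linarith⟩
    exact (key _ h').mono fun n hn => layerCutoff_eq_zero n (Or.inr hn)
  · exact (key (z.2 - a z.1) (by linarith)).mono fun n hn => layerCutoff_eq_zero n (Or.inl hn)

theorem layerCutoff_periodic (hap : ∀ x, a (x + 2 * π) = a x) (hbp : ∀ x, b (x + 2 * π) = b x)
    (n : ℕ) (x y : ℝ) : layerCutoff a b n (x + 2 * π, y) = layerCutoff a b n (x, y) := by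
  simp only [layerCutoff, hap, hbp]

end Cutoff

theorem dx_congr {f g : ℝ × ℝ → ℝ} {z : ℝ × ℝ} (h : f =ᶠ[𝓝 z] g) : dx f z = dx g z := by
  have hc : Tendsto (fun s : ℝ => (s, z.2)) (𝓝 z.1) (𝓝 z) :=
    (Continuous.prodMk_left z.2).tendsto z.1
  exact EventuallyEq.deriv_eq (hc.eventually h)

theorem dy_congr {f g : ℝ × ℝ → ℝ} {z : ℝ × ℝ} (h : f =ᶠ[𝓝 z] g) : dy f z = dy g z := by
  have hc : Tendsto (fun t : ℝ => (z.1, t)) (𝓝 z.2) (𝓝 z) :=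
    (Continuous.prodMk_right z.1).tendsto z.2
  exact EventuallyEq.deriv_eq (hc.eventually h)

theorem periodic_bounded {f : ℝ → ℝ} (hf : Continuous f) (hp : ∀ x, f (x + 2 * π) = f x) :
    ∃ C, ∀ x, |f x| ≤ C := by
  obtain ⟨C, hC⟩ := (isCompact_Icc (a := -π) (b := π)).exists_bound_of_continuousOn hf.continuousOn
  exact ⟨C, periodic_forall hp (p := fun r => |r| ≤ C) hC⟩

/-! ### Rigidity of the overdetermined problem in a layer -/

theorem rectIntegral_indicator {a b : ℝ → ℝ} {α Λ : ℝ} (hab : ∀ x, a x ≤ b x)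
    (ha : ∀ x, α ≤ a x) (hb : ∀ x, b x ≤ α + Λ) (f c : ℝ × ℝ → ℝ) :
    rectIntegral α Λ (fun z => (closedLayer a b).indicator f z * c z)
      = ∫ x in (-π)..π, ∫ y in (a x)..(b x), f (x, y) * c (x, y) := by
  refine intervalIntegral.integral_congr fun x _ => ?_
  simp only
  have e : ∀ y, (closedLayer a b).indicator f (x, y) * c (x, y)
      = (Icc (a x) (b x)).indicator (fun y => f (x, y) * c (x, y)) y := by
    intro y
    by_cases h : (x, y) ∈ closedLayer a b
    · rw [indicator_of_mem h, indicator_of_mem (show y ∈ Icc (a x) (b x) from h)]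
    · rw [indicator_of_notMem h, indicator_of_notMem (show y ∉ Icc (a x) (b x) from h), zero_mul]
  simp only [e]
  rw [intervalIntegral.integral_of_le (((ha x).trans (hab x)).trans (hb x)),
    intervalIntegral.integral_of_le (hab x), ← integral_Icc_eq_integral_Ioc,
    ← integral_Icc_eq_integral_Ioc, setIntegral_indicator measurableSet_Icc,
    inter_eq_self_of_subset_right (Icc_subset_Icc (ha x) (hb x))]

section Rigidity

variable {a b : ℝ → ℝ} {ψ u : ℝ × ℝ → ℝ}

theorem dx_comp_phase {α Λ : ℝ} (k : Fin 2 → ℤ) {c s : ℝ → ℝ} (hc : ∀ t, HasDerivAt c (s t) t)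
    (z : ℝ × ℝ) : dx (fun z => c (phase α Λ k z)) z = freqX k * s (phase α Λ k z) := by
  have hp : HasDerivAt (fun t => phase α Λ k (t, z.2)) (freqX k) z.1 := by
    have := ((((hasDerivAt_id z.1).add_const π).const_mul (k 0 : ℝ)).add_const
      (2 * π / Λ * k 1 * (z.2 - α)))
    simpa [phase, freqX] using this
  rw [mul_comm]
  exact ((hc _).comp z.1 hp).deriv

theorem dy_comp_phase {α Λ : ℝ} (k : Fin 2 → ℤ) {c s : ℝ → ℝ} (hc : ∀ t, HasDerivAt c (s t) t)
    (z : ℝ × ℝ) : dy (fun z => c (phase α Λ k z)) z = freqY Λ k * s (phase α Λ k z) := by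
  have hp : HasDerivAt (fun t => phase α Λ k (z.1, t)) (freqY Λ k) z.2 := by
    have := ((((hasDerivAt_id z.2).sub_const α).const_mul (2 * π / Λ * k 1)).const_add
      (k 0 * (z.1 + π)))
    simpa [phase, freqY] using this
  rw [mul_comm]
  exact ((hc _).comp z.2 hp).deriv

theorem dx_const_mul (r : ℝ) (f : ℝ × ℝ → ℝ) (z : ℝ × ℝ) :
    dx (fun z => r * f z) z = r * dx f z := by
  simp only [dx, deriv_const_mul_field]

theorem dy_const_mul (r : ℝ) (f : ℝ × ℝ → ℝ) (z : ℝ × ℝ) :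
    dy (fun z => r * f z) z = r * dy f z := by
  simp only [dy, deriv_const_mul_field]

theorem lap_comp_phase {α Λ : ℝ} (k : Fin 2 → ℤ) {c s r : ℝ → ℝ} (hc : ∀ t, HasDerivAt c (s t) t)
    (hs : ∀ t, HasDerivAt s (r t) t) (z : ℝ × ℝ) :
    lap (fun z => c (phase α Λ k z)) z
      = (freqX k ^ 2 + freqY Λ k ^ 2) * r (phase α Λ k z) := by
  rw [lap_eq, funext (dx_comp_phase k hc), funext (dy_comp_phase k hc), dx_const_mul, dy_const_mul,
    dx_comp_phase k hs, dy_comp_phase k hs]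
  ring

/-- If `∫ ∇ψ·∇φ - u Δφ = 0` over the layer for all periodic `φ`, without any boundary condition on
`φ`, then the extension of `u` by zero has the weak derivative `-∂_y ψ` in the layer and `0`
outside. -/
theorem layer_weak_deriv_y (ha : ContDiff ℝ 2 a) (hb : ContDiff ℝ 2 b)
    (hap : ∀ x, a (x + 2 * π) = a x) (hbp : ∀ x, b (x + 2 * π) = b x) (hab : ∀ x, a x ≤ b x)
    (hψ : ContDiff ℝ 2 ψ) (hψp : ∀ x y, ψ (x + 2 * π, y) = ψ (x, y)) (hu : Continuous u)
    (hI : ∀ φ : ℝ × ℝ → ℝ, ContDiff ℝ 2 φ → (∀ x y, φ (x + 2 * π, y) = φ (x, y)) →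
      ∫ x in (-π)..π, ∫ y in (a x)..(b x), (dx ψ (x, y) * dx φ (x, y) + dy ψ (x, y) * dy φ (x, y)
        - u (x, y) * lap φ (x, y)) = 0)
    {X Y : ℝ × ℝ → ℝ} (hX : Continuous X) (hY : Continuous Y)
    (hXY : ∀ x y, HasDerivAt (fun t => X (x, t)) (Y (x, y)) y) :
    (∫ x in (-π)..π, ∫ y in (a x)..(b x), dy ψ (x, y) * X (x, y))
      = ∫ x in (-π)..π, ∫ y in (a x)..(b x), u (x, y) * Y (x, y) := by
  have hac := ha.continuous
  have hbc := hb.continuous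
  obtain ⟨Ca, hCa⟩ := periodic_bounded hac hap
  obtain ⟨Cb, hCb⟩ := periodic_bounded hbc hbp
  -- A rectangle containing the supports of all cutoffs in its interior.
  set α : ℝ := -Ca - 3 with hα
  set Λ : ℝ := Cb + 3 - α with hΛdef
  have haα : ∀ x, α + 3 ≤ a x := fun x => by linarith [neg_abs_le (a x), hCa x]
  have hbΛ : ∀ x, b x + 3 ≤ α + Λ := fun x => by linarith [le_abs_self (b x), hCb x]
  have hΛ : 0 < Λ := by linarith [haα 0, hbΛ 0, hab 0]
  set D := closedLayer a b with hD
  have hDm : MeasurableSet D := (isClosed_closedLayer hac hbc).measurableSet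
  have hind : ∀ {f : ℝ × ℝ → ℝ}, Continuous f → RectBounded α Λ (D.indicator f) := by
    intro f hf
    obtain ⟨C, hC⟩ := (RectBounded.of_continuous (α := α) (Λ := Λ) hf).2
    refine ⟨hf.measurable.indicator hDm, C, fun z hz => ?_⟩
    exact (norm_indicator_le_norm_self f z).trans (hC z hz)
  have hri : ∀ f c : ℝ × ℝ → ℝ, rectIntegral α Λ (fun z => D.indicator f z * c z)
      = ∫ x in (-π)..π, ∫ y in (a x)..(b x), f (x, y) * c (x, y) :=
    rectIntegral_indicator hab (fun x => by linarith [haα x]) (fun x => by linarith [hbΛ x])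
  set τ := layerCutoff a b with hτ
  have hτC := contDiff_layerCutoff ha hb
  have hτp := layerCutoff_periodic hap hbp
  -- The cutoffs vanish near the horizontal sides of the rectangle.
  have hτα : ∀ n x, ∀ᶠ w in 𝓝 ((x, α) : ℝ × ℝ), τ n w = 0 := by
    intro n x
    have : ∀ᶠ w : ℝ × ℝ in 𝓝 (x, α), w.2 - a w.1 < -2 := by
      refine ContinuousAt.eventually_lt (by fun_prop) continuousAt_const ?_
      simp only
      linarith [haα x]
    filter_upwards [this] with w hw
    refine layerCutoff_eq_zero n (Or.inl ?_)
    nlinarith [(Nat.cast_nonneg n : (0 : ℝ) ≤ n)]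
  have hτβ : ∀ n x, ∀ᶠ w in 𝓝 ((x, α + Λ) : ℝ × ℝ), τ n w = 0 := by
    intro n x
    have : ∀ᶠ w : ℝ × ℝ in 𝓝 (x, α + Λ), b w.1 - w.2 < -2 := by
      refine ContinuousAt.eventually_lt (by fun_prop) continuousAt_const ?_
      simp only
      linarith [hbΛ x]
    filter_upwards [this] with w hw
    refine layerCutoff_eq_zero n (Or.inr ?_)
    nlinarith [(Nat.cast_nonneg n : (0 : ℝ) ≤ n)]
  set p : ℝ × ℝ → ℝ := fun z => τ 0 z * ψ z with hp
  have hpC : ContDiff ℝ 2 p := (hτC 0).mul hψ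
  have hpC1 : ContDiff ℝ 1 p := hpC.of_le one_le_two
  have hpp : ∀ x y, p (x + 2 * π, y) = p (x, y) := fun x y => by
    simp only [hp, hψp, hτ, hτp]
  have hpα : ∀ x, p =ᶠ[𝓝 (x, α)] fun _ => 0 := fun x => by
    filter_upwards [hτα 0 x] with w hw
    simp only [hp, hw, zero_mul]
  have hpβ : ∀ x, p =ᶠ[𝓝 (x, α + Λ)] fun _ => 0 := fun x => by
    filter_upwards [hτβ 0 x] with w hw
    simp only [hp, hw, zero_mul]
  have hpD : ∀ z ∈ D, p =ᶠ[𝓝 z] ψ := fun z hz => by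
    filter_upwards [layerCutoff_eventuallyEq_one hac hbc 0 hz] with w hw
    simp only [hp, hτ, hw, one_mul]
  have dy0 : ∀ z, dy (fun _ => (0 : ℝ)) z = 0 := fun z => by simp [dy]
  have dx0 : ∀ z, dx (fun _ => (0 : ℝ)) z = 0 := fun z => by simp [dx]
  have hX0C : ∀ {q : ℝ × ℝ → ℝ}, ContDiff ℝ 1 q → ∀ n, ContDiff ℝ 1 fun z => (1 - τ n z) * q z :=
    fun hq n => (contDiff_const.sub ((hτC n).of_le one_le_two)).mul hq
  have hX0D : ∀ (q : ℝ × ℝ → ℝ) (n : ℕ), ∀ z ∈ D,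
      (fun z => (1 - τ n z) * q z) =ᶠ[𝓝 z] fun _ => 0 := by
    intro q n z hz
    filter_upwards [layerCutoff_eventuallyEq_one hac hbc n hz] with w hw
    simp only [hτ, hw, sub_self, zero_mul]
  have hX0le : ∀ (q : ℝ × ℝ → ℝ) (n : ℕ) (z : ℝ × ℝ), |(1 - τ n z) * q z| ≤ |q z| := by
    intro q n z
    rw [abs_mul]
    refine mul_le_of_le_one_left (abs_nonneg _) ?_
    rw [abs_le]
    constructor <;> linarith [layerCutoff_nonneg (a := a) (b := b) n z,
      layerCutoff_le_one (a := a) (b := b) n z]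
  have hX0lim : ∀ (q f : ℝ × ℝ → ℝ), (∀ z ∈ D, q z = f z) → ∀ z,
      Tendsto (fun n => (1 - τ n z) * q z) atTop (𝓝 (q z - D.indicator f z)) := by
    intro q f hqf z
    by_cases hz : z ∈ D
    · rw [indicator_of_mem hz, hqf z hz, sub_self]
      refine tendsto_const_nhds.congr fun n => ?_
      rw [hτ, layerCutoff_eq_one n hz, sub_self, zero_mul]
    · rw [indicator_of_notMem hz, sub_zero]
      refine tendsto_const_nhds.congr' ?_
      filter_upwards [layerCutoff_eventually_eq_zero hz] with n hn
      rw [hτ, hn, sub_zero, one_mul]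
  have hzero : ∀ {f : ℝ × ℝ → ℝ}, (∀ z, f z = 0) → rectIntegral α Λ f = 0 := by
    intro f hf
    simp [rectIntegral, hf]
  obtain ⟨C₁, hC₁⟩ := (RectBounded.of_continuous (α := α) (Λ := Λ) (continuous_dx hpC1)).2
  obtain ⟨C₂, hC₂⟩ := (RectBounded.of_continuous (α := α) (Λ := Λ) (continuous_dy hpC1)).2
  have hψ1 := hψ.of_le one_le_two
  have cx := continuous_dx hψ1
  have cy := continuous_dy hψ1
  -- The test function `X`, cut off so that it vanishes on the horizontal sides.
  set X' : ℝ × ℝ → ℝ := fun z => τ 0 z * X z with hX'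
  set Y' : ℝ × ℝ → ℝ := fun z => dy (τ 0) z * X z + τ 0 z * Y z with hY'
  have hτ1 : ContDiff ℝ 1 (τ 0) := (hτC 0).of_le one_le_two
  have hX'c : Continuous X' := hτ1.continuous.mul hX
  have hY'c : Continuous Y' := ((continuous_dy hτ1).mul hX).add (hτ1.continuous.mul hY)
  have main := rectIntegral_weak_deriv_y (α := α) hΛ (v := D.indicator u) (g₁ := D.indicator (dx ψ))
    (g₂ := D.indicator (dy ψ)) (p := p) (p₁ := dx p) (p₂ := dy p) (hind hu) (hind cx) (hind cy)
    (.of_continuous hpC.continuous) (.of_continuous (continuous_dx hpC1))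
    (.of_continuous (continuous_dy hpC1))
    (by
      intro k
      have key : ∀ {c s r : ℝ → ℝ}, (∀ t, HasDerivAt c (s t) t) → (∀ t, HasDerivAt s (r t) t) →
          ContDiff ℝ 2 c → (∀ t (n : ℤ), c (t + n * (2 * π)) = c t) → Continuous s → Continuous r →
          (freqX k * ∫ x in (-π)..π, ∫ y in (a x)..(b x),
              dx ψ (x, y) * s (phase α Λ k (x, y)))
            + (freqY Λ k * ∫ x in (-π)..π, ∫ y in (a x)..(b x),
              dy ψ (x, y) * s (phase α Λ k (x, y)))
            - (freqX k ^ 2 + freqY Λ k ^ 2) * (∫ x in (-π)..π, ∫ y in (a x)..(b x),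
              u (x, y) * r (phase α Λ k (x, y))) = 0 := by
        intro c s r hc hs hcC hcper hsc hrc
        have hph := (contDiff_phase α Λ k (n := 0)).continuous
        have h := hI (fun z => c (phase α Λ k z)) (hcC.comp (contDiff_phase α Λ k)) (fun x y => by
          rw [phase_add_two_pi, hcper])
        simp only [dx_comp_phase k hc, dy_comp_phase k hc, lap_comp_phase k hc hs] at h
        rw [← h, ← layer_integral_const_mul (fun z => dx ψ z * s (phase α Λ k z)),
          ← layer_integral_const_mul (fun z => dy ψ z * s (phase α Λ k z)),
          ← layer_integral_const_mul (fun z => u z * r (phase α Λ k z)),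
          ← layer_integral_add (f := fun z => freqX k * (dx ψ z * s (phase α Λ k z)))
            (g := fun z => freqY Λ k * (dy ψ z * s (phase α Λ k z)))
            ((cx.mul (hsc.comp hph)).const_mul _) ((cy.mul (hsc.comp hph)).const_mul _) hac hbc,
          ← layer_integral_sub (f := fun z => freqX k * (dx ψ z * s (phase α Λ k z))
              + freqY Λ k * (dy ψ z * s (phase α Λ k z)))
            (g := fun z => (freqX k ^ 2 + freqY Λ k ^ 2) * (u z * r (phase α Λ k z)))
            (((cx.mul (hsc.comp hph)).const_mul _).add ((cy.mul (hsc.comp hph)).const_mul _))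
            ((hu.mul (hrc.comp hph)).const_mul _) hac hbc]
        refine intervalIntegral.integral_congr fun x _ =>
          intervalIntegral.integral_congr fun y _ => ?_
        ring
      have h1 := key Real.hasDerivAt_cos (fun t => (Real.hasDerivAt_sin t).neg) Real.contDiff_cos
        Real.cos_add_int_mul_two_pi Real.continuous_sin.neg Real.continuous_cos.neg
      have h2 := key Real.hasDerivAt_sin Real.hasDerivAt_cos Real.contDiff_sin
        Real.sin_add_int_mul_two_pi Real.continuous_cos Real.continuous_sin.neg
      simp only [mul_neg, intervalIntegral.integral_neg] at h1 h2
      simp only [hri]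
      constructor <;> linarith)
    (hasWeakDeriv_x hpC.continuous (continuous_dx hpC1) (hasDerivAt_dx hpC1) hpp)
    (hasWeakDeriv_y hpC.continuous (continuous_dy hpC1) (hasDerivAt_dy hpC1)
      (fun x => (hpα x).eq_of_nhds) (fun x => (hpβ x).eq_of_nhds))
    (X₁ := fun n z => (1 - τ n z) * dx p z) (Y₁ := fun n => dx fun z => (1 - τ n z) * dx p z)
    (X₂ := fun n z => (1 - τ n z) * dy p z) (Y₂ := fun n => dy fun z => (1 - τ n z) * dy p z)
    (fun n => .of_continuous (hX0C (contDiff_dx hpC) n).continuous)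
    (fun n => .of_continuous (continuous_dx (hX0C (contDiff_dx hpC) n)))
    (fun n => .of_continuous (hX0C (contDiff_dy hpC) n).continuous)
    (fun n => .of_continuous (continuous_dy (hX0C (contDiff_dy hpC) n)))
    (fun n => hasWeakDeriv_x (hX0C (contDiff_dx hpC) n).continuous
      (continuous_dx (hX0C (contDiff_dx hpC) n)) (hasDerivAt_dx (hX0C (contDiff_dx hpC) n))
      (fun x y => by simp only [hτ, hτp, dx_periodic hpp]))
    (fun n => hasWeakDeriv_y (hX0C (contDiff_dy hpC) n).continuous
      (continuous_dy (hX0C (contDiff_dy hpC) n)) (hasDerivAt_dy (hX0C (contDiff_dy hpC) n))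
      (fun x => by simp only [dy_congr (hpα x), dy0, mul_zero])
      (fun x => by simp only [dy_congr (hpβ x), dy0, mul_zero]))
    (fun n => by
      rw [hzero, hzero] <;> intro z <;> by_cases hz : z ∈ D
      · rw [dx_congr (hX0D _ n z hz), dx0, zero_mul]
      · rw [indicator_of_notMem hz, mul_zero]
      · rw [(hX0D (dx p) n z hz).eq_of_nhds, zero_mul]
      · rw [indicator_of_notMem hz, mul_zero])
    (fun n => by
      rw [hzero, hzero] <;> intro z <;> by_cases hz : z ∈ D
      · rw [dy_congr (hX0D _ n z hz), dy0, zero_mul]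
      · rw [indicator_of_notMem hz, mul_zero]
      · rw [(hX0D (dy p) n z hz).eq_of_nhds, zero_mul]
      · rw [indicator_of_notMem hz, mul_zero])
    (max C₁ C₂) (fun n z hz => (hX0le _ n z).trans ((hC₁ z hz).trans (le_max_left _ _)))
    (fun n z hz => (hX0le _ n z).trans ((hC₂ z hz).trans (le_max_right _ _)))
    (hX0lim _ _ fun z hz => dx_congr (hpD z hz)) (hX0lim _ _ fun z hz => dy_congr (hpD z hz))
    (X := X') (Y := Y') (.of_continuous hX'c) (.of_continuous hY'c)
    (hasWeakDeriv_y hX'c hY'c (fun x y => (hasDerivAt_dy hτ1 x y).mul (hXY x y))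
      (fun x => by simp only [hX', (hτα 0 x).self_of_nhds, zero_mul])
      (fun x => by simp only [hX', (hτβ 0 x).self_of_nhds, zero_mul]))
  rw [funext fun z => mul_comm (X' z) _, funext fun z => mul_comm (Y' z) _, hri, hri] at main
  have hmem : ∀ {x y}, y ∈ uIcc (a x) (b x) → (x, y) ∈ D := fun {x y} hy => by
    rw [uIcc_of_le (hab x)] at hy
    exact hy
  have dy1 : ∀ z, dy (fun _ => (1 : ℝ)) z = 0 := fun z => by simp [dy]
  refine Eq.trans ?_ (main.trans ?_)
  · refine intervalIntegral.integral_congr fun x _ =>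
      intervalIntegral.integral_congr fun y hy => ?_
    simp only [hX', hτ, layerCutoff_eq_one 0 (hmem hy), one_mul]
  · refine intervalIntegral.integral_congr fun x _ =>
      intervalIntegral.integral_congr fun y hy => ?_
    have h1 : dy (τ 0) (x, y) = 0 := by
      rw [dy_congr (layerCutoff_eventuallyEq_one hac hbc 0 (hmem hy)), dy1]
    have h2 : τ 0 (x, y) = 1 := layerCutoff_eq_one 0 (hmem hy)
    simp only [hY', h1, h2, one_mul, zero_mul, zero_add]

/-- A continuous periodic function with vanishing integral of its square over a layer vanishes in
the closed layer. -/
theorem eq_zero_of_layer_integral_sq {f : ℝ × ℝ → ℝ} (hf : Continuous f)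
    (ha : Continuous a) (hb : Continuous b) (hab : ∀ x, a x < b x)
    (h : ∫ x in (-π)..π, ∫ y in (a x)..(b x), f (x, y) ^ 2 = 0) :
    ∀ x ∈ Icc (-π) π, ∀ y ∈ Icc (a x) (b x), f (x, y) = 0 := by
  intro x hx
  have hc := continuous_layer_integral (f := fun z => f z ^ 2) (hf.pow 2) ha hb
  have hnn : ∀ x, 0 ≤ ∫ y in (a x)..(b x), f (x, y) ^ 2 := fun x =>
    intervalIntegral.integral_nonneg (hab x).le fun y _ => sq_nonneg _
  have h0 : (∫ y in (a x)..(b x), f (x, y) ^ 2) = 0 := by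
    by_contra hne
    have := intervalIntegral.integral_pos (by linarith [Real.pi_pos] : (-π : ℝ) < π)
      hc.continuousOn (fun x _ => hnn x) ⟨x, hx, lt_of_le_of_ne (hnn x) (Ne.symm hne)⟩
    linarith
  exact eq_zero_of_integral_sq_eq_zero (f := fun y => f (x, y))
    (hf.comp (Continuous.prodMk_right x)) (hab x) h0

/-- If the weak equation holds for all test functions, without any boundary condition, then `u` is
a constant minus `ψ` and vanishes on both boundaries. -/
theorem layer_rigidity (ha : ContDiff ℝ 2 a) (hb : ContDiff ℝ 2 b)
    (hap : ∀ x, a (x + 2 * π) = a x) (hbp : ∀ x, b (x + 2 * π) = b x) (hab : ∀ x, a x < b x)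
    (hψ : ContDiff ℝ 2 ψ) (hψp : ∀ x y, ψ (x + 2 * π, y) = ψ (x, y)) (hu : Continuous u)
    (hup : ∀ x y, u (x + 2 * π, y) = u (x, y))
    (hI : ∀ φ : ℝ × ℝ → ℝ, ContDiff ℝ 2 φ → (∀ x y, φ (x + 2 * π, y) = φ (x, y)) →
      ∫ x in (-π)..π, ∫ y in (a x)..(b x), (dx ψ (x, y) * dx φ (x, y) + dy ψ (x, y) * dy φ (x, y)
        - u (x, y) * lap φ (x, y)) = 0) :
    ∃ C, (∀ x, ∀ y ∈ Icc (a x) (b x), u (x, y) + ψ (x, y) = C) ∧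
      (∀ x, ψ (x, a x) = C) ∧ ∀ x, ψ (x, b x) = C := by
  have hac := ha.continuous
  have hbc := hb.continuous
  have hψc := hψ.continuous
  have hψ1 := hψ.of_le one_le_two
  -- Integrating by parts in the weak derivative turns it into a relation for `u + ψ`.
  have star : ∀ {X Y : ℝ × ℝ → ℝ}, Continuous X → Continuous Y →
      (∀ x y, HasDerivAt (fun t => X (x, t)) (Y (x, y)) y) →
      (∫ x in (-π)..π, ∫ y in (a x)..(b x), (u (x, y) + ψ (x, y)) * Y (x, y))
        = ∫ x in (-π)..π, (ψ (x, b x) * X (x, b x) - ψ (x, a x) * X (x, a x)) := by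
    intro X Y hX hY hXY
    have h := layer_weak_deriv_y ha hb hap hbp (fun x => (hab x).le) hψ hψp hu hI hX hY hXY
    have h1 : ∀ x, (∫ y in (a x)..(b x), (dy ψ (x, y) * X (x, y) + ψ (x, y) * Y (x, y)))
        = ψ (x, b x) * X (x, b x) - ψ (x, a x) * X (x, a x) := fun x =>
      intervalIntegral.integral_deriv_mul_eq_sub (fun y _ => hasDerivAt_dy hψ1 x y)
        (fun y _ => hXY x y)
        (((continuous_dy hψ1).comp (Continuous.prodMk_right x)).intervalIntegrable _ _)
        ((hY.comp (Continuous.prodMk_right x)).intervalIntegrable _ _)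
    simp only [← h1]
    rw [layer_integral_add (f := fun z => dy ψ z * X z) (g := fun z => ψ z * Y z)
      ((continuous_dy hψ1).mul hX) (hψc.mul hY) hac hbc, h,
      ← layer_integral_add (f := fun z => u z * Y z) (g := fun z => ψ z * Y z)
      (hu.mul hY) (hψc.mul hY) hac hbc]
    simp only [add_mul]
  set m : ℝ → ℝ := fun x => ψ (x, b x) with hm
  have hmC : ContDiff ℝ 2 m := hψ.comp (contDiff_id.prodMk hb)
  have hmc := hmC.continuous
  have hmp : ∀ x, m (x + 2 * π) = m x := fun x => by simp only [hm, hbp, hψp]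
  -- A test function depending on `x` only: `ψ` takes the same value at both ends of a vertical.
  have hma : ∀ x, ψ (x, a x) = m x := by
    have hδ : Continuous fun x => m x - ψ (x, a x) := by fun_prop
    have h := star (X := fun z => m z.1 - ψ (z.1, a z.1)) (Y := fun _ => 0)
      (hδ.comp continuous_fst) continuous_const
      (fun x y => hasDerivAt_const y (m x - ψ (x, a x)))
    simp only [mul_zero, intervalIntegral.integral_zero] at h
    have h' : ∫ x in (-π)..π, (m x - ψ (x, a x)) ^ 2 = 0 := by
      rw [h]
      refine intervalIntegral.integral_congr fun x _ => ?_
      simp only [hm]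
      ring
    have h2 := periodic_forall (f := fun x => m x - ψ (x, a x))
      (fun x => by simp only [hmp, hap, hψp]) (p := fun r => r = 0)
      (eq_zero_of_integral_sq_eq_zero hδ (by linarith [Real.pi_pos]) h')
    exact fun x => by linarith [h2 x]
  -- A test function with vertical derivative `u + ψ - m`, vanishing on the lower boundary.
  set q : ℝ × ℝ → ℝ := fun z => u z + ψ z - m z.1 with hq
  have hqc : Continuous q := by fun_prop
  have hqx : ∀ x, Continuous fun y => q (x, y) := fun x => hqc.comp (Continuous.prodMk_right x)
  have hq0 : ∫ x in (-π)..π, ∫ y in (a x)..(b x), q (x, y) ^ 2 = 0 := by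
    set X : ℝ × ℝ → ℝ := fun z => ∫ t in (a z.1)..z.2, q (z.1, t) with hX
    have hXc : Continuous X := by
      have h1 : Continuous (Function.uncurry fun (w : ℝ × ℝ) (t : ℝ) => q (w.1, t)) :=
        hqc.comp (by fun_prop : Continuous fun v : (ℝ × ℝ) × ℝ => (v.1.1, v.2))
      have e : ∀ w : ℝ × ℝ, X w = (∫ t in (0 : ℝ)..w.2, q (w.1, t))
          - ∫ t in (0 : ℝ)..(a w.1), q (w.1, t) := fun w =>
        (intervalIntegral.integral_interval_sub_left
          ((hqx w.1).intervalIntegrable _ _) ((hqx w.1).intervalIntegrable _ _)).symm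
      rw [funext e]
      exact (continuous_parametric_intervalIntegral_of_continuous h1 continuous_snd).sub
        (continuous_parametric_intervalIntegral_of_continuous h1 (hac.comp continuous_fst))
    have h := star hXc hqc fun x y => ((hqx x).integral_hasStrictDerivAt (a x) y).hasDerivAt
    have h1 : ∀ x, ψ (x, b x) * X (x, b x) - ψ (x, a x) * X (x, a x)
        = ∫ y in (a x)..(b x), m x * q (x, y) := fun x => by
      rw [intervalIntegral.integral_const_mul]
      simp only [hX, intervalIntegral.integral_same, mul_zero, sub_zero, hm]
    simp only [h1] at h
    have h2 := layer_integral_sub (f := fun z => (u z + ψ z) * q z) (g := fun z => m z.1 * q z)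
      (by fun_prop) (by fun_prop) hac hbc (-π) π
    rw [h, sub_self] at h2
    rw [← h2]
    refine intervalIntegral.integral_congr fun x _ => intervalIntegral.integral_congr fun y _ => ?_
    simp only [hq]
    ring
  have hqz := eq_zero_of_layer_integral_sq hqc hac hbc hab hq0
  -- Testing with `m` itself shows that `m` is constant.
  have hm1 := hmC.of_le one_le_two
  have hmd : Continuous (deriv m) := hm1.continuous_deriv le_rfl
  have dxm : ∀ z, dx (fun z => m z.1) z = deriv m z.1 := fun z => rfl
  have dym : ∀ z, dy (fun z => m z.1) z = 0 := fun z => by simp [dy]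
  have hφC : ContDiff ℝ 2 fun z : ℝ × ℝ => m z.1 := hmC.comp contDiff_fst
  have hθC : ContDiff ℝ 1 fun z : ℝ × ℝ => ψ z - m z.1 := hψ1.sub (hφC.of_le one_le_two)
  have hg := layer_green (θ := fun z => ψ z - m z.1) (φ := fun z => m z.1) hθC hφC
    (fun x y => by simp only [hψp, hmp]) (fun x y => by simp only [hmp])
    (ha.of_le one_le_two) (hb.of_le one_le_two) hap hbp
  have hw := hI (fun z => m z.1) hφC (fun x y => by simp only [hmp])
  simp only [hma, sub_self, zero_mul, intervalIntegral.integral_zero, dxm, dym, mul_zero,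
    add_zero] at hg hw
  simp only [show ∀ x, ψ (x, b x) = m x from fun _ => rfl, sub_self, zero_mul,
    intervalIntegral.integral_zero] at hg
  have dxθ : ∀ z, dx (fun z => ψ z - m z.1) z = dx ψ z - deriv m z.1 := fun z =>
    ((hasDerivAt_dx hψ1 z.1 z.2).sub (hm1.differentiable one_ne_zero z.1).hasDerivAt).deriv
  have hlc := continuous_lap hφC
  have hcx := continuous_dx hψ1
  have hm0 : ∫ x in (-π)..π, ∫ y in (a x)..(b x), deriv m x ^ 2 = 0 := by
    have h2 := layer_integral_sub
      (f := fun z => dx ψ z * deriv m z.1 - u z * lap (fun z => m z.1) z)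
      (g := fun z => dx (fun z => ψ z - m z.1) z * deriv m z.1
        + (ψ z - m z.1) * lap (fun z => m z.1) z)
      (by fun_prop) (by have := continuous_dx hθC; fun_prop) hac hbc (-π) π
    rw [hg, hw, sub_self] at h2
    rw [← h2]
    refine intervalIntegral.integral_congr fun x hx =>
      intervalIntegral.integral_congr fun y hy => ?_
    rw [uIcc_of_le (by linarith [Real.pi_pos])] at hx
    rw [uIcc_of_le (hab x).le] at hy
    have hz := hqz x hx y hy
    simp only [hq] at hz
    simp only [dxθ]
    linear_combination lap (fun z => m z.1) (x, y) * hz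
  have hdm : ∀ x, deriv m x = 0 := periodic_forall (deriv_periodic hmp) (p := fun r => r = 0)
    fun x hx => eq_zero_of_layer_integral_sq (f := fun z => deriv m z.1) (hmd.comp continuous_fst)
      hac hbc hab hm0 x hx (a x) (left_mem_Icc.2 (hab x).le)
  have hmconst : ∀ x, m x = m 0 := fun x =>
    is_const_of_deriv_eq_zero (hm1.differentiable one_ne_zero) hdm x 0
  refine ⟨m 0, fun x y hy => ?_, fun x => by rw [hma, hmconst], hmconst⟩
  obtain ⟨n, hn⟩ := periodic_exists_mem_Icc x
  have hz := hqz _ hn y (by rwa [periodic_add_int hap, periodic_add_int hbp])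
  have e1 := periodic_add_int (f := fun x => u (x, y)) (fun x => hup x y) x n
  have e2 := periodic_add_int (f := fun x => ψ (x, y)) (fun x => hψp x y) x n
  simp only [hq, e1, e2] at hz
  rw [hmconst] at hz
  linarith

theorem dx_sub_const_mul_snd {φ : ℝ × ℝ → ℝ} (hφ : ContDiff ℝ 1 φ) (κ : ℝ) (z : ℝ × ℝ) :
    dx (fun z => φ z - κ * z.2) z = dx φ z :=
  ((hasDerivAt_dx hφ z.1 z.2).sub_const (κ * z.2)).deriv

theorem dy_sub_const_mul_snd {φ : ℝ × ℝ → ℝ} (hφ : ContDiff ℝ 1 φ) (κ : ℝ) (z : ℝ × ℝ) :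
    dy (fun z => φ z - κ * z.2) z = dy φ z - κ := by
  have h := ((hasDerivAt_dy hφ z.1 z.2).sub ((hasDerivAt_id z.2).const_mul κ)).deriv
  rw [mul_one] at h
  exact h

theorem lap_sub_const_mul_snd {φ : ℝ × ℝ → ℝ} (hφ : ContDiff ℝ 2 φ) (κ : ℝ) (z : ℝ × ℝ) :
    lap (fun z => φ z - κ * z.2) z = lap φ z := by
  rw [lap_eq, lap_eq, funext (dx_sub_const_mul_snd (hφ.of_le one_le_two) κ),
    funext (dy_sub_const_mul_snd (hφ.of_le one_le_two) κ)]
  congr 1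
  exact ((hasDerivAt_dy (contDiff_dy hφ) z.1 z.2).sub_const κ).deriv

theorem flux_sub_const_mul_snd {φ : ℝ × ℝ → ℝ} (hφ : ContDiff ℝ 1 φ) (κ : ℝ) (c : ℝ → ℝ) (x : ℝ) :
    flux (fun z => φ z - κ * z.2) c x = flux φ c x - κ := by
  simp only [flux, dx_sub_const_mul_snd hφ, dy_sub_const_mul_snd hφ]
  ring

/-- Rigidity for test functions with zero flux through the graph of `c`. The flux constraint
produces a Lagrange multiplier `l`, which is absorbed by adding a multiple of `θ`, whose Green
identity has the flux through the graph of `c` as its only boundary term. -/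
theorem layer_rigidity_of_flux (ha : ContDiff ℝ 2 a) (hb : ContDiff ℝ 2 b)
    (hap : ∀ x, a (x + 2 * π) = a x) (hbp : ∀ x, b (x + 2 * π) = b x) (hab : ∀ x, a x < b x)
    (hψ : ContDiff ℝ 2 ψ) (hψp : ∀ x y, ψ (x + 2 * π, y) = ψ (x, y)) (hu : Continuous u)
    (hup : ∀ x y, u (x + 2 * π, y) = u (x, y)) {c : ℝ → ℝ} (hc : ContDiff ℝ 1 c)
    {θ : ℝ × ℝ → ℝ} (hθ : ContDiff ℝ 2 θ) (hθp : ∀ x y, θ (x + 2 * π, y) = θ (x, y))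
    (hgreen : ∀ φ : ℝ × ℝ → ℝ, ContDiff ℝ 2 φ → (∀ x y, φ (x + 2 * π, y) = φ (x, y)) →
      ∫ x in (-π)..π, ∫ y in (a x)..(b x),
        (dx θ (x, y) * dx φ (x, y) + dy θ (x, y) * dy φ (x, y) + θ (x, y) * lap φ (x, y))
        = ∫ x in (-π)..π, flux φ c x)
    (hI : ∀ φ : ℝ × ℝ → ℝ, ContDiff ℝ 2 φ → (∀ x y, φ (x + 2 * π, y) = φ (x, y)) →
      ∫ x in (-π)..π, flux φ c x = 0 →
      ∫ x in (-π)..π, ∫ y in (a x)..(b x), (dx ψ (x, y) * dx φ (x, y) + dy ψ (x, y) * dy φ (x, y)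
        - u (x, y) * lap φ (x, y)) = 0) :
    ∃ C l, (∀ x, ∀ y ∈ Icc (a x) (b x), u (x, y) + ψ (x, y) = C) ∧
      (∀ x, ψ (x, a x) = C + l * θ (x, a x)) ∧ ∀ x, ψ (x, b x) = C + l * θ (x, b x) := by
  have hac := ha.continuous
  have hbc := hb.continuous
  have hψ1 := hψ.of_le one_le_two
  have hθ1 := hθ.of_le one_le_two
  have cx := continuous_dx hψ1
  have cy := continuous_dy hψ1
  have tx := continuous_dx hθ1
  have ty := continuous_dy hθ1
  have hθc := hθ.continuous
  set J : (ℝ × ℝ → ℝ) → ℝ := fun φ => ∫ x in (-π)..π, ∫ y in (a x)..(b x),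
    (dx ψ (x, y) * dx φ (x, y) + dy ψ (x, y) * dy φ (x, y) - u (x, y) * lap φ (x, y)) with hJ
  set l : ℝ := (∫ x in (-π)..π, ∫ y in (a x)..(b x), dy ψ (x, y)) / (2 * π) with hl
  have hpi := Real.pi_pos
  have hmult : ∀ φ : ℝ × ℝ → ℝ, ContDiff ℝ 2 φ → (∀ x y, φ (x + 2 * π, y) = φ (x, y)) →
      J φ = l * ∫ x in (-π)..π, flux φ c x := by
    intro φ hφ hφp
    have hφ1 := hφ.of_le one_le_two
    set κ : ℝ := (∫ x in (-π)..π, flux φ c x) / (2 * π) with hκ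
    have h := hI (fun z => φ z - κ * z.2) (hφ.sub (contDiff_const.mul contDiff_snd))
      (fun x y => by simp only [hφp]) (by
        simp only [flux_sub_const_mul_snd hφ1]
        rw [intervalIntegral.integral_sub ((continuous_flux hφ1 hc).intervalIntegrable _ _)
          intervalIntegrable_const, intervalIntegral.integral_const, hκ, smul_eq_mul]
        field_simp
        ring)
    simp only [dx_sub_const_mul_snd hφ1, dy_sub_const_mul_snd hφ1, lap_sub_const_mul_snd hφ] at h
    have px := continuous_dx hφ1
    have py := continuous_dy hφ1
    have pl := continuous_lap hφ
    have h2 := layer_integral_sub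
      (f := fun z => dx ψ z * dx φ z + dy ψ z * dy φ z - u z * lap φ z)
      (g := fun z => κ * dy ψ z) (by fun_prop) (by fun_prop) hac hbc (-π) π
    rw [layer_integral_const_mul (dy ψ)] at h2
    have h3 : (∫ x in (-π)..π, ∫ y in (a x)..(b x),
        (dx ψ (x, y) * dx φ (x, y) + dy ψ (x, y) * dy φ (x, y) - u (x, y) * lap φ (x, y)
          - κ * dy ψ (x, y))) = 0 := by
      rw [← h]
      refine intervalIntegral.integral_congr fun x _ =>
        intervalIntegral.integral_congr fun y _ => ?_
      ring
    have h4 : J φ = κ * ∫ x in (-π)..π, ∫ y in (a x)..(b x), dy ψ (x, y) := by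
      simp only [hJ]
      linarith
    rw [h4, hκ, hl]
    ring
  obtain ⟨C, h1, h2, h3⟩ := layer_rigidity (ψ := fun z => ψ z - l * θ z)
    (u := fun z => u z + l * θ z) ha hb hap hbp hab (hψ.sub (contDiff_const.mul hθ)) (fun x y => by simp only [hψp, hθp])
    (by fun_prop) (fun x y => by simp only [hup, hθp]) (by
      intro φ hφ hφp
      have hφ1 := hφ.of_le one_le_two
      have px := continuous_dx hφ1
      have py := continuous_dy hφ1
      have pl := continuous_lap hφ
      have e1 : ∀ z, dx (fun z => ψ z - l * θ z) z = dx ψ z - l * dx θ z := fun z =>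
        ((hasDerivAt_dx hψ1 z.1 z.2).sub ((hasDerivAt_dx hθ1 z.1 z.2).const_mul l)).deriv
      have e2 : ∀ z, dy (fun z => ψ z - l * θ z) z = dy ψ z - l * dy θ z := fun z =>
        ((hasDerivAt_dy hψ1 z.1 z.2).sub ((hasDerivAt_dy hθ1 z.1 z.2).const_mul l)).deriv
      have h := layer_integral_sub
        (f := fun z => dx ψ z * dx φ z + dy ψ z * dy φ z - u z * lap φ z)
        (g := fun z => l * (dx θ z * dx φ z + dy θ z * dy φ z + θ z * lap φ z))
        (by fun_prop) (by fun_prop) hac hbc (-π) π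
      rw [layer_integral_const_mul (fun z => dx θ z * dx φ z + dy θ z * dy φ z + θ z * lap φ z),
        hgreen φ hφ hφp, show (∫ x in (-π)..π, ∫ y in (a x)..(b x),
          (dx ψ (x, y) * dx φ (x, y) + dy ψ (x, y) * dy φ (x, y) - u (x, y) * lap φ (x, y)))
            = l * ∫ x in (-π)..π, flux φ c x from hmult φ hφ hφp, sub_self] at h
      rw [← h]
      refine intervalIntegral.integral_congr fun x _ =>
        intervalIntegral.integral_congr fun y _ => ?_
      simp only [e1, e2]
      ring)
  exact ⟨C, l, fun x y hy => by linarith [h1 x y hy], fun x => by linarith [h2 x],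
    fun x => by linarith [h3 x]⟩

/-- Rigidity for test functions with zero flux through the lower boundary. -/
theorem layer_rigidity_lower (ha : ContDiff ℝ 2 a) (hb : ContDiff ℝ 2 b)
    (hap : ∀ x, a (x + 2 * π) = a x) (hbp : ∀ x, b (x + 2 * π) = b x) (hab : ∀ x, a x < b x)
    (hψ : ContDiff ℝ 2 ψ) (hψp : ∀ x y, ψ (x + 2 * π, y) = ψ (x, y)) (hu : Continuous u)
    (hup : ∀ x y, u (x + 2 * π, y) = u (x, y))
    (hI : ∀ φ : ℝ × ℝ → ℝ, ContDiff ℝ 2 φ → (∀ x y, φ (x + 2 * π, y) = φ (x, y)) →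
      ∫ x in (-π)..π, flux φ a x = 0 →
      ∫ x in (-π)..π, ∫ y in (a x)..(b x), (dx ψ (x, y) * dx φ (x, y) + dy ψ (x, y) * dy φ (x, y)
        - u (x, y) * lap φ (x, y)) = 0) :
    ∃ C K, (∀ x, ∀ y ∈ Icc (a x) (b x), u (x, y) + ψ (x, y) = C) ∧
      (∀ x, ψ (x, a x) = K) ∧ ∀ x, ψ (x, b x) = C := by
  have hne : ∀ x, b x - a x ≠ 0 := fun x => (sub_pos.2 (hab x)).ne'
  have hθ : ContDiff ℝ 2 fun z : ℝ × ℝ => (z.2 - b z.1) / (b z.1 - a z.1) :=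
    (contDiff_snd.sub (hb.comp contDiff_fst)).div
      ((hb.comp contDiff_fst).sub (ha.comp contDiff_fst)) fun z => hne z.1
  have e : ∀ x, (a x - b x) / (b x - a x) = -1 := fun x => by
    rw [div_eq_iff (hne x)]
    ring
  obtain ⟨C, l, h1, h2, h3⟩ := layer_rigidity_of_flux ha hb hap hbp hab hψ hψp hu hup
    (ha.of_le one_le_two) hθ (fun x y => by simp only [hap, hbp]) (fun φ hφ hφp => by
      rw [layer_green (hθ.of_le one_le_two) hφ (fun x y => by simp only [hap, hbp]) hφp
        (ha.of_le one_le_two) (hb.of_le one_le_two) hap hbp]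
      simp [e]) hI
  refine ⟨C, C - l, h1, fun x => ?_, fun x => ?_⟩
  · rw [h2]
    simp only [e]
    ring
  · rw [h3]
    simp

/-- Rigidity for test functions with zero flux through the upper boundary. -/
theorem layer_rigidity_upper (ha : ContDiff ℝ 2 a) (hb : ContDiff ℝ 2 b)
    (hap : ∀ x, a (x + 2 * π) = a x) (hbp : ∀ x, b (x + 2 * π) = b x) (hab : ∀ x, a x < b x)
    (hψ : ContDiff ℝ 2 ψ) (hψp : ∀ x y, ψ (x + 2 * π, y) = ψ (x, y)) (hu : Continuous u)
    (hup : ∀ x y, u (x + 2 * π, y) = u (x, y))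
    (hI : ∀ φ : ℝ × ℝ → ℝ, ContDiff ℝ 2 φ → (∀ x y, φ (x + 2 * π, y) = φ (x, y)) →
      ∫ x in (-π)..π, flux φ b x = 0 →
      ∫ x in (-π)..π, ∫ y in (a x)..(b x), (dx ψ (x, y) * dx φ (x, y) + dy ψ (x, y) * dy φ (x, y)
        - u (x, y) * lap φ (x, y)) = 0) :
    ∃ C K, (∀ x, ∀ y ∈ Icc (a x) (b x), u (x, y) + ψ (x, y) = C) ∧
      (∀ x, ψ (x, a x) = C) ∧ ∀ x, ψ (x, b x) = K := by
  have hne : ∀ x, b x - a x ≠ 0 := fun x => (sub_pos.2 (hab x)).ne'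
  have hθ : ContDiff ℝ 2 fun z : ℝ × ℝ => (z.2 - a z.1) / (b z.1 - a z.1) :=
    (contDiff_snd.sub (ha.comp contDiff_fst)).div
      ((hb.comp contDiff_fst).sub (ha.comp contDiff_fst)) fun z => hne z.1
  obtain ⟨C, l, h1, h2, h3⟩ := layer_rigidity_of_flux ha hb hap hbp hab hψ hψp hu hup
    (hb.of_le one_le_two) hθ (fun x y => by simp only [hap, hbp]) (fun φ hφ hφp => by
      rw [layer_green (hθ.of_le one_le_two) hφ (fun x y => by simp only [hap, hbp]) hφp
        (ha.of_le one_le_two) (hb.of_le one_le_two) hap hbp]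
      simp [div_self (hne _)]) hI
  refine ⟨C, C + l, h1, fun x => ?_, fun x => ?_⟩
  · rw [h2]
    simp
  · rw [h3]
    simp [div_self (hne x)]

end Rigidity

/-! ### Joint continuity of the potentials -/

/-- A family of bijections of the line depending continuously on a parameter has inverses depending
continuously on the parameter. -/
theorem continuous_uncurry_inverse {E : Type*} [TopologicalSpace E] {f γ : E → ℝ → ℝ}
    (hf : Continuous (Function.uncurry f)) (hl : ∀ y, Function.LeftInverse (γ y) (f y))
    (hr : ∀ y, Function.RightInverse (γ y) (f y)) : Continuous (Function.uncurry γ) := by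
  rw [continuous_iff_continuousAt]
  rintro ⟨y₀, q₀⟩
  rw [Metric.continuousAt_iff']
  intro ε hε
  set p₀ := γ y₀ q₀ with hp₀
  have hfp : f y₀ p₀ = q₀ := hr y₀ q₀
  have hpt : ∀ p, ContinuousAt (fun w : E × ℝ => f w.1 p) (y₀, q₀) := fun p =>
    (hf.comp (by fun_prop : Continuous fun w : E × ℝ => (w.1, p))).continuousAt
  have hsec : ∀ y, Continuous (f y) := fun y => hf.comp (Continuous.prodMk_right y)
  have hcl : ∀ w : E × ℝ, w.2 ∈ f w.1 '' Ioo (p₀ - ε) (p₀ + ε) →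
      dist (Function.uncurry γ w) (Function.uncurry γ (y₀, q₀)) < ε := by
    rintro ⟨y, q⟩ ⟨p, hp, hpq⟩
    simp only at hpq
    simp only [Function.uncurry, ← hp₀, ← hpq, hl y p, Real.dist_eq, abs_lt]
    constructor <;> linarith [hp.1, hp.2]
  rcases (hsec y₀).strictMono_of_inj (hl y₀).injective with hm | hm
  · have h1 := (hpt (p₀ - ε)).eventually_lt continuousAt_snd
      (by simpa [hfp] using hm (sub_lt_self p₀ hε))
    have h2 := (continuousAt_snd (p := (y₀, q₀))).eventually_lt (hpt (p₀ + ε))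
      (by simpa [hfp] using hm (lt_add_of_pos_right p₀ hε))
    filter_upwards [h1, h2] with w h1 h2
    exact hcl w (intermediate_value_Ioo (by linarith) (hsec w.1).continuousOn ⟨h1, h2⟩)
  · have h1 := (continuousAt_snd (p := (y₀, q₀))).eventually_lt (hpt (p₀ - ε))
      (by simpa [hfp] using hm (sub_lt_self p₀ hε))
    have h2 := (hpt (p₀ + ε)).eventually_lt continuousAt_snd
      (by simpa [hfp] using hm (lt_add_of_pos_right p₀ hε))
    filter_upwards [h1, h2] with w h1 h2
    exact hcl w (intermediate_value_Ioo' (by linarith) (hsec w.1).continuousOn ⟨h2, h1⟩)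

/-- A family of primitives is jointly continuous if the derivative is and if the values along one
continuous curve depend continuously on the parameter. -/
theorem continuous_uncurry_of_deriv {Φ γ : ℝ → ℝ → ℝ} (hγ : Continuous (Function.uncurry γ))
    (hd : ∀ y q, HasDerivAt (Φ y) (γ y q) q) {s : ℝ → ℝ} (hs : Continuous s)
    (hbase : Continuous fun y => Φ y (s y)) : Continuous (Function.uncurry Φ) := by
  have e : ∀ w : ℝ × ℝ, Function.uncurry Φ w = Φ w.1 (s w.1)
      + ((∫ t in (0 : ℝ)..w.2, γ w.1 t) - ∫ t in (0 : ℝ)..(s w.1), γ w.1 t) := by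
    intro w
    have hc : Continuous (γ w.1) := hγ.comp (Continuous.prodMk_right w.1)
    rw [intervalIntegral.integral_interval_sub_left (hc.intervalIntegrable _ _)
      (hc.intervalIntegrable _ _), intervalIntegral.integral_eq_sub_of_hasDerivAt
      (fun t _ => hd w.1 t) (hc.intervalIntegrable _ _)]
    simp [Function.uncurry]
  rw [funext e]
  have h1 : Continuous (Function.uncurry fun (w : ℝ × ℝ) (t : ℝ) => γ w.1 t) :=
    hγ.comp (by fun_prop : Continuous fun v : (ℝ × ℝ) × ℝ => (v.1.1, v.2))
  exact (hbase.comp continuous_fst).add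
    ((continuous_parametric_intervalIntegral_of_continuous h1 continuous_snd).sub
      (continuous_parametric_intervalIntegral_of_continuous h1 (hs.comp continuous_fst)))

/-- The projection of the line to `[-d, H]`. Heights are clamped so that the potentials, which are
only controlled in `[-d, h)`, become continuous functions on the whole plane. -/
def clamp (d H y : ℝ) : ℝ := max (-d) (min y H)

theorem continuous_clamp (d H : ℝ) : Continuous (clamp d H) := by
  unfold clamp
  fun_prop

theorem clamp_of_mem {d H y : ℝ} (hy : y ∈ Icc (-d) H) : clamp d H y = y := by
  rw [clamp, min_eq_left hy.2, max_eq_right hy.1]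

theorem clamp_mem {d h H : ℝ} (hdH : -d ≤ H) (hH : H < h) (y : ℝ) :
    clamp d H y ∈ Ico (-d) h :=
  ⟨le_max_left _ _, (max_le hdH (min_le_right _ _)).trans_lt hH⟩

theorem continuous_vort {g : ℝ} {ρ β : ℝ → ℝ} (hρ : ContDiff ℝ 1 ρ) (hβ : Continuous β) :
    Continuous (Function.uncurry (vort g ρ β)) := by
  have h := hρ.continuous_deriv le_rfl
  unfold vort Function.uncurry
  fun_prop

section Potential

variable {g d h H : ℝ} {ρ β : ℝ → ℝ} {F : ℝ → ℝ → ℝ}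

theorem IsPotential.continuous_deriv_clamp (hF : IsPotential g d h ρ β F) (hρ : ContDiff ℝ 1 ρ)
    (hβ : Continuous β) (hdH : -d ≤ H) (hH : H < h) :
    Continuous (Function.uncurry fun y => deriv (F (clamp d H y))) :=
  continuous_uncurry_inverse (f := fun y => vort g ρ β (clamp d H y))
    ((continuous_vort hρ hβ).comp
      (((continuous_clamp d H).comp continuous_fst).prodMk continuous_snd))
    (fun y => (hF _ (clamp_mem hdH hH y)).2.1) (fun y => (hF _ (clamp_mem hdH hH y)).2.2)

theorem IsPotential.hasDerivAt_clamp (hF : IsPotential g d h ρ β F) (hdH : -d ≤ H) (hH : H < h)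
    (y q : ℝ) : HasDerivAt (F (clamp d H y)) (deriv (F (clamp d H y)) q) q :=
  ((hF _ (clamp_mem hdH hH y)).1.1.differentiable two_ne_zero q).hasDerivAt

theorem IsPotential.continuous_clamp_of_base (hF : IsPotential g d h ρ β F) (hρ : ContDiff ℝ 1 ρ)
    (hβ : Continuous β) (hdH : -d ≤ H) (hH : H < h) (p : ℝ)
    (hbase : Continuous fun y => F (clamp d H y) (vort g ρ β (clamp d H y) p)) :
    Continuous (Function.uncurry fun y => F (clamp d H y)) :=
  continuous_uncurry_of_deriv (hF.continuous_deriv_clamp hρ hβ hdH hH)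
    (hF.hasDerivAt_clamp hdH hH)
    (s := fun y => vort g ρ β (clamp d H y) p)
    ((continuous_vort hρ hβ).comp ((continuous_clamp d H).prodMk continuous_const)) hbase

/-- The equation `∂_q F = p` at a height of the layer is the vorticity equation. -/
theorem IsPotential.deriv_clamp_eq_iff (hF : IsPotential g d h ρ β F) (hH : H < h) {y q p : ℝ}
    (hy : y ∈ Icc (-d) H) : deriv (F (clamp d H y)) q = p ↔ q = vort g ρ β y p := by
  rw [clamp_of_mem hy]
  obtain ⟨-, h1, h2⟩ := hF y ⟨hy.1, hy.2.trans_lt hH⟩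
  constructor
  · rintro rfl
    exact (h2 q).symm
  · rintro rfl
    exact h1 p

end Potential

theorem IsNormalized.continuous_upper {g d h H p₁ p₂ : ℝ} {ρ₁ ρ₂ β₁ β₂ : ℝ → ℝ} {F₁ F₂ : ℝ → ℝ → ℝ}
    (hF : IsNormalized g d h p₁ p₂ ρ₁ ρ₂ β₁ β₂ F₁ F₂) (hF₂ : IsPotential g d h ρ₂ β₂ F₂)
    (hρ₂ : ContDiff ℝ 1 ρ₂) (hβ₂ : Continuous β₂) (hdH : -d ≤ H) (hH : H < h) :
    Continuous (Function.uncurry fun y => F₂ (clamp d H y)) := by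
  refine hF₂.continuous_clamp_of_base hρ₂ hβ₂ hdH hH p₂ ?_
  simp only [fun y => (hF _ (clamp_mem hdH hH y)).1]
  have := continuous_clamp d H
  fun_prop

theorem IsNormalized.continuous_lower {g d h H p₁ p₂ : ℝ} {ρ₁ ρ₂ β₁ β₂ : ℝ → ℝ} {F₁ F₂ : ℝ → ℝ → ℝ}
    (hF : IsNormalized g d h p₁ p₂ ρ₁ ρ₂ β₁ β₂ F₁ F₂) (hF₁ : IsPotential g d h ρ₁ β₁ F₁)
    (hF₂ : IsPotential g d h ρ₂ β₂ F₂) (hρ₁ : ContDiff ℝ 1 ρ₁) (hρ₂ : ContDiff ℝ 1 ρ₂)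
    (hβ₁ : Continuous β₁) (hβ₂ : Continuous β₂) (hdH : -d ≤ H) (hH : H < h) :
    Continuous (Function.uncurry fun y => F₁ (clamp d H y)) := by
  refine hF₁.continuous_clamp_of_base hρ₁ hβ₁ hdH hH 0 ?_
  simp only [fun y => (hF _ (clamp_mem hdH hH y)).2]
  have h1 := continuous_clamp d H
  have h2 := hF.continuous_upper hF₂ hρ₂ hβ₂ hdH hH
  have h3 : Continuous fun y => vort g ρ₂ β₂ (clamp d H y) 0 :=
    (continuous_vort hρ₂ hβ₂).comp (h1.prodMk continuous_const)
  have h4 : Continuous fun y => F₂ (clamp d H y) (vort g ρ₂ β₂ (clamp d H y) 0) :=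
    h2.comp (continuous_id.prodMk h3)
  exact h4.add (continuous_const.mul (h1.add continuous_const))

/-! ### The first variation -/

/-- The energy density of a layer with potential `Φ`. -/
noncomputable def density (c d Q : ℝ) (Φ : ℝ → ℝ → ℝ) (ψ : ℝ × ℝ → ℝ) (z : ℝ × ℝ) : ℝ :=
  gradSq ψ z / 2 + c * (z.2 + d) - Q - Φ z.2 (lap ψ z)

theorem continuous_density {c d Q : ℝ} {Φ : ℝ → ℝ → ℝ} (hΦ : Continuous (Function.uncurry Φ))
    {ψ : ℝ × ℝ → ℝ} (hψ : ContDiff ℝ 2 ψ) : Continuous (density c d Q Φ ψ) := by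
  have h1 := continuous_gradSq (hψ.of_le one_le_two)
  have h2 : Continuous fun z : ℝ × ℝ => Φ z.2 (lap ψ z) :=
    hΦ.comp (continuous_snd.prodMk (continuous_lap hψ))
  exact (((h1.div_const 2).add (by fun_prop)).sub continuous_const).sub h2

theorem dx_add_const_mul {ψ φ : ℝ × ℝ → ℝ} (hψ : ContDiff ℝ 1 ψ) (hφ : ContDiff ℝ 1 φ) (s : ℝ)
    (z : ℝ × ℝ) : dx (fun z => ψ z + s * φ z) z = dx ψ z + s * dx φ z :=
  ((hasDerivAt_dx hψ z.1 z.2).add ((hasDerivAt_dx hφ z.1 z.2).const_mul s)).deriv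

theorem dy_add_const_mul {ψ φ : ℝ × ℝ → ℝ} (hψ : ContDiff ℝ 1 ψ) (hφ : ContDiff ℝ 1 φ) (s : ℝ)
    (z : ℝ × ℝ) : dy (fun z => ψ z + s * φ z) z = dy ψ z + s * dy φ z :=
  ((hasDerivAt_dy hψ z.1 z.2).add ((hasDerivAt_dy hφ z.1 z.2).const_mul s)).deriv

theorem lap_add_const_mul {ψ φ : ℝ × ℝ → ℝ} (hψ : ContDiff ℝ 2 ψ) (hφ : ContDiff ℝ 2 φ) (s : ℝ)
    (z : ℝ × ℝ) : lap (fun z => ψ z + s * φ z) z = lap ψ z + s * lap φ z := by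
  simp only [lap_eq]
  rw [funext (dx_add_const_mul (hψ.of_le one_le_two) (hφ.of_le one_le_two) s),
    funext (dy_add_const_mul (hψ.of_le one_le_two) (hφ.of_le one_le_two) s),
    dx_add_const_mul (contDiff_dx hψ) (contDiff_dx hφ),
    dy_add_const_mul (contDiff_dy hψ) (contDiff_dy hφ)]
  ring

/-- The first variation of the energy of a layer, with respect to the stream function and the two
boundaries. -/
theorem hasDerivAt_layer_energy {c d Q : ℝ} {Φ γ : ℝ → ℝ → ℝ}
    (hΦ : Continuous (Function.uncurry Φ)) (hγ : Continuous (Function.uncurry γ))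
    (hd : ∀ y q, HasDerivAt (Φ y) (γ y q) q) {ψ φ : ℝ × ℝ → ℝ} (hψ : ContDiff ℝ 2 ψ)
    (hφ : ContDiff ℝ 2 φ) {a a' b b' : ℝ → ℝ} (ha : Continuous a) (ha' : Continuous a')
    (hb : Continuous b) (hb' : Continuous b') :
    HasDerivAt (fun s => ∫ x in (-π)..π, ∫ y in (a x + s * a' x)..(b x + s * b' x),
        density c d Q Φ (fun z => ψ z + s * φ z) (x, y))
      ((∫ x in (-π)..π, ∫ y in (a x)..(b x), (dx ψ (x, y) * dx φ (x, y) + dy ψ (x, y) * dy φ (x, y)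
          - γ y (lap ψ (x, y)) * lap φ (x, y)))
        + ((∫ x in (-π)..π, b' x * density c d Q Φ ψ (x, b x))
          - ∫ x in (-π)..π, a' x * density c d Q Φ ψ (x, a x))) 0 := by
  have hψ1 := hψ.of_le one_le_two
  have hφ1 := hφ.of_le one_le_two
  have e : ∀ s z, density c d Q Φ (fun z => ψ z + s * φ z) z
      = ((dx ψ z + s * dx φ z) ^ 2 + (dy ψ z + s * dy φ z) ^ 2) / 2 + c * (z.2 + d) - Q
        - Φ z.2 (lap ψ z + s * lap φ z) := fun s z => by
    simp only [density, gradSq, dx_add_const_mul hψ1 hφ1, dy_add_const_mul hψ1 hφ1,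
      lap_add_const_mul hψ hφ]
  have c1 := continuous_dx hψ1
  have c2 := continuous_dy hψ1
  have c3 := continuous_lap hψ
  have c4 := continuous_dx hφ1
  have c5 := continuous_dy hφ1
  have c6 := continuous_lap hφ
  have hq : Continuous fun w : ℝ × (ℝ × ℝ) => (w.2.2, lap ψ w.2 + w.1 * lap φ w.2) := by fun_prop
  have hΦ' : Continuous fun w : ℝ × (ℝ × ℝ) => Φ w.2.2 (lap ψ w.2 + w.1 * lap φ w.2) := hΦ.comp hq
  have hγ' : Continuous fun w : ℝ × (ℝ × ℝ) => γ w.2.2 (lap ψ w.2 + w.1 * lap φ w.2) := hγ.comp hq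
  have h := hasDerivAt_integral_layer
    (L := fun s z => ((dx ψ z + s * dx φ z) ^ 2 + (dy ψ z + s * dy φ z) ^ 2) / 2 + c * (z.2 + d) - Q
        - Φ z.2 (lap ψ z + s * lap φ z))
    (L' := fun s z => (dx ψ z + s * dx φ z) * dx φ z + (dy ψ z + s * dy φ z) * dy φ z
        - γ z.2 (lap ψ z + s * lap φ z) * lap φ z)
    (by unfold Function.uncurry; fun_prop) (by unfold Function.uncurry; fun_prop)
    (fun s z => by
      have l : ∀ p q : ℝ, HasDerivAt (fun s => p + s * q) q s := fun p q => by
        simpa using ((hasDerivAt_id s).mul_const q).const_add p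
      have h1 := (((((l (dx ψ z) (dx φ z)).pow 2).add ((l (dy ψ z) (dy φ z)).pow 2)).div_const
        2).add_const (c * (z.2 + d))).sub_const Q
      have h2 := (hd z.2 (lap ψ z + s * lap φ z)).comp s (l (lap ψ z) (lap φ z))
      refine (h1.sub h2).congr_deriv ?_
      simp only [Nat.cast_ofNat]
      ring) ha ha' hb hb' (-π) π
  simp only [e]
  refine h.congr_deriv ?_
  have hden := continuous_density (c := c) (d := d) (Q := Q) hΦ hψ
  have e0 : ∀ z, ((dx ψ z + 0 * dx φ z) ^ 2 + (dy ψ z + 0 * dy φ z) ^ 2) / 2 + c * (z.2 + d) - Q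
        - Φ z.2 (lap ψ z + 0 * lap φ z) = density c d Q Φ ψ z := fun z => by
    simp only [density, gradSq, zero_mul, add_zero]
  simp only [e0]
  have i1 : Continuous fun x => b' x * density c d Q Φ ψ (x, b x) := by fun_prop
  have i2 : Continuous fun x => a' x * density c d Q Φ ψ (x, a x) := by fun_prop
  have hγ0 : Continuous fun z : ℝ × ℝ => γ z.2 (lap ψ z) := hγ.comp (continuous_snd.prodMk c3)
  have i3 := continuous_layer_integral (f := fun z => dx ψ z * dx φ z + dy ψ z * dy φ z
    - γ z.2 (lap ψ z) * lap φ z) (by fun_prop) ha hb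
  have i4 : IntervalIntegrable (fun x => b' x * density c d Q Φ ψ (x, b x)
      - a' x * density c d Q Φ ψ (x, a x)) volume (-π) π := (i1.sub i2).intervalIntegrable _ _
  simp only [zero_mul, add_zero]
  rw [intervalIntegral.integral_add (i3.intervalIntegrable _ _) i4,
    intervalIntegral.integral_sub (i1.intervalIntegrable _ _) (i2.intervalIntegrable _ _)]

/-- The first variation of the two-layer energy in the direction `P`. -/
noncomputable def firstVariation (d Q₁ Q₂ c₁ c₂ : ℝ) (Φ₁ Φ₂ γ₁ γ₂ : ℝ → ℝ → ℝ) (S P : Flow) : ℝ :=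
  (∫ x in (-π)..π, ∫ y in (-d)..(S.ηi x), (dx S.Ψ₁ (x, y) * dx P.Ψ₁ (x, y)
      + dy S.Ψ₁ (x, y) * dy P.Ψ₁ (x, y) - γ₁ y (lap S.Ψ₁ (x, y)) * lap P.Ψ₁ (x, y)))
  + (∫ x in (-π)..π, ∫ y in (S.ηi x)..(S.ηs x), (dx S.Ψ₂ (x, y) * dx P.Ψ₂ (x, y)
      + dy S.Ψ₂ (x, y) * dy P.Ψ₂ (x, y) - γ₂ y (lap S.Ψ₂ (x, y)) * lap P.Ψ₂ (x, y)))
  + (∫ x in (-π)..π, P.ηi x * (density c₁ d (Q₁ + Q₂) Φ₁ S.Ψ₁ (x, S.ηi x)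
      - density c₂ d Q₂ Φ₂ S.Ψ₂ (x, S.ηi x)))
  + ∫ x in (-π)..π, P.ηs x * density c₂ d Q₂ Φ₂ S.Ψ₂ (x, S.ηs x)

theorem eventually_forall_pos_add_mul {f k : ℝ → ℝ} (hf : Continuous f) (hk : Continuous k)
    (hfp : ∀ x, f (x + 2 * π) = f x) (hkp : ∀ x, k (x + 2 * π) = k x) (hpos : ∀ x, 0 < f x) :
    ∀ᶠ s : ℝ in 𝓝 0, ∀ x, 0 < f x + s * k x := by
  obtain ⟨C, hC⟩ := periodic_bounded hk hkp
  obtain ⟨x₀, -, hx₀⟩ := (isCompact_Icc (a := -π) (b := π)).exists_isMinOn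
    ⟨0, by constructor <;> linarith [Real.pi_pos]⟩ hf.continuousOn
  have hmin : ∀ x, f x₀ ≤ f x := periodic_forall hfp (p := fun r => f x₀ ≤ r) fun x hx => hx₀ hx
  have hev : ∀ᶠ s : ℝ in 𝓝 0, |s| * C < f x₀ :=
    ContinuousAt.eventually_lt (by fun_prop) continuousAt_const (by simpa using hpos x₀)
  filter_upwards [hev] with s hs x
  have h1 : |s * k x| ≤ |s| * C := by
    rw [abs_mul]
    exact mul_le_mul_of_nonneg_left (hC x) (abs_nonneg s)
  linarith [neg_abs_le (s * k x), hmin x]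

/-- A bound for the surface that stays below the height `h`. -/
theorem Flow.IsLayered.exists_height {S : Flow} {d h : ℝ} (hS : S.IsClassical)
    (hl : S.IsLayered d h) : ∃ H, -d ≤ H ∧ H < h ∧ ∀ x, S.ηs x < H := by
  obtain ⟨x₀, -, hx₀⟩ := (isCompact_Icc (a := -π) (b := π)).exists_isMaxOn
    ⟨0, by constructor <;> linarith [Real.pi_pos]⟩ hS.smooth_surface.continuous.continuousOn
  have hmax : ∀ x, S.ηs x ≤ S.ηs x₀ :=
    periodic_forall hS.periodic_surface (p := fun r => r ≤ S.ηs x₀) fun x hx => hx₀ hx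
  obtain ⟨h1, h2, h3⟩ := hl x₀
  exact ⟨(S.ηs x₀ + h) / 2, by linarith, by linarith, fun x => by linarith [hmax x]⟩

theorem hasDerivAt_energy {g d H Q₁ Q₂ p₁ : ℝ} {ρ₁ ρ₂ : ℝ → ℝ} {F₁ F₂ : ℝ → ℝ → ℝ}
    (hΦ₁ : Continuous (Function.uncurry fun y => F₁ (clamp d H y)))
    (hΦ₂ : Continuous (Function.uncurry fun y => F₂ (clamp d H y)))
    (hγ₁ : Continuous (Function.uncurry fun y => deriv (F₁ (clamp d H y))))
    (hγ₂ : Continuous (Function.uncurry fun y => deriv (F₂ (clamp d H y))))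
    (hd₁ : ∀ y q, HasDerivAt (F₁ (clamp d H y)) (deriv (F₁ (clamp d H y)) q) q)
    (hd₂ : ∀ y q, HasDerivAt (F₂ (clamp d H y)) (deriv (F₂ (clamp d H y)) q) q)
    {S P : Flow} (hS : S.IsClassical) (hP : P.IsClassical) (hSl : S.IsLayered d H) (hdH : -d ≤ H) :
    HasDerivAt (fun s : ℝ => energy g d Q₁ Q₂ p₁ ρ₁ ρ₂ F₁ F₂ (S.perturb P s))
      (firstVariation d Q₁ Q₂ (g * ρ₁ p₁) (g * ρ₂ 0) (fun y => F₁ (clamp d H y))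
        (fun y => F₂ (clamp d H y)) (fun y => deriv (F₁ (clamp d H y)))
        (fun y => deriv (F₂ (clamp d H y))) S P) 0 := by
  have ci := hS.smooth_interface.continuous
  have cs := hS.smooth_surface.continuous
  have ci' := hP.smooth_interface.continuous
  have cs' := hP.smooth_surface.continuous
  have h1 := hasDerivAt_layer_energy (c := g * ρ₁ p₁) (d := d) (Q := Q₁ + Q₂) hΦ₁ hγ₁ hd₁
    hS.smooth_lower hP.smooth_lower (a := fun _ => -d) (a' := fun _ => 0) continuous_const
    continuous_const ci ci'
  have h2 := hasDerivAt_layer_energy (c := g * ρ₂ 0) (d := d) (Q := Q₂) hΦ₂ hγ₂ hd₂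
    hS.smooth_upper hP.smooth_upper ci ci' cs cs'
  have ev1 := eventually_forall_pos_add_mul (f := fun x => S.ηi x + d) (ci.add continuous_const) ci'
    (fun x => by simp only [hS.periodic_interface]) hP.periodic_interface
    (fun x => by linarith [(hSl x).1])
  have ev2 := eventually_forall_pos_add_mul (f := fun x => H - S.ηi x) (k := fun x => - P.ηi x)
    (continuous_const.sub ci) ci'.neg (fun x => by simp only [hS.periodic_interface])
    (fun x => by simp only [hP.periodic_interface])
    (fun x => by linarith [(hSl x).2.1, (hSl x).2.2])
  have ev3 := eventually_forall_pos_add_mul (f := fun x => S.ηs x + d) (cs.add continuous_const) cs'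
    (fun x => by simp only [hS.periodic_surface]) hP.periodic_surface
    (fun x => by linarith [(hSl x).1, (hSl x).2.1])
  have ev4 := eventually_forall_pos_add_mul (f := fun x => H - S.ηs x) (k := fun x => - P.ηs x)
    (continuous_const.sub cs) cs'.neg (fun x => by simp only [hS.periodic_surface])
    (fun x => by simp only [hP.periodic_surface]) (fun x => by linarith [(hSl x).2.2])
  refine ((h1.add h2).congr_deriv ?_).congr_of_eventuallyEq ?_
  · have c1 := continuous_density (c := g * ρ₁ p₁) (d := d) (Q := Q₁ + Q₂) hΦ₁ hS.smooth_lower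
    have c2 := continuous_density (c := g * ρ₂ 0) (d := d) (Q := Q₂) hΦ₂ hS.smooth_upper
    simp only [firstVariation, mul_sub, zero_mul, intervalIntegral.integral_zero]
    rw [intervalIntegral.integral_sub (Continuous.intervalIntegrable (by fun_prop) _ _)
      (Continuous.intervalIntegrable (by fun_prop) _ _)]
    ring
  · filter_upwards [ev1, ev2, ev3, ev4] with s e1 e2 e3 e4
    have m0 : (-d) ∈ Icc (-d) H := ⟨le_rfl, hdH⟩
    have m1 : ∀ x, S.ηi x + s * P.ηi x ∈ Icc (-d) H := fun x =>
      ⟨by linarith [e1 x], by linarith [e2 x]⟩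
    have m2 : ∀ x, S.ηs x + s * P.ηs x ∈ Icc (-d) H := fun x =>
      ⟨by linarith [e3 x], by linarith [e4 x]⟩
    simp only [energy, Flow.perturb, Pi.add_apply]
    congr 1
    · refine intervalIntegral.integral_congr fun x _ => ?_
      simp only [mul_zero, add_zero]
      refine intervalIntegral.integral_congr fun y hy => ?_
      simp only [density, clamp_of_mem (uIcc_subset_Icc m0 (m1 x) hy)]
    · refine intervalIntegral.integral_congr fun x _ => ?_
      refine intervalIntegral.integral_congr fun y hy => ?_
      simp only [density, clamp_of_mem (uIcc_subset_Icc (m1 x) (m2 x) hy)]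

theorem isCritical_iff_firstVariation {d : ℝ} {E : Flow → ℝ} {S : Flow} {V : Flow → ℝ}
    (h : ∀ P, P.IsClassical → HasDerivAt (fun s : ℝ => E (S.perturb P s)) (V P) 0) :
    IsCritical d E S ↔ ∀ P, S.IsPerturbation d P → V P = 0 := by
  refine forall_congr' fun P => imp_congr_right fun hP => ?_
  have hd := h P hP.classical
  exact ⟨fun h0 => hd.unique h0, fun h0 => h0 ▸ hd⟩

/-! ### Critical points and solutions -/

theorem flux_const (φ : ℝ × ℝ → ℝ) (r x : ℝ) : flux φ (fun _ => r) x = dy φ (x, r) := by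
  simp [flux]

theorem normalDeriv_mul_sqrt (φ : ℝ × ℝ → ℝ) (η : ℝ → ℝ) (x : ℝ) :
    normalDeriv φ η x * √(1 + deriv η x ^ 2) = flux φ η x :=
  div_mul_cancel₀ _ (Real.sqrt_pos.2 (by positivity)).ne'

theorem dx_sub_const (ψ : ℝ × ℝ → ℝ) (k : ℝ) : dx (fun z => ψ z - k) = dx ψ := by
  funext z
  simp only [dx, deriv_sub_const]

theorem dy_sub_const (ψ : ℝ × ℝ → ℝ) (k : ℝ) : dy (fun z => ψ z - k) = dy ψ := by
  funext z
  simp only [dy, deriv_sub_const]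

theorem gradSq_sub_const (ψ : ℝ × ℝ → ℝ) (k : ℝ) : gradSq (fun z => ψ z - k) = gradSq ψ := by
  funext z
  simp only [gradSq, dx_sub_const, dy_sub_const]

theorem lap_sub_const (ψ : ℝ × ℝ → ℝ) (k : ℝ) : lap (fun z => ψ z - k) = lap ψ := by
  funext z
  simp only [lap_eq, dx_sub_const, dy_sub_const]

theorem dx_zero (z : ℝ × ℝ) : dx (fun _ => (0 : ℝ)) z = 0 := deriv_const _ _

theorem dy_zero (z : ℝ × ℝ) : dy (fun _ => (0 : ℝ)) z = 0 := deriv_const _ _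

theorem lap_zero (z : ℝ × ℝ) : lap (fun _ => (0 : ℝ)) z = 0 := by
  rw [lap_eq, funext dx_zero, funext dy_zero, dx_zero, dy_zero, add_zero]

theorem eq_zero_on_closed_layer {f : ℝ × ℝ → ℝ} (hf : Continuous f) {a b : ℝ → ℝ}
    (ha : Continuous a) (hb : Continuous b) (hab : ∀ x, a x < b x)
    (h : ∀ x ∈ Ioo (-π) π, ∀ y, a x < y → y < b x → f (x, y) = 0) :
    ∀ x ∈ Icc (-π) π, ∀ y ∈ Icc (a x) (b x), f (x, y) = 0 := by
  intro x hx y hy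
  -- In the coordinates `(x, (y - a) / (b - a))` the layer is a rectangle.
  set G : ℝ × ℝ → ℝ := fun w => f (w.1, a w.1 + w.2 * (b w.1 - a w.1)) with hG
  have hGc : Continuous G := by fun_prop
  have h0 : EqOn G (fun _ => 0) (Ioo (-π) π ×ˢ Ioo (0 : ℝ) 1) := by
    rintro ⟨s, t⟩ ⟨hs, ht⟩
    have := sub_pos.2 (hab s)
    simp only [mem_Ioo] at ht
    exact h s hs _ (by simp only; nlinarith) (by simp only; nlinarith)
  have h1 := h0.closure hGc continuous_const
  rw [closure_prod_eq, closure_Ioo (by linarith [Real.pi_pos]), closure_Ioo zero_ne_one] at h1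
  have hpos := sub_pos.2 (hab x)
  have h2 : G (x, (y - a x) / (b x - a x)) = 0 := h1 (mk_mem_prod hx
    ⟨div_nonneg (by linarith [hy.1]) hpos.le, (div_le_one hpos).2 (by linarith [hy.2])⟩)
  rw [← h2]
  simp only [hG]
  rw [div_mul_cancel₀ _ hpos.ne', add_sub_cancel]

theorem integral_dy {ψ : ℝ × ℝ → ℝ} (hψ : ContDiff ℝ 1 ψ) (x r s : ℝ) :
    ∫ y in r..s, dy ψ (x, y) = ψ (x, s) - ψ (x, r) :=
  intervalIntegral.integral_eq_sub_of_hasDerivAt (fun y _ => hasDerivAt_dy hψ x y)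
    (((continuous_dy hψ).comp (Continuous.prodMk_right x)).intervalIntegrable _ _)

theorem Flow.isPerturbation_iff {S P : Flow} {d : ℝ} :
    S.IsPerturbation d P ↔ P.IsClassical ∧ ∫ x in (-π)..π, flux P.Ψ₁ (fun _ => -d) x = 0 ∧
      ∫ x in (-π)..π, flux P.Ψ₂ S.ηs x = 0 := by
  simp only [flux_const]
  simp only [← normalDeriv_mul_sqrt]
  exact ⟨fun h => ⟨h.1, h.2, h.3⟩, fun h => ⟨h.1, h.2.1, h.2.2⟩⟩

theorem isClassical_mk {Ψ₁ Ψ₂ : ℝ × ℝ → ℝ} {ηi ηs : ℝ → ℝ} (h₁ : ContDiff ℝ 2 Ψ₁)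
    (h₂ : ContDiff ℝ 2 Ψ₂) (h₃ : ContDiff ℝ 2 ηi) (h₄ : ContDiff ℝ 2 ηs)
    (p₁ : ∀ x y, Ψ₁ (x + 2 * π, y) = Ψ₁ (x, y)) (p₂ : ∀ x y, Ψ₂ (x + 2 * π, y) = Ψ₂ (x, y))
    (p₃ : ∀ x, ηi (x + 2 * π) = ηi x) (p₄ : ∀ x, ηs (x + 2 * π) = ηs x) :
    Flow.IsClassical ⟨Ψ₁, Ψ₂, ηi, ηs⟩ :=
  ⟨h₁, h₂, h₃, h₄, p₁, p₂, p₃, p₄⟩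

section Variation

variable {d Q₁ Q₂ c₁ c₂ : ℝ} {Φ₁ Φ₂ γ₁ γ₂ : ℝ → ℝ → ℝ} {S : Flow}

/-- The Euler-Lagrange system in terms of `γ = ∂_q F`. Here `k₁`, `k₂` are the constants by which
the stream functions are shifted and `l₁`, `l₂` the boundary values on the bottom and the
surface. -/
structure EulerLagrange (d Q₁ Q₂ c₁ c₂ : ℝ) (Φ₁ Φ₂ γ₁ γ₂ : ℝ → ℝ → ℝ) (S : Flow)
    (k₁ k₂ l₁ l₂ : ℝ) : Prop where
  lower : ∀ x, ∀ y ∈ Icc (-d) (S.ηi x), γ₁ y (lap S.Ψ₁ (x, y)) + S.Ψ₁ (x, y) = k₁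
  upper : ∀ x, ∀ y ∈ Icc (S.ηi x) (S.ηs x), γ₂ y (lap S.Ψ₂ (x, y)) + S.Ψ₂ (x, y) = k₂
  bottom : ∀ x, S.Ψ₁ (x, -d) = l₁
  interface_lower : ∀ x, S.Ψ₁ (x, S.ηi x) = k₁
  interface_upper : ∀ x, S.Ψ₂ (x, S.ηi x) = k₂
  surface : ∀ x, S.Ψ₂ (x, S.ηs x) = l₂
  density_interface : ∀ x, density c₁ d (Q₁ + Q₂) Φ₁ S.Ψ₁ (x, S.ηi x)
    = density c₂ d Q₂ Φ₂ S.Ψ₂ (x, S.ηi x)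
  density_surface : ∀ x, density c₂ d Q₂ Φ₂ S.Ψ₂ (x, S.ηs x) = 0

/-- Necessity: a vanishing first variation yields the Euler-Lagrange system. -/
theorem eulerLagrange_of_firstVariation (hΦ₁ : Continuous (Function.uncurry Φ₁))
    (hΦ₂ : Continuous (Function.uncurry Φ₂)) (hγ₁ : Continuous (Function.uncurry γ₁))
    (hγ₂ : Continuous (Function.uncurry γ₂)) (hS : S.IsClassical)
    (hSl : ∀ x, -d < S.ηi x ∧ S.ηi x < S.ηs x)
    (h : ∀ P, S.IsPerturbation d P → firstVariation d Q₁ Q₂ c₁ c₂ Φ₁ Φ₂ γ₁ γ₂ S P = 0) :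
    ∃ k₁ k₂ l₁ l₂, EulerLagrange d Q₁ Q₂ c₁ c₂ Φ₁ Φ₂ γ₁ γ₂ S k₁ k₂ l₁ l₂ := by
  have z2 : ContDiff ℝ 2 fun _ : ℝ × ℝ => (0 : ℝ) := contDiff_const
  have z1 : ContDiff ℝ 2 fun _ : ℝ => (0 : ℝ) := contDiff_const
  have f0 : ∀ c x, flux (fun _ => 0) c x = 0 := fun c x => by simp [flux, dx_zero, dy_zero]
  obtain ⟨k₁, l₁, e1, e2, e3⟩ := layer_rigidity_lower (a := fun _ => -d) (b := S.ηi) (ψ := S.Ψ₁)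
    (u := fun z => γ₁ z.2 (lap S.Ψ₁ z)) contDiff_const hS.smooth_interface (fun _ => rfl)
    hS.periodic_interface (fun x => (hSl x).1) hS.smooth_lower hS.periodic_lower
    (hγ₁.comp (continuous_snd.prodMk (continuous_lap hS.smooth_lower)))
    (fun x y => by simp only [lap_periodic hS.periodic_lower]) (by
      intro φ hφ hφp h0
      have := h ⟨φ, fun _ => 0, fun _ => 0, fun _ => 0⟩ (Flow.isPerturbation_iff.2
        ⟨isClassical_mk hφ z2 z1 z1 hφp (fun _ _ => rfl) (fun _ => rfl) fun _ => rfl, h0,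
          by simp [f0]⟩)
      simpa [firstVariation, dx_zero, dy_zero, lap_zero] using this)
  obtain ⟨k₂, l₂, e4, e5, e6⟩ := layer_rigidity_upper (a := S.ηi) (b := S.ηs) (ψ := S.Ψ₂)
    (u := fun z => γ₂ z.2 (lap S.Ψ₂ z)) hS.smooth_interface hS.smooth_surface
    hS.periodic_interface hS.periodic_surface (fun x => (hSl x).2) hS.smooth_upper hS.periodic_upper
    (hγ₂.comp (continuous_snd.prodMk (continuous_lap hS.smooth_upper)))
    (fun x y => by simp only [lap_periodic hS.periodic_upper]) (by
      intro φ hφ hφp h0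
      have := h ⟨fun _ => 0, φ, fun _ => 0, fun _ => 0⟩ (Flow.isPerturbation_iff.2
        ⟨isClassical_mk z2 hφ z1 z1 (fun _ _ => rfl) hφp (fun _ => rfl) fun _ => rfl,
          by simp [f0], h0⟩)
      simpa [firstVariation, dx_zero, dy_zero, lap_zero] using this)
  have ci := hS.smooth_interface.continuous
  have cs := hS.smooth_surface.continuous
  have cd₁ := continuous_density (c := c₁) (d := d) (Q := Q₁ + Q₂) hΦ₁ hS.smooth_lower
  have cd₂ := continuous_density (c := c₂) (d := d) (Q := Q₂) hΦ₂ hS.smooth_upper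
  have per : ∀ {c d Q : ℝ} {Φ : ℝ → ℝ → ℝ} {ψ : ℝ × ℝ → ℝ},
      (∀ x y, ψ (x + 2 * π, y) = ψ (x, y)) → ∀ x y,
      density c d Q Φ ψ (x + 2 * π, y) = density c d Q Φ ψ (x, y) := fun hψ x y => by
    simp only [density, gradSq, dx_periodic hψ, dy_periodic hψ, lap_periodic hψ]
  have e7 := eq_zero_of_integral_mul_periodic
    (q := fun x => density c₁ d (Q₁ + Q₂) Φ₁ S.Ψ₁ (x, S.ηi x)
      - density c₂ d Q₂ Φ₂ S.Ψ₂ (x, S.ηi x)) (by fun_prop)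
    (fun x => by
      simp only [hS.periodic_interface, per hS.periodic_lower, per hS.periodic_upper]) (by
      intro φ hφ hφp
      have := h ⟨fun _ => 0, fun _ => 0, φ, fun _ => 0⟩ (Flow.isPerturbation_iff.2
        ⟨isClassical_mk z2 z2 hφ z1 (fun _ _ => rfl) (fun _ _ => rfl) hφp fun _ => rfl,
          by simp [f0], by simp [f0]⟩)
      simpa [firstVariation, dx_zero, dy_zero, lap_zero] using this)
  have e8 := eq_zero_of_integral_mul_periodic
    (q := fun x => density c₂ d Q₂ Φ₂ S.Ψ₂ (x, S.ηs x)) (by fun_prop)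
    (fun x => by simp only [hS.periodic_surface, per hS.periodic_upper]) (by
      intro φ hφ hφp
      have := h ⟨fun _ => 0, fun _ => 0, fun _ => 0, φ⟩ (Flow.isPerturbation_iff.2
        ⟨isClassical_mk z2 z2 z1 hφ (fun _ _ => rfl) (fun _ _ => rfl) (fun _ => rfl) hφp,
          by simp [f0], by simp [f0]⟩)
      simpa [firstVariation, dx_zero, dy_zero, lap_zero] using this)
  exact ⟨k₁, k₂, l₁, l₂, e1, e4, e2, e3, e5, e6, fun x => sub_eq_zero.1 (e7 x), e8⟩

/-- Sufficiency: the Euler-Lagrange system makes the first variation vanish. -/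
theorem EulerLagrange.firstVariation_eq_zero {k₁ k₂ l₁ l₂ : ℝ}
    (h : EulerLagrange d Q₁ Q₂ c₁ c₂ Φ₁ Φ₂ γ₁ γ₂ S k₁ k₂ l₁ l₂) (hS : S.IsClassical)
    (hSl : ∀ x, -d < S.ηi x ∧ S.ηi x < S.ηs x) {P : Flow} (hP : S.IsPerturbation d P) :
    firstVariation d Q₁ Q₂ c₁ c₂ Φ₁ Φ₂ γ₁ γ₂ S P = 0 := by
  obtain ⟨hPc, hP1, hP2⟩ := Flow.isPerturbation_iff.1 hP
  have hi1 := hS.smooth_interface.of_le one_le_two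
  have hs1 := hS.smooth_surface.of_le one_le_two
  have g1 := layer_green (θ := fun z => S.Ψ₁ z - k₁) (φ := P.Ψ₁) (a := fun _ => -d) (b := S.ηi)
    ((hS.smooth_lower.of_le one_le_two).sub contDiff_const) hPc.smooth_lower
    (fun x y => by simp only [hS.periodic_lower]) hPc.periodic_lower contDiff_const hi1
    (fun _ => rfl) hS.periodic_interface
  have g2 := layer_green (θ := fun z => S.Ψ₂ z - k₂) (φ := P.Ψ₂) (a := S.ηi) (b := S.ηs)
    ((hS.smooth_upper.of_le one_le_two).sub contDiff_const) hPc.smooth_upper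
    (fun x y => by simp only [hS.periodic_upper]) hPc.periodic_upper hi1 hs1
    hS.periodic_interface hS.periodic_surface
  simp only [h.interface_lower, h.bottom, h.interface_upper, h.surface, sub_self, zero_mul,
    intervalIntegral.integral_zero, intervalIntegral.integral_const_mul, hP1, hP2, mul_zero,
    dx_sub_const, dy_sub_const] at g1 g2
  have v1 : (∫ x in (-π)..π, ∫ y in (-d)..(S.ηi x), (dx S.Ψ₁ (x, y) * dx P.Ψ₁ (x, y)
      + dy S.Ψ₁ (x, y) * dy P.Ψ₁ (x, y) - γ₁ y (lap S.Ψ₁ (x, y)) * lap P.Ψ₁ (x, y))) = 0 := by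
    rw [← g1]
    refine intervalIntegral.integral_congr fun x _ => intervalIntegral.integral_congr fun y hy => ?_
    rw [uIcc_of_le (hSl x).1.le] at hy
    linear_combination -(lap P.Ψ₁ (x, y)) * h.lower x y hy
  have v2 : (∫ x in (-π)..π, ∫ y in (S.ηi x)..(S.ηs x), (dx S.Ψ₂ (x, y) * dx P.Ψ₂ (x, y)
      + dy S.Ψ₂ (x, y) * dy P.Ψ₂ (x, y) - γ₂ y (lap S.Ψ₂ (x, y)) * lap P.Ψ₂ (x, y))) = 0 := by
    rw [← g2]
    refine intervalIntegral.integral_congr fun x _ => intervalIntegral.integral_congr fun y hy => ?_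
    rw [uIcc_of_le (hSl x).2.le] at hy
    linear_combination -(lap P.Ψ₂ (x, y)) * h.upper x y hy
  simp only [firstVariation, v1, v2, h.density_interface, h.density_surface, sub_self, mul_zero,
    intervalIntegral.integral_zero, add_zero]

end Variation

section System

variable {g d h H Q₁ Q₂ p₁ p₂ : ℝ} {ρ₁ ρ₂ β₁ β₂ : ℝ → ℝ} {F₁ F₂ : ℝ → ℝ → ℝ} {S : Flow}

/-- On the surface, where the vorticity is that of the stream function value `-p₂`, the energy
density is the defect in Bernoulli's law. -/
theorem density_surface_eq (hF : IsNormalized g d h p₁ p₂ ρ₁ ρ₂ β₁ β₂ F₁ F₂) (hH : H < h)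
    {ψ : ℝ × ℝ → ℝ} {x y : ℝ} (hy : y ∈ Icc (-d) H) (hlap : lap ψ (x, y) = vort g ρ₂ β₂ y p₂) :
    density (g * ρ₂ 0) d Q₂ (fun y => F₂ (clamp d H y)) ψ (x, y)
      = gradSq ψ (x, y) / 2 + g * ρ₂ p₂ * (y + d) - Q₂ := by
  simp only [density, clamp_of_mem hy, hlap, (hF y ⟨hy.1, hy.2.trans_lt hH⟩).1]
  ring

/-- On the interface, where the stream functions vanish, the difference of the energy densities is
the defect in the dynamic condition. -/
theorem density_interface_sub (hF : IsNormalized g d h p₁ p₂ ρ₁ ρ₂ β₁ β₂ F₁ F₂) (hH : H < h)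
    {ψ₁ ψ₂ : ℝ × ℝ → ℝ} {x y : ℝ} (hy : y ∈ Icc (-d) H)
    (hlap₁ : lap ψ₁ (x, y) = vort g ρ₁ β₁ y 0) (hlap₂ : lap ψ₂ (x, y) = vort g ρ₂ β₂ y 0) :
    density (g * ρ₁ p₁) d (Q₁ + Q₂) (fun y => F₁ (clamp d H y)) ψ₁ (x, y)
        - density (g * ρ₂ 0) d Q₂ (fun y => F₂ (clamp d H y)) ψ₂ (x, y)
      = (gradSq ψ₁ (x, y) - gradSq ψ₂ (x, y)) / 2 + g * (ρ₁ 0 - ρ₂ 0) * (y + d) - Q₁ := by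
  simp only [density, clamp_of_mem hy, hlap₁, hlap₂, (hF y ⟨hy.1, hy.2.trans_lt hH⟩).2]
  ring

/-- The Euler-Lagrange system is the system for stratified waves. -/
theorem eulerLagrange_iff_solves (hρ₁ : ContDiff ℝ 1 ρ₁) (hρ₂ : ContDiff ℝ 1 ρ₂)
    (hβ₁ : Continuous β₁) (hβ₂ : Continuous β₂)
    (hF₁ : IsPotential g d h ρ₁ β₁ F₁) (hF₂ : IsPotential g d h ρ₂ β₂ F₂)
    (hF : IsNormalized g d h p₁ p₂ ρ₁ ρ₂ β₁ β₂ F₁ F₂) (hS : S.IsClassical) (hdH : -d ≤ H)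
    (hH : H < h) (hSl : S.IsLayered d H) (k₁ k₂ : ℝ) :
    EulerLagrange d Q₁ Q₂ (g * ρ₁ p₁) (g * ρ₂ 0) (fun y => F₁ (clamp d H y))
        (fun y => F₂ (clamp d H y)) (fun y => deriv (F₁ (clamp d H y)))
        (fun y => deriv (F₂ (clamp d H y))) S k₁ k₂ (k₁ - p₁) (k₂ - p₂)
      ↔ Solves g d Q₁ Q₂ p₁ p₂ ρ₁ ρ₂ β₁ β₂ (S.shift k₁ k₂) := by
  have mem₁ : ∀ x, ∀ y ∈ Icc (-d) (S.ηi x), y ∈ Icc (-d) H := fun x y hy =>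
    ⟨hy.1, hy.2.trans ((hSl x).2.1.le.trans (hSl x).2.2.le)⟩
  have mem₂ : ∀ x, ∀ y ∈ Icc (S.ηi x) (S.ηs x), y ∈ Icc (-d) H := fun x y hy =>
    ⟨(hSl x).1.le.trans hy.1, hy.2.trans (hSl x).2.2.le⟩
  have eq₁ : ∀ {x y k : ℝ}, y ∈ Icc (-d) H →
      (deriv (F₁ (clamp d H y)) (lap S.Ψ₁ (x, y)) + S.Ψ₁ (x, y) = k ↔
        lap S.Ψ₁ (x, y) = vort g ρ₁ β₁ y (k - S.Ψ₁ (x, y))) := fun hy => by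
    rw [← hF₁.deriv_clamp_eq_iff hH hy, eq_sub_iff_add_eq]
  have eq₂ : ∀ {x y k : ℝ}, y ∈ Icc (-d) H →
      (deriv (F₂ (clamp d H y)) (lap S.Ψ₂ (x, y)) + S.Ψ₂ (x, y) = k ↔
        lap S.Ψ₂ (x, y) = vort g ρ₂ β₂ y (k - S.Ψ₂ (x, y))) := fun hy => by
    rw [← hF₂.deriv_clamp_eq_iff hH hy, eq_sub_iff_add_eq]
  have iL : ∀ x, S.ηi x ∈ Icc (-d) (S.ηi x) := fun x => right_mem_Icc.2 (hSl x).1.le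
  have iU : ∀ x, S.ηi x ∈ Icc (S.ηi x) (S.ηs x) := fun x => left_mem_Icc.2 (hSl x).2.1.le
  have sU : ∀ x, S.ηs x ∈ Icc (S.ηi x) (S.ηs x) := fun x => right_mem_Icc.2 (hSl x).2.1.le
  constructor
  · intro E
    have l₁ : ∀ x, ∀ y ∈ Icc (-d) (S.ηi x),
        lap S.Ψ₁ (x, y) = vort g ρ₁ β₁ y (k₁ - S.Ψ₁ (x, y)) := fun x y hy =>
      (eq₁ (mem₁ x y hy)).1 (E.lower x y hy)
    have l₂ : ∀ x, ∀ y ∈ Icc (S.ηi x) (S.ηs x),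
        lap S.Ψ₂ (x, y) = vort g ρ₂ β₂ y (k₂ - S.Ψ₂ (x, y)) := fun x y hy =>
      (eq₂ (mem₂ x y hy)).1 (E.upper x y hy)
    constructor
    · rintro ⟨x, y⟩ ⟨-, h1, h2⟩
      simp only [Flow.shift, lap_sub_const]
      rw [l₁ x y ⟨h1.le, h2.le⟩]
      simp only [vort, neg_sub]
    · rintro ⟨x, y⟩ ⟨-, h1, h2⟩
      simp only [Flow.shift, lap_sub_const]
      rw [l₂ x y ⟨h1.le, h2.le⟩]
      simp only [vort, neg_sub]
    · intro x
      have h1 := l₂ x _ (sU x)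
      rw [E.surface, sub_sub_cancel] at h1
      have h2 := density_surface_eq (Q₂ := Q₂) hF hH (mem₂ x _ (sU x)) h1
      rw [E.density_surface] at h2
      simp only [Flow.shift, gradSq_sub_const, E.surface, sub_sub_cancel_left, neg_neg]
      linarith
    · intro x
      have h1 := l₁ x _ (iL x)
      have h2 := l₂ x _ (iU x)
      rw [E.interface_lower, sub_self] at h1
      rw [E.interface_upper, sub_self] at h2
      have h3 := density_interface_sub (Q₁ := Q₁) (Q₂ := Q₂) hF hH (mem₁ x _ (iL x)) h1 h2
      rw [E.density_interface, sub_self] at h3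
      simp only [Flow.shift, gradSq_sub_const, E.interface_lower, E.interface_upper, sub_self,
        neg_zero]
      linarith
    · exact fun x => by simp only [Flow.shift, E.interface_lower, sub_self]
    · exact fun x => by simp only [Flow.shift, E.interface_upper, sub_self]
    · exact fun x => by simp only [Flow.shift, E.bottom, sub_sub_cancel_left]
    · exact fun x => by simp only [Flow.shift, E.surface, sub_sub_cancel_left]
  · intro T
    have b1 : ∀ x, S.Ψ₁ (x, S.ηi x) = k₁ := fun x => sub_eq_zero.1 (T.interface_lower x)
    have b2 : ∀ x, S.Ψ₂ (x, S.ηi x) = k₂ := fun x => sub_eq_zero.1 (T.interface_upper x)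
    have b3 : ∀ x, S.Ψ₁ (x, -d) = k₁ - p₁ := fun x => by
      have h1 : S.Ψ₁ (x, -d) - k₁ = -p₁ := T.bottom x
      linarith
    have b4 : ∀ x, S.Ψ₂ (x, S.ηs x) = k₂ - p₂ := fun x => by
      have h1 : S.Ψ₂ (x, S.ηs x) - k₂ = -p₂ := T.surface x
      linarith
    have ext : ∀ {a b : ℝ → ℝ} {γ : ℝ → ℝ → ℝ} {ψ : ℝ × ℝ → ℝ} {k : ℝ}, Continuous a →
        Continuous b → (∀ x, a x < b x) → (∀ x, a (x + 2 * π) = a x) →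
        (∀ x, b (x + 2 * π) = b x) → Continuous (Function.uncurry γ) → ContDiff ℝ 2 ψ →
        (∀ x y, ψ (x + 2 * π, y) = ψ (x, y)) →
        (∀ x ∈ Ioo (-π) π, ∀ y, a x < y → y < b x → γ y (lap ψ (x, y)) + ψ (x, y) = k) →
        ∀ x, ∀ y ∈ Icc (a x) (b x), γ y (lap ψ (x, y)) + ψ (x, y) = k := by
      intro a b γ ψ k ha hb hab hap hbp hγ hψ hψp hi x y hy
      have hcl := continuous_lap hψ
      have hγl : Continuous fun z : ℝ × ℝ => γ z.2 (lap ψ z) := hγ.comp (continuous_snd.prodMk hcl)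
      have h0 := eq_zero_on_closed_layer (f := fun z => γ z.2 (lap ψ z) + ψ z - k)
        ((hγl.add hψ.continuous).sub continuous_const) ha hb hab
        fun x hx y h1 h2 => sub_eq_zero.2 (hi x hx y h1 h2)
      obtain ⟨n, hn⟩ := periodic_exists_mem_Icc x
      have h1 := h0 _ hn y (by rwa [periodic_add_int hap, periodic_add_int hbp])
      have e := periodic_add_int (f := fun x => γ y (lap ψ (x, y)) + ψ (x, y))
        (fun x => by simp only [lap_periodic hψp, hψp]) x n
      exact e.symm.trans (sub_eq_zero.1 h1)
    have ci := hS.smooth_interface.continuous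
    have cs := hS.smooth_surface.continuous
    have E1 : ∀ x, ∀ y ∈ Icc (-d) (S.ηi x),
        deriv (F₁ (clamp d H y)) (lap S.Ψ₁ (x, y)) + S.Ψ₁ (x, y) = k₁ :=
      ext (a := fun _ => -d) (γ := fun y => deriv (F₁ (clamp d H y))) continuous_const ci
        (fun x => (hSl x).1) (fun _ => rfl) hS.periodic_interface
        (hF₁.continuous_deriv_clamp hρ₁ hβ₁ hdH hH) hS.smooth_lower hS.periodic_lower
        fun x hx y h1 h2 => by
          rw [eq₁ (mem₁ x y ⟨h1.le, h2.le⟩)]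
          have := T.eq_lower (x, y) ⟨hx, h1, h2⟩
          simp only [Flow.shift, lap_sub_const] at this
          rw [this]
          simp only [vort, neg_sub]
    have E2 : ∀ x, ∀ y ∈ Icc (S.ηi x) (S.ηs x),
        deriv (F₂ (clamp d H y)) (lap S.Ψ₂ (x, y)) + S.Ψ₂ (x, y) = k₂ :=
      ext (γ := fun y => deriv (F₂ (clamp d H y))) ci cs (fun x => (hSl x).2.1)
        hS.periodic_interface hS.periodic_surface
        (hF₂.continuous_deriv_clamp hρ₂ hβ₂ hdH hH) hS.smooth_upper hS.periodic_upper
        fun x hx y h1 h2 => by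
          rw [eq₂ (mem₂ x y ⟨h1.le, h2.le⟩)]
          have := T.eq_upper (x, y) ⟨hx, h1, h2⟩
          simp only [Flow.shift, lap_sub_const] at this
          rw [this]
          simp only [vort, neg_sub]
    refine ⟨E1, E2, b3, b1, b2, b4, fun x => ?_, fun x => ?_⟩
    · have h1 := (eq₁ (mem₁ x _ (iL x))).1 (E1 x _ (iL x))
      have h2 := (eq₂ (mem₂ x _ (iU x))).1 (E2 x _ (iU x))
      rw [b1, sub_self] at h1
      rw [b2, sub_self] at h2
      have h3 := density_interface_sub (Q₁ := Q₁) (Q₂ := Q₂) hF hH (mem₁ x _ (iL x)) h1 h2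
      have h4 := T.bernoulli_interface x
      simp only [Flow.shift, gradSq_sub_const, b1, b2, sub_self, neg_zero] at h4
      rw [← sub_eq_zero, h3]
      linarith
    · have h1 := (eq₂ (mem₂ x _ (sU x))).1 (E2 x _ (sU x))
      rw [b4, sub_sub_cancel] at h1
      rw [density_surface_eq (Q₂ := Q₂) hF hH (mem₂ x _ (sU x)) h1]
      have h4 := T.bernoulli_surface x
      simp only [Flow.shift, gradSq_sub_const, b4, sub_sub_cancel_left, neg_neg] at h4
      linarith

end System

end TwoLayer

theorem theorem1 (g d h Q₁ Q₂ p₁ p₂ x₀ : ℝ) (ρ₁ ρ₂ β₁ β₂ : ℝ → ℝ)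
    (hρ₁ : ContDiff ℝ 1 ρ₁) (hρ₂ : ContDiff ℝ 1 ρ₂)
    (hβ₁ : Continuous β₁) (hβ₂ : Continuous β₂)
    (F₁ F₂ : ℝ → ℝ → ℝ)
    (hF₁ : TwoLayer.IsPotential g d h ρ₁ β₁ F₁)
    (hF₂ : TwoLayer.IsPotential g d h ρ₂ β₂ F₂)
    (hF : TwoLayer.IsNormalized g d h p₁ p₂ ρ₁ ρ₂ β₁ β₂ F₁ F₂)
    (S : TwoLayer.Flow) (hS : S.IsClassical) (hlay : S.IsLayered d h) :
    (TwoLayer.IsCritical d (TwoLayer.energy g d Q₁ Q₂ p₁ ρ₁ ρ₂ F₁ F₂) S ∧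
        S.HasFluxes d p₁ p₂ x₀) ↔
      ∃ k₁ k₂ : ℝ,
        TwoLayer.Solves g d Q₁ Q₂ p₁ p₂ ρ₁ ρ₂ β₁ β₂ (S.shift k₁ k₂) := by
  open TwoLayer in
  obtain ⟨H, hdH, hH, hsH⟩ := hlay.exists_height hS
  have hSl : S.IsLayered d H := fun x => ⟨(hlay x).1, (hlay x).2.1, hsH x⟩
  have hSl' : ∀ x, -d < S.ηi x ∧ S.ηi x < S.ηs x := fun x => ⟨(hlay x).1, (hlay x).2.1⟩
  have cΦ₁ := hF.continuous_lower hF₁ hF₂ hρ₁ hρ₂ hβ₁ hβ₂ hdH hH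
  have cΦ₂ := hF.continuous_upper hF₂ hρ₂ hβ₂ hdH hH
  have cγ₁ := hF₁.continuous_deriv_clamp hρ₁ hβ₁ hdH hH
  have cγ₂ := hF₂.continuous_deriv_clamp hρ₂ hβ₂ hdH hH
  have crit := isCritical_iff_firstVariation (d := d)
    (E := energy g d Q₁ Q₂ p₁ ρ₁ ρ₂ F₁ F₂) (S := S) fun P hP =>
    hasDerivAt_energy cΦ₁ cΦ₂ cγ₁ cγ₂ (hF₁.hasDerivAt_clamp hdH hH) (hF₂.hasDerivAt_clamp hdH hH)
      hS hP hSl hdH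
  have hfl : S.HasFluxes d p₁ p₂ x₀ ↔ S.Ψ₁ (x₀, S.ηi x₀) - S.Ψ₁ (x₀, -d) = p₁ ∧
      -(S.Ψ₂ (x₀, S.ηs x₀) - S.Ψ₂ (x₀, S.ηi x₀)) = p₂ := by
    rw [Flow.HasFluxes, integral_dy (hS.smooth_lower.of_le one_le_two),
      integral_dy (hS.smooth_upper.of_le one_le_two)]
  simp only [← eulerLagrange_iff_solves hρ₁ hρ₂ hβ₁ hβ₂ hF₁ hF₂ hF hS hdH hH hSl]
  rw [crit, hfl]
  constructor
  · rintro ⟨hc, h1, h2⟩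
    obtain ⟨k₁, k₂, l₁, l₂, E⟩ := eulerLagrange_of_firstVariation cΦ₁ cΦ₂ cγ₁ cγ₂ hS hSl' hc
    rw [E.interface_lower, E.bottom] at h1
    rw [E.surface, E.interface_upper] at h2
    refine ⟨k₁, k₂, ?_⟩
    rwa [show k₁ - p₁ = l₁ by linarith, show k₂ - p₂ = l₂ by linarith]
  · rintro ⟨k₁, k₂, E⟩
    refine ⟨fun P hP => E.firstVariation_eq_zero hS hSl' hP, ?_, ?_⟩
    · rw [E.interface_lower, E.bottom, sub_sub_cancel]
    · rw [E.surface, E.interface_upper]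
      ring
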